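/- Fix a countably infinite set of names and a countably infinite set of name variables. The terms of the $\pi$-calculus are \[ S,T ::= \mathbf 0 \mid \textstyle\sum_{i\in I} n(x).T_i \mid \sum_{i\in I}\overline n m_i.T_i \mid S\,|\,T \mid (c)T \mid [p{=}q]T \mid [p{\neq}q]T \mid\; !n(x).T \mid\; !\overline n m.T , \] where $I$ is finite and nonempty, $x$ is a name variable (bound in $n(x).T_i$ and $n(x).T$), $c$ is a name (local in $(c)T$), and $n,m,m_i,p,q$ are names or name variables. Terms are taken up to $\alpha$-conversion; processes are the terms without free name variables; $gn(P)$ is the set of the global (that is, non-local) names of $P$. The actions are $\tau$ and the external actions $\ell$: inputs $ab$, outputs $\overline ab$ and bound outputs $\overline a(c)$. The transitions $\xrightarrow{\lambda}$ are generated by the following rules and the symmetric forms of the composition rules, where bound names are taken different from all other names: * $\sum_{i\in I} a(x).T_i\xrightarrow{ac}T_i\{c/x\}$ and $\sum_{i\in I}\overline ac_i.T_i\xrightarrow{\overline ac_i}T_i$ for $i\in I$; * if $T\xrightarrow{\lambda}T'$ then $S\,|\,T\xrightarrow{\lambda}S\,|\,T'$; if $S\xrightarrow{ab}S'$ and $T\xrightarrow{\overline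 ab}T'$ then $S\,|\,T\xrightarrow{\tau}S'\,|\,T'$; if $S\xrightarrow{ac}S'$ and $T\xrightarrow{\overline a(c)}T'$ then $S\,|\,T\xrightarrow{\tau}(c)(S'\,|\,T')$; * if $T\xrightarrow{\overline ac}T'$ with $a\ne c$ then $(c)T\xrightarrow{\overline a(c)}T'$; if $T\xrightarrow{\lambda}T'$ and $c$ does not occur in $\lambda$ then $(c)T\xrightarrow{\lambda}(c)T'$; * if $T\xrightarrow{\lambda}T'$ then $[a{=}a]T\xrightarrow{\lambda}T'$, and $[a{\neq}b]T\xrightarrow{\lambda}T'$ for distinct names $a,b$; * $!\overline ab.T\xrightarrow{\overline ab}T\,|\,!\overline ab.T$ and $!a(x).T\xrightarrow{ab}T\{b/x\}\,|\,!a(x).T$. Let $\Longrightarrow$ be the reflexive transitive closure of $\xrightarrow{\tau}$ and $\overset{\tau}{\Longrightarrow}$ its transitive closure. A process $P$ is observable if $P\Longrightarrow\xrightarrow{\ell}P'$ for some $P'$ and some external $\ell$. A binary relation $\mathcal R$ on processes is * *equipollent* if $P\mathcal RQ$ implies that $P$ is observable iff $Q$ is; * *extensional* if $L\mathcal RM$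 and $P\mathcal RQ$ imply $(L\,|\,P)\,\mathcal R\,(M\,|\,Q)$, and $P\mathcal RQ$ implies $(c)P\,\mathcal R\,(c)Q$ for every name $c$; * *codivergent* if, whenever $P\mathcal RQ$ and $Q\xrightarrow{\tau}Q_1\xrightarrow{\tau}Q_2\xrightarrow{\tau}\cdots$ is infinite, there are $k\ge1$ and $P'$ with $P\overset{\tau}{\Longrightarrow}P'$ and $P'\mathcal RQ_k$, and symmetrically for the infinite $\tau$-sequences of $P$; * a *(branching) bisimulation* if, whenever $P\mathcal RQ$ and $P\xrightarrow{\tau}P'$, either $Q\Longrightarrow Q'$ for some $Q'$ with $P\mathcal RQ'$ and $P'\mathcal RQ'$, or $Q\Longrightarrow Q''\xrightarrow{\tau}Q'$ for some $Q'',Q'$ with $P\mathcal RQ''$ and $P'\mathcal RQ'$; and symmetrically for the $\tau$-actions of $Q$; * a *$\pi$-bisimulation* if it is a codivergent bisimulation such that, for every external action $\ell$, whenever $P\mathcal RQ$ and $P\xrightarrow{\ell}P'$ (where $b\notin gn(Q)$ if $\ell=\overline a(b)$), there are $Q'',Q'$ with $Q\Longrightarrow Q''\xrightarrow{\ell}Q'$,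 $P\mathcal RQ''$ and $P'\mathcal RQ'$; and symmetrically for the external actions of $Q$. **Theorem.** There is a largest $\pi$-bisimulation $\simeq_\pi$, the external $\pi$-bisimilarity, namely the union of all $\pi$-bisimulations. There is a largest reflexive, equipollent, extensional, codivergent bisimulation $=_\pi$, the absolute equality, namely the union of all such relations. The two coincide: for all processes $P,Q$, $P\simeq_\pi Q$ if and only if $P=_\pi Q$. -/

import Mathlib

/-! The pi-calculus with uniform input choice, uniform output choice, composition, localization,
match, mismatch and guarded replication. Global names are natural numbers; occurrences of bound name
variables and of local names are de Bruijn indices, so that terms are taken up to alpha-conversion. -/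

namespace PiCalc

/-- The countably infinite set of names. -/
abbrev Name : Type := ℕ

/-- A name occurrence in the scope of `n` binders: a global name, or a reference to a binder
(index `0` is the innermost one). The binder (input prefix or localization) determines whether a
bound reference is a name variable or a local name. -/
inductive Nm (n : ℕ) : Type
  | free (a : Name) : Nm n
  | bound (i : Fin n) : Nm n

/-- Pi-terms in the scope of `n` binders, up to alpha-conversion. The index set of a choice is the
nonempty finite set `Fin (k + 1)`. -/
inductive Term : ℕ → Type
  /-- the inactive term -/
  | nil {n : ℕ} : Term n
  /-- input choice: the sum over `i` of `m(x).T i`, where `x` is index `0` in `T i` -/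
  | inp {n : ℕ} (m : Nm n) (k : ℕ) (T : Fin (k + 1) → Term (n + 1)) : Term n
  /-- output choice: the sum over `i` of the terms that send `o i` along `m` and become `T i` -/
  | out {n : ℕ} (m : Nm n) (k : ℕ) (o : Fin (k + 1) → Nm n) (T : Fin (k + 1) → Term n) : Term n
  /-- concurrent composition -/
  | par {n : ℕ} (S T : Term n) : Term n
  /-- localization `(c)T`, where `c` is index `0` in `T` -/
  | res {n : ℕ} (T : Term (n + 1)) : Term n
  /-- match `[p = q]T` -/
  | mat {n : ℕ} (p q : Nm n) (T : Term n) : Term n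
  /-- mismatch `[p ≠ q]T` -/
  | mis {n : ℕ} (p q : Nm n) (T : Term n) : Term n
  /-- guarded replication `!m(x).T`, where `x` is index `0` in `T` -/
  | repIn {n : ℕ} (m : Nm n) (T : Term (n + 1)) : Term n
  /-- guarded replication of the output prefix that sends `o` along `m` -/
  | repOut {n : ℕ} (m o : Nm n) (T : Term n) : Term n

/-- The processes are the closed terms. -/
abbrev Proc : Type := Term 0

/-- Entering one more binder. -/
def Nm.shift {n : ℕ} : Nm n → Nm (n + 1)
  | .free a => .free a
  | .bound i => .bound i.succ

/-- The action of a map of names under one more binder. -/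
def Nm.lift {n m : ℕ} (f : Nm n → Nm m) : Nm (n + 1) → Nm (m + 1)
  | .free a => (f (.free a)).shift
  | .bound i => Fin.cases (.bound 0) (fun j => (f (.bound j)).shift) i

/-- Capture-avoiding simultaneous replacement of names. -/
def Term.map : {n m : ℕ} → (Nm n → Nm m) → Term n → Term m
  | _, _, _, .nil => .nil
  | _, _, f, .inp c k T => .inp (f c) k (fun i => (T i).map (Nm.lift f))
  | _, _, f, .out c k o T => .out (f c) k (fun i => f (o i)) (fun i => (T i).map f)
  | _, _, f, .par S T => .par (S.map f) (T.map f)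
  | _, _, f, .res T => .res (T.map (Nm.lift f))
  | _, _, f, .mat p q T => .mat (f p) (f q) (T.map f)
  | _, _, f, .mis p q T => .mis (f p) (f q) (T.map f)
  | _, _, f, .repIn c T => .repIn (f c) (T.map (Nm.lift f))
  | _, _, f, .repOut c o T => .repOut (f c) (f o) (T.map f)

/-- The global names of a name occurrence. -/
def Nm.gn {n : ℕ} : Nm n → Finset Name
  | .free a => {a}
  | .bound _ => ∅

/-- The set of the global names of a term. -/
def Term.gn : {n : ℕ} → Term n → Finset Name
  | _, .nil => ∅
  | _, .inp c _ T => c.gn ∪ Finset.univ.biUnion (fun i => (T i).gn)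
  | _, .out c _ o T => c.gn ∪ Finset.univ.biUnion (fun i => (o i).gn ∪ (T i).gn)
  | _, .par S T => S.gn ∪ T.gn
  | _, .res T => T.gn
  | _, .mat p q T => p.gn ∪ q.gn ∪ T.gn
  | _, .mis p q T => p.gn ∪ q.gn ∪ T.gn
  | _, .repIn c T => c.gn ∪ T.gn
  | _, .repOut c o T => c.gn ∪ o.gn ∪ T.gn

/-- Replace the outermost bound reference by the global name `c`. -/
def instNm (c : Name) : Nm 1 → Nm 0
  | .free a => .free a
  | .bound _ => .free c

/-- Turn the global name `c` into the outermost bound reference. -/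
def absNm (c : Name) : Nm 0 → Nm 1
  | .free a => if a = c then .bound 0 else .free a
  | .bound i => .bound i.succ

/-- The body of a binder with the global name `c` put for the reference to it: `T{c/x}`. -/
def Term.inst (T : Term 1) (c : Name) : Proc := T.map (instNm c)

/-- The localization `(c)P` of a global name `c` of a process `P`. -/
def nu (c : Name) (P : Proc) : Proc := .res (P.map (absNm c))

/-- Actions: the internal action, the input `ab`, the output of the global name `b` along `a`,
and the bound output of the local name `c` along `a`. -/
inductive Act : Type
  | tau : Act
  | inp (a b : Name) : Act
  | out (a b : Name) : Act
  | bout (a c : Name) : Act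

/-- The names that occur in an action. -/
def Act.names : Act → Finset Name
  | .tau => ∅
  | .inp a b => {a, b}
  | .out a b => {a, b}
  | .bout a c => {a, c}

/-- The bound names of an action. -/
def Act.bn : Act → Finset Name
  | .bout _ c => {c}
  | _ => ∅

/-- The labelled transition system. In the rules for localization the local name is represented by
an arbitrary name `c` that is not global in the body; the other side conditions spell out the
convention that bound names are different from all other names. -/
inductive Step : Proc → Act → Proc → Prop
  | inp (a c : Name) (k : ℕ) (T : Fin (k + 1) → Term 1) (i : Fin (k + 1)) :
      Step (.inp (.free a) k T) (.inp a c) ((T i).inst c)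
  | out (a : Name) (k : ℕ) (c : Fin (k + 1) → Name) (T : Fin (k + 1) → Proc) (i : Fin (k + 1)) :
      Step (.out (.free a) k (fun j => .free (c j)) T) (.out a (c i)) (T i)
  | parR {S T T' : Proc} {l : Act} : Step T l T' → Disjoint l.bn S.gn →
      Step (.par S T) l (.par S T')
  | parL {S T S' : Proc} {l : Act} : Step S l S' → Disjoint l.bn T.gn →
      Step (.par S T) l (.par S' T)
  | commR {S T S' T' : Proc} {a b : Name} : Step S (.inp a b) S' → Step T (.out a b) T' →
      Step (.par S T) .tau (.par S' T')
  | commL {S T S' T' : Proc} {a b : Name} : Step S (.out a b) S' → Step T (.inp a b) T' →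
      Step (.par S T) .tau (.par S' T')
  | closeR {S T S' T' : Proc} {a c : Name} : Step S (.inp a c) S' → Step T (.bout a c) T' →
      c ∉ S.gn → Step (.par S T) .tau (nu c (.par S' T'))
  | closeL {S T S' T' : Proc} {a c : Name} : Step S (.bout a c) S' → Step T (.inp a c) T' →
      c ∉ T.gn → Step (.par S T) .tau (nu c (.par S' T'))
  | extrude {T : Term 1} {T' : Proc} {a c : Name} : c ∉ T.gn → Step (T.inst c) (.out a c) T' →
      a ≠ c → Step (.res T) (.bout a c) T'
  | res {T : Term 1} {T' : Proc} {l : Act} {c : Name} : c ∉ T.gn → Step (T.inst c) l T' →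
      c ∉ l.names → Step (.res T) l (nu c T')
  | mat {T T' : Proc} {l : Act} (a : Name) : Step T l T' →
      Step (.mat (.free a) (.free a) T) l T'
  | mis {T T' : Proc} {l : Act} (a b : Name) : a ≠ b → Step T l T' →
      Step (.mis (.free a) (.free b) T) l T'
  | repOut (a b : Name) (T : Proc) :
      Step (.repOut (.free a) (.free b) T) (.out a b) (.par T (.repOut (.free a) (.free b) T))
  | repIn (a b : Name) (T : Term 1) :
      Step (.repIn (.free a) T) (.inp a b) (.par (T.inst b) (.repIn (.free a) T))

/-- A single internal action. -/
def Tau (P P' : Proc) : Prop := Step P .tau P'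

/-- Zero or more internal actions. -/
def Taus : Proc → Proc → Prop := Relation.ReflTransGen Tau

/-- One or more internal actions. -/
def TausPlus : Proc → Proc → Prop := Relation.TransGen Tau

/-- A process is observable if it can perform an external action after some internal actions. -/
def Observable (P : Proc) : Prop :=
  ∃ (P₁ P' : Proc) (l : Act), l ≠ .tau ∧ Taus P P₁ ∧ Step P₁ l P'

/-- The (branching) bisimulation property. -/
structure IsBisimulation (R : Proc → Proc → Prop) : Prop where
  left : ∀ {P Q P' : Proc}, R P Q → Tau P P' →
    (∃ Q', Taus Q Q' ∧ R P Q' ∧ R P' Q') ∨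
    (∃ Q'' Q', Taus Q Q'' ∧ R P Q'' ∧ Tau Q'' Q' ∧ R P' Q')
  right : ∀ {P Q Q' : Proc}, R P Q → Tau Q Q' →
    (∃ P', Taus P P' ∧ R P' Q ∧ R P' Q') ∨
    (∃ P'' P', Taus P P'' ∧ R P'' Q ∧ Tau P'' P' ∧ R P' Q')

/-- Codivergence: an infinite internal action sequence of one process is answered by at least one
internal action of the other that leads to a process related to a later point of the sequence. -/
structure IsCodivergent (R : Proc → Proc → Prop) : Prop where
  left : ∀ {P Q : Proc}, R P Q → ∀ s : ℕ → Proc, s 0 = Q → (∀ i, Tau (s i) (s (i + 1))) →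
    ∃ k P', 1 ≤ k ∧ TausPlus P P' ∧ R P' (s k)
  right : ∀ {P Q : Proc}, R P Q → ∀ s : ℕ → Proc, s 0 = P → (∀ i, Tau (s i) (s (i + 1))) →
    ∃ k Q', 1 ≤ k ∧ TausPlus Q Q' ∧ R (s k) Q'

/-- Closure under composition and localization. -/
structure IsExtensional (R : Proc → Proc → Prop) : Prop where
  par : ∀ {L M P Q : Proc}, R L M → R P Q → R (.par L P) (.par M Q)
  nu : ∀ {P Q : Proc} (c : Name), R P Q → R (nu c P) (nu c Q)

/-- Related processes are both observable or both unobservable. -/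
def IsEquipollent (R : Proc → Proc → Prop) : Prop :=
  ∀ P Q, R P Q → (Observable P ↔ Observable Q)

/-- The requirements on a relation in the definition of the absolute equality. -/
structure IsAbsolute (R : Proc → Proc → Prop) : Prop where
  refl : ∀ P, R P P
  equipollent : IsEquipollent R
  extensional : IsExtensional R
  codivergent : IsCodivergent R
  bisimulation : IsBisimulation R

/-- Codivergent bisimulations that explicitly simulate every external action. By the convention on
bound names, the name of a bound output to be simulated is not a global name of the simulating
process. -/
structure IsPiBisimulation (R : Proc → Proc → Prop) : Prop where
  codivergent : IsCodivergent R
  bisimulation : IsBisimulation R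
  left : ∀ {P Q P' : Proc} {l : Act}, l ≠ .tau → Disjoint l.bn Q.gn → R P Q → Step P l P' →
    ∃ Q'' Q', Taus Q Q'' ∧ Step Q'' l Q' ∧ R P' Q' ∧ R P Q''
  right : ∀ {P Q Q' : Proc} {l : Act}, l ≠ .tau → Disjoint l.bn P.gn → R P Q → Step Q l Q' →
    ∃ P'' P', Taus P P'' ∧ Step P'' l P' ∧ R P' Q' ∧ R P'' Q

/-- The absolute equality: the union of all relations that meet the requirements. -/
def AbsEq (P Q : Proc) : Prop := ∃ R : Proc → Proc → Prop, IsAbsolute R ∧ R P Q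

/-- The external bisimilarity: the union of all pi-bisimulations. -/
def PiBisimilar (P Q : Proc) : Prop := ∃ R : Proc → Proc → Prop, IsPiBisimulation R ∧ R P Q

end PiCalc

/-!
The external bisimilarity and the absolute equality of the pi-calculus are each the union of all
relations with certain properties, so that two things have to be shown: the unions have these
properties again, and each of the two relations is contained in the other.

The external bisimilarity is a pi-bisimulation simply because pi-bisimulations are closed under
union. For the absolute equality only closure under composition `P | Q` needs an argument: its
witnesses compose (`IsAbsolute.comp`), where codivergence of a composite is the delicate property
(`codivAt_comp`).

*The external bisimilarity is absolute* (`piBisimilar_isAbsolute`). Its closure `Cl` under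
composition and localization is a pi-bisimulation. For codivergence, an infinite computation of
`P | L` that is never answered would descend in the product of two well-founded orders, one for the
internal actions of `P` and one for those of `L` (`codivAt_par`).

*The absolute equality is contained in the external bisimilarity* (`AbsEq.piBisimilar`). External
actions have to be recovered from internal actions and equipollence, by placing the processes next
to an observer. Since the absolute equality relates whole systems, and observers cannot be removed
again, the relation that is shown to be a pi-bisimulation (`EnvEq`, up to renaming `RenEq`) relates
`P` and `Q` if `(cs)(P | T)` and `(cs)(Q | T)` are absolutely equal for some environment `T` of the
form `Env cs H G T`. The environment grows with every simulated action, and stays inert otherwise.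

* A *signal* on `g` is the process that sends `g` along `g` forever. If the signal is active at the
  top level (`Loud`), then the process is not absolutely equal to one that does not know `g`
  (`Silent`): localize all names but `g` and use equipollence (`Silent.not_loud`). A process for
  which contexts can still bring about both outcomes is `Undecided`, and such a process is
  absolutely equal neither to a silent nor to a loud one (`Undecided.not_decided`).
* Any internal action in which the environment takes part decides a signal that was undecided. So
  as long as systems stay absolutely equal to undecided ones, all internal actions come from the
  processes (`Env.cfg_taus`); this gives the bisimulation property and codivergence for internal
  actions.
* For an external action along `a`, a *tester* is added to the environment: a choice along `a`, one
  of whose branches activates a new signal `g`. The interaction of `P` with the tester that destroys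
  the signal must be answered by an interaction of a successor of `Q` with the tester
  (`Env.test`), and the tester is such that only the same action avoids the signal: an input of `b`
  is tested by sending `b`, an output of `b` by a receiver that activates the signal for all names
  but `b`, and a bound output by a receiver that activates it for all global names of `Q`.
  As `a` may be a shared local name, no context can communicate with the tester directly. The
  tester therefore comes with a locked `probe`, which contexts can unlock along a new channel, and
  which then decides the signal either way.
* The extruded name of a bound output becomes a local name shared by process and environment. The
  environment offers it on a new channel forever. This makes it possible to add testers that know
  shared names: a receiver that does not know the name fetches it first (`Env.install`).
-/

namespace PiCalc

/-! ### Renaming of terms -/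

theorem Nm.lift_shift {n m : ℕ} (f : Nm n → Nm m) (x : Nm n) :
    Nm.lift f x.shift = (f x).shift := by
  cases x <;> simp [Nm.shift, Nm.lift]

theorem Nm.lift_comp {n m k : ℕ} (f : Nm n → Nm m) (g : Nm m → Nm k) :
    Nm.lift (g ∘ f) = Nm.lift g ∘ Nm.lift f := by
  funext x
  cases x with
  | free a => exact (Nm.lift_shift g (f (.free a))).symm
  | bound i =>
    refine Fin.cases rfl (fun j => ?_) i
    exact (Nm.lift_shift g (f (.bound j))).symm

theorem Nm.lift_id {n : ℕ} : Nm.lift (id : Nm n → Nm n) = id := by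
  funext x
  cases x with
  | free a => simp [Nm.lift, Nm.shift]
  | bound i => refine Fin.cases ?_ (fun j => ?_) i <;> simp [Nm.lift, Nm.shift]

theorem Term.map_map {n : ℕ} (T : Term n) : ∀ {m k : ℕ} (f : Nm n → Nm m) (g : Nm m → Nm k),
    (T.map f).map g = T.map (g ∘ f) := by
  induction T <;> intro m' k' f g <;> simp_all [Term.map, Nm.lift_comp]

theorem Term.map_id {n : ℕ} (T : Term n) : T.map id = T := by
  induction T <;> simp_all [Term.map, Nm.lift_id]

@[simp] theorem Nm.gn_shift {n : ℕ} (x : Nm n) : x.shift.gn = x.gn := by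
  cases x <;> rfl

/-- Maps that agree on the names in `s` and on the bound references agree under a binder as well. -/
theorem Nm.lift_congr {n m : ℕ} {f g : Nm n → Nm m} {s : Finset Name}
    (hfree : ∀ a ∈ s, f (.free a) = g (.free a)) (hbound : ∀ i, f (.bound i) = g (.bound i)) :
    (∀ a ∈ s, Nm.lift f (.free a) = Nm.lift g (.free a)) ∧
      ∀ i, Nm.lift f (.bound i) = Nm.lift g (.bound i) := by
  refine ⟨fun a ha => by simp [Nm.lift, hfree a ha], fun i => ?_⟩
  refine Fin.cases ?_ (fun j => ?_) i <;> simp [Nm.lift, hbound]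

theorem Nm.map_congr {n m : ℕ} {f g : Nm n → Nm m} (x : Nm n)
    (hfree : ∀ a ∈ x.gn, f (.free a) = g (.free a)) (hbound : ∀ i, f (.bound i) = g (.bound i)) :
    f x = g x := by
  cases x with
  | free a => exact hfree a (by simp [Nm.gn])
  | bound i => exact hbound i

theorem Term.map_congr {n : ℕ} (T : Term n) : ∀ {m : ℕ} (f g : Nm n → Nm m),
    (∀ a ∈ T.gn, f (.free a) = g (.free a)) → (∀ i, f (.bound i) = g (.bound i)) →
    T.map f = T.map g := by
  induction T with
  | nil => intros; rfl
  | inp m k T ih =>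
    intro m' f g h1 h2
    simp only [Term.gn, Finset.mem_union, Finset.mem_biUnion, Finset.mem_univ, true_and] at h1
    simp only [Term.map]
    congr 1
    · exact Nm.map_congr _ (fun a ha => h1 a (.inl ha)) h2
    · funext i
      have := Nm.lift_congr (s := (T i).gn) (fun a ha => h1 a (.inr ⟨i, ha⟩)) h2
      exact ih i _ _ this.1 this.2
  | out m k o T ih =>
    intro m' f g h1 h2
    simp only [Term.gn, Finset.mem_union, Finset.mem_biUnion, Finset.mem_univ, true_and] at h1
    simp only [Term.map]
    congr 1
    · exact Nm.map_congr _ (fun a ha => h1 a (.inl ha)) h2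
    · funext i
      exact Nm.map_congr _ (fun a ha => h1 a (.inr ⟨i, .inl ha⟩)) h2
    · funext i
      exact ih i _ _ (fun a ha => h1 a (.inr ⟨i, .inr ha⟩)) h2
  | par S T ih1 ih2 =>
    intro m' f g h1 h2
    simp only [Term.gn, Finset.mem_union] at h1
    simp only [Term.map]
    rw [ih1 f g (fun a ha => h1 a (.inl ha)) h2, ih2 f g (fun a ha => h1 a (.inr ha)) h2]
  | res T ih =>
    intro m' f g h1 h2
    simp only [Term.map]
    have := Nm.lift_congr (s := T.gn) h1 h2
    rw [ih _ _ this.1 this.2]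
  | mat p q T ih =>
    intro m' f g h1 h2
    simp only [Term.gn, Finset.mem_union] at h1
    simp only [Term.map]
    rw [ih f g (fun a ha => h1 a (.inr ha)) h2,
      Nm.map_congr p (fun a ha => h1 a (.inl (.inl ha))) h2,
      Nm.map_congr q (fun a ha => h1 a (.inl (.inr ha))) h2]
  | mis p q T ih =>
    intro m' f g h1 h2
    simp only [Term.gn, Finset.mem_union] at h1
    simp only [Term.map]
    rw [ih f g (fun a ha => h1 a (.inr ha)) h2,
      Nm.map_congr p (fun a ha => h1 a (.inl (.inl ha))) h2,
      Nm.map_congr q (fun a ha => h1 a (.inl (.inr ha))) h2]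
  | repIn m T ih =>
    intro m' f g h1 h2
    simp only [Term.gn, Finset.mem_union] at h1
    simp only [Term.map]
    have := Nm.lift_congr (s := T.gn) (fun a ha => h1 a (.inr ha)) h2
    rw [ih _ _ this.1 this.2, Nm.map_congr m (fun a ha => h1 a (.inl ha)) h2]
  | repOut m o T ih =>
    intro m' f g h1 h2
    simp only [Term.gn, Finset.mem_union] at h1
    simp only [Term.map]
    rw [ih f g (fun a ha => h1 a (.inr ha)) h2,
      Nm.map_congr m (fun a ha => h1 a (.inl (.inl ha))) h2,
      Nm.map_congr o (fun a ha => h1 a (.inl (.inr ha))) h2]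

theorem Nm.gn_lift_free {n m : ℕ} (f : Nm n → Nm m) (b : Name) :
    (Nm.lift f (.free b)).gn = (f (.free b)).gn := by
  simp [Nm.lift]

theorem Nm.exists_of_mem_gn_lift_bound {n m : ℕ} (f : Nm n → Nm m) (i : Fin (n + 1)) {a : Name} :
    a ∈ (Nm.lift f (.bound i)).gn → ∃ j, a ∈ (f (.bound j)).gn := by
  refine Fin.cases ?_ (fun j => ?_) i
  · simp [Nm.lift, Nm.gn]
  · intro h; exact ⟨j, by simpa [Nm.lift] using h⟩

/-- Where a global name of `T.map f` comes from. -/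
theorem Term.mem_gn_map {n : ℕ} (T : Term n) : ∀ {m : ℕ} (f : Nm n → Nm m) {a : Name},
    a ∈ (T.map f).gn → (∃ b ∈ T.gn, a ∈ (f (.free b)).gn) ∨ ∃ i, a ∈ (f (.bound i)).gn := by
  have key : ∀ {n m : ℕ} (f : Nm n → Nm m) (x : Nm n) {a : Name}, a ∈ (f x).gn →
      (∃ b ∈ x.gn, a ∈ (f (.free b)).gn) ∨ ∃ i, a ∈ (f (.bound i)).gn := by
    intro n m f x a h
    cases x with
    | free b => exact .inl ⟨b, by simp [Nm.gn], h⟩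
    | bound i => exact .inr ⟨i, h⟩
  have under : ∀ {n m : ℕ} (f : Nm n → Nm m) {s : Finset Name} {a : Name},
      ((∃ b ∈ s, a ∈ (Nm.lift f (.free b)).gn) ∨ ∃ i, a ∈ (Nm.lift f (.bound i)).gn) →
      (∃ b ∈ s, a ∈ (f (.free b)).gn) ∨ ∃ i, a ∈ (f (.bound i)).gn := by
    rintro n m f s a (⟨b, hb, h⟩ | ⟨i, h⟩)
    · exact .inl ⟨b, hb, by simpa [Nm.gn_lift_free] using h⟩
    · exact .inr (Nm.exists_of_mem_gn_lift_bound f i h)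
  have mono : ∀ {n m : ℕ} (f : Nm n → Nm m) {s t : Finset Name} {a : Name}, s ⊆ t →
      ((∃ b ∈ s, a ∈ (f (.free b)).gn) ∨ ∃ i, a ∈ (f (.bound i)).gn) →
      (∃ b ∈ t, a ∈ (f (.free b)).gn) ∨ ∃ i, a ∈ (f (.bound i)).gn := by
    rintro n m f s t a hst (⟨b, hb, h⟩ | h)
    · exact .inl ⟨b, hst hb, h⟩
    · exact .inr h
  induction T with
  | nil => intro m f a h; simp [Term.map, Term.gn] at h
  | inp m k T ih =>
    intro m' f a h
    simp only [Term.map, Term.gn, Finset.mem_union, Finset.mem_biUnion, Finset.mem_univ,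
      true_and] at h
    rcases h with h | ⟨i, h⟩
    · exact mono f (fun x hx => by simp [Term.gn, hx]) (key f m h)
    · exact mono f (fun x hx => by
        simp only [Term.gn, Finset.mem_union, Finset.mem_biUnion]
        exact .inr ⟨i, by simp, hx⟩)
        (under f (ih i _ h))
  | out m k o T ih =>
    intro m' f a h
    simp only [Term.map, Term.gn, Finset.mem_union, Finset.mem_biUnion, Finset.mem_univ,
      true_and] at h
    rcases h with h | ⟨i, h | h⟩
    · exact mono f (fun x hx => by simp [Term.gn, hx]) (key f m h)
    · exact mono f (fun x hx => by
        simp only [Term.gn, Finset.mem_union, Finset.mem_biUnion]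
        exact .inr ⟨i, by simp, .inl hx⟩) (key f _ h)
    · exact mono f (fun x hx => by
        simp only [Term.gn, Finset.mem_union, Finset.mem_biUnion]
        exact .inr ⟨i, by simp, .inr hx⟩) (ih i f h)
  | par S T ih1 ih2 =>
    intro m' f a h
    simp only [Term.map, Term.gn, Finset.mem_union] at h
    rcases h with h | h
    · exact mono f (fun x hx => by simp [Term.gn, hx]) (ih1 f h)
    · exact mono f (fun x hx => by simp [Term.gn, hx]) (ih2 f h)
  | res T ih =>
    intro m' f a h
    exact under f (ih _ h)
  | mat p q T ih =>
    intro m' f a h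
    simp only [Term.map, Term.gn, Finset.mem_union] at h
    rcases h with (h | h) | h
    · exact mono f (fun x hx => by simp [Term.gn, hx]) (key f _ h)
    · exact mono f (fun x hx => by simp [Term.gn, hx]) (key f _ h)
    · exact mono f (fun x hx => by simp [Term.gn, hx]) (ih f h)
  | mis p q T ih =>
    intro m' f a h
    simp only [Term.map, Term.gn, Finset.mem_union] at h
    rcases h with (h | h) | h
    · exact mono f (fun x hx => by simp [Term.gn, hx]) (key f _ h)
    · exact mono f (fun x hx => by simp [Term.gn, hx]) (key f _ h)
    · exact mono f (fun x hx => by simp [Term.gn, hx]) (ih f h)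
  | repIn m T ih =>
    intro m' f a h
    simp only [Term.map, Term.gn, Finset.mem_union] at h
    rcases h with h | h
    · exact mono f (fun x hx => by simp [Term.gn, hx]) (key f _ h)
    · exact mono f (fun x hx => by simp [Term.gn, hx]) (under f (ih _ h))
  | repOut m o T ih =>
    intro m' f a h
    simp only [Term.map, Term.gn, Finset.mem_union] at h
    rcases h with (h | h) | h
    · exact mono f (fun x hx => by simp [Term.gn, hx]) (key f _ h)
    · exact mono f (fun x hx => by simp [Term.gn, hx]) (key f _ h)
    · exact mono f (fun x hx => by simp [Term.gn, hx]) (ih f h)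

theorem Nm.gn_map_free {n m : ℕ} (f : Nm n → Nm m) (x : Nm n) {a b : Name} (hb : b ∈ x.gn)
    (ha : a ∈ (f (.free b)).gn) : a ∈ (f x).gn := by
  cases x with
  | free c => simp only [Nm.gn, Finset.mem_singleton] at hb; subst hb; exact ha
  | bound i => simp [Nm.gn] at hb

theorem Term.mem_gn_map_of_mem {n : ℕ} (T : Term n) : ∀ {m : ℕ} (f : Nm n → Nm m) {a b : Name},
    b ∈ T.gn → a ∈ (f (.free b)).gn → a ∈ (T.map f).gn := by
  induction T <;> intro m' f a b hb ha <;>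
    simp only [Term.map, Term.gn, Finset.mem_union, Finset.mem_biUnion, Finset.mem_univ,
      true_and] at hb ⊢
  · simp at hb
  · rename_i ih
    rcases hb with hb | ⟨i, hb⟩
    · exact .inl (Nm.gn_map_free f _ hb ha)
    · exact .inr ⟨i, ih i _ hb (by rwa [Nm.gn_lift_free])⟩
  · rename_i ih
    rcases hb with hb | ⟨i, hb | hb⟩
    · exact .inl (Nm.gn_map_free f _ hb ha)
    · exact .inr ⟨i, .inl (Nm.gn_map_free f _ hb ha)⟩
    · exact .inr ⟨i, .inr (ih i _ hb ha)⟩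
  · rename_i ih1 ih2
    exact hb.imp (fun h => ih1 f h ha) (fun h => ih2 f h ha)
  · rename_i ih
    exact ih _ hb (by rwa [Nm.gn_lift_free])
  · rename_i ih
    exact hb.imp (Or.imp (fun h => Nm.gn_map_free f _ h ha) (fun h => Nm.gn_map_free f _ h ha))
      (fun h => ih f h ha)
  · rename_i ih
    exact hb.imp (Or.imp (fun h => Nm.gn_map_free f _ h ha) (fun h => Nm.gn_map_free f _ h ha))
      (fun h => ih f h ha)
  · rename_i ih
    exact hb.imp (fun h => Nm.gn_map_free f _ h ha)
      (fun h => ih _ h (by rwa [Nm.gn_lift_free]))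
  · rename_i ih
    exact hb.imp (Or.imp (fun h => Nm.gn_map_free f _ h ha) (fun h => Nm.gn_map_free f _ h ha))
      (fun h => ih f h ha)

/-- A permutation of the global names, applied to a name occurrence. -/
def Nm.ren {n : ℕ} (σ : Equiv.Perm Name) : Nm n → Nm n
  | .free a => .free (σ a)
  | .bound i => .bound i

/-- A permutation of the global names, applied to a term. -/
def Term.ren {n : ℕ} (σ : Equiv.Perm Name) (T : Term n) : Term n := T.map (Nm.ren σ)

theorem Nm.lift_ren {n : ℕ} (σ : Equiv.Perm Name) :
    Nm.lift (Nm.ren σ : Nm n → Nm n) = Nm.ren σ := by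
  funext x
  cases x with
  | free a => simp [Nm.lift, Nm.ren, Nm.shift]
  | bound i => refine Fin.cases ?_ (fun j => ?_) i <;> simp [Nm.lift, Nm.ren, Nm.shift]

theorem Term.ren_ren {n : ℕ} (σ τ : Equiv.Perm Name) (T : Term n) :
    (T.ren σ).ren τ = T.ren (τ * σ) := by
  rw [Term.ren, Term.ren, Term.map_map, Term.ren]
  congr 1; funext x; cases x <;> rfl

@[simp] theorem Term.ren_one {n : ℕ} (T : Term n) : T.ren 1 = T := by
  rw [Term.ren]
  conv_rhs => rw [← Term.map_id T]
  congr 1; funext x; cases x <;> rfl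

@[simp] theorem Term.ren_inv_ren {n : ℕ} (σ : Equiv.Perm Name) (T : Term n) :
    (T.ren σ).ren σ⁻¹ = T := by simp [Term.ren_ren]

@[simp] theorem Term.ren_ren_inv {n : ℕ} (σ : Equiv.Perm Name) (T : Term n) :
    (T.ren σ⁻¹).ren σ = T := by simp [Term.ren_ren]

@[simp] theorem Term.ren_swap_swap {n : ℕ} (a b : Name) (T : Term n) :
    (T.ren (Equiv.swap a b)).ren (Equiv.swap a b) = T := by simp [Term.ren_ren]

theorem Term.ren_congr {n : ℕ} {σ τ : Equiv.Perm Name} {T : Term n}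
    (h : ∀ a ∈ T.gn, σ a = τ a) : T.ren σ = T.ren τ :=
  Term.map_congr T _ _ (fun a ha => by simp [Nm.ren, h a ha]) (fun _ => rfl)

theorem Term.ren_eq_self {n : ℕ} {σ : Equiv.Perm Name} {T : Term n}
    (h : ∀ a ∈ T.gn, σ a = a) : T.ren σ = T := by
  rw [Term.ren_congr (τ := 1) (by simpa using h), Term.ren_one]

theorem Term.ren_swap_eq_self {n : ℕ} {a b : Name} {T : Term n} (ha : a ∉ T.gn) (hb : b ∉ T.gn) :
    T.ren (Equiv.swap a b) = T :=
  Term.ren_eq_self fun x hx => Equiv.swap_apply_of_ne_of_ne (by rintro rfl; exact ha hx)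
    (by rintro rfl; exact hb hx)

@[simp] theorem Term.gn_ren {n : ℕ} (σ : Equiv.Perm Name) (T : Term n) :
    (T.ren σ).gn = T.gn.image σ := by
  ext a
  constructor
  · intro h
    rcases Term.mem_gn_map T _ h with ⟨b, hb, h⟩ | ⟨i, h⟩
    · simp only [Nm.ren, Nm.gn, Finset.mem_singleton] at h
      exact Finset.mem_image.2 ⟨b, hb, h.symm⟩
    · simp [Nm.ren, Nm.gn] at h
  · intro h
    obtain ⟨b, hb, rfl⟩ := Finset.mem_image.1 h
    exact Term.mem_gn_map_of_mem T _ hb (by simp [Nm.ren, Nm.gn])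

theorem Term.gn_inst_subset (T : Term 1) (c : Name) : (T.inst c).gn ⊆ insert c T.gn := by
  intro a h
  rcases Term.mem_gn_map T _ h with ⟨b, hb, h⟩ | ⟨i, h⟩
  · simp only [instNm, Nm.gn, Finset.mem_singleton] at h
    subst h; simp [hb]
  · simp only [instNm, Nm.gn, Finset.mem_singleton] at h
    simp [h]

theorem gn_map_absNm (c : Name) (P : Proc) : (P.map (absNm c)).gn = P.gn.erase c := by
  ext a
  constructor
  · intro h
    rcases Term.mem_gn_map P _ h with ⟨b, hb, h⟩ | ⟨i, h⟩
    · by_cases hbc : b = c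
      · simp [absNm, hbc, Nm.gn] at h
      · simp only [absNm, hbc, if_false, Nm.gn, Finset.mem_singleton] at h
        subst h; simp [hb, hbc]
    · exact i.elim0
  · intro h
    obtain ⟨hc, h⟩ := Finset.mem_erase.1 h
    exact Term.mem_gn_map_of_mem P _ h (by simp [absNm, hc, Nm.gn])

@[simp] theorem gn_nu (c : Name) (P : Proc) : (nu c P).gn = P.gn.erase c := gn_map_absNm c P

theorem absNm_inst (c : Name) (P : Proc) : (P.map (absNm c)).inst c = P := by
  rw [Term.inst, Term.map_map]
  conv_rhs => rw [← Term.map_id P]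
  apply Term.map_congr
  · intro a _
    by_cases h : a = c <;> simp [absNm, instNm, h]
  · exact fun i => i.elim0

/-- Localizing a global name and instantiating it again amounts to a renaming. -/
theorem absNm_inst_ren {c d : Name} {P : Proc} (hd : d ∉ P.gn.erase c) :
    (P.map (absNm c)).inst d = P.ren (Equiv.swap c d) := by
  rw [Term.inst, Term.map_map, Term.ren]
  apply Term.map_congr
  · intro a ha
    by_cases h : a = c
    · simp [absNm, instNm, h, Nm.ren]
    · have : a ≠ d := by rintro rfl; exact hd (Finset.mem_erase.2 ⟨h, ha⟩)
      simp [absNm, instNm, h, Nm.ren, Equiv.swap_apply_of_ne_of_ne h this]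
  · exact fun i => i.elim0

theorem Term.inst_absNm {c : Name} {T : Term 1} (hc : c ∉ T.gn) :
    (T.inst c).map (absNm c) = T := by
  rw [Term.inst, Term.map_map]
  conv_rhs => rw [← Term.map_id T]
  apply Term.map_congr
  · intro a ha
    have : a ≠ c := by rintro rfl; exact hc ha
    simp [absNm, instNm, this]
  · intro i
    simp [absNm, instNm, Subsingleton.elim i 0]

/-- Every localization is the localization of a global name. -/
theorem res_eq_nu {c : Name} {T : Term 1} (hc : c ∉ T.gn) : Term.res T = nu c (T.inst c) := by
  rw [nu, Term.inst_absNm hc]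

theorem Term.inst_ren (σ : Equiv.Perm Name) (T : Term 1) (c : Name) :
    (T.inst c).ren σ = (T.ren σ).inst (σ c) := by
  rw [Term.inst, Term.inst, Term.ren, Term.ren, Term.map_map, Term.map_map]
  congr 1; funext x; cases x <;> rfl

theorem nu_ren (σ : Equiv.Perm Name) (c : Name) (P : Proc) :
    (nu c P).ren σ = nu (σ c) (P.ren σ) := by
  simp only [nu, Term.ren, Term.map, Nm.lift_ren, Term.map_map]
  congr 2; funext x
  cases x with
  | free a => by_cases h : a = c <;> simp [absNm, Nm.ren, h]
  | bound i => exact i.elim0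

/-- Alpha-conversion of a localization. -/
theorem nu_alpha {c d : Name} {P : Proc} (hd : d ∉ P.gn.erase c) :
    nu c P = nu d (P.ren (Equiv.swap c d)) := by
  rw [← absNm_inst_ren hd, ← res_eq_nu (by rwa [gn_map_absNm]), nu]

/-- A permutation of the global names, applied to an action. -/
def Act.ren (σ : Equiv.Perm Name) : Act → Act
  | .tau => .tau
  | .inp a b => .inp (σ a) (σ b)
  | .out a b => .out (σ a) (σ b)
  | .bout a c => .bout (σ a) (σ c)

theorem Act.names_ren (σ : Equiv.Perm Name) (l : Act) : (l.ren σ).names = l.names.image σ := by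
  cases l <;> simp [Act.ren, Act.names, Finset.image_insert]

theorem Act.bn_ren (σ : Equiv.Perm Name) (l : Act) : (l.ren σ).bn = l.bn.image σ := by
  cases l <;> simp [Act.ren, Act.bn]

theorem Act.bn_subset_names (l : Act) : l.bn ⊆ l.names := by
  cases l <;> simp [Act.bn, Act.names]

theorem Act.ren_congr {σ τ : Equiv.Perm Name} {l : Act} (h : ∀ a ∈ l.names, σ a = τ a) :
    l.ren σ = l.ren τ := by
  cases l <;> simp_all [Act.ren, Act.names]

theorem Act.ren_eq_self {σ : Equiv.Perm Name} {l : Act} (h : ∀ a ∈ l.names, σ a = a) :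
    l.ren σ = l := by
  cases l <;> simp_all [Act.ren, Act.names]

theorem Act.ren_swap_eq_self {a b : Name} {l : Act} (ha : a ∉ l.names) (hb : b ∉ l.names) :
    l.ren (Equiv.swap a b) = l :=
  Act.ren_eq_self fun x hx => Equiv.swap_apply_of_ne_of_ne (by rintro rfl; exact ha hx)
    (by rintro rfl; exact hb hx)

theorem Act.ren_ren (σ τ : Equiv.Perm Name) (l : Act) : (l.ren σ).ren τ = l.ren (τ * σ) := by
  cases l <;> rfl

@[simp] theorem Act.ren_one (l : Act) : l.ren 1 = l := by cases l <;> rfl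

theorem Act.ren_eq_tau {σ : Equiv.Perm Name} {l : Act} : l.ren σ = .tau ↔ l = .tau := by
  cases l <;> simp [Act.ren]

theorem exists_fresh (s : Finset Name) : ∃ c : Name, c ∉ s := Infinite.exists_notMem_finset s

/-! ### Transitions: global names, renaming and inversion -/

/-- The channel of an action. -/
def Act.subj : Act → Finset Name
  | .tau => ∅
  | .inp a _ => {a}
  | .out a _ => {a}
  | .bout a _ => {a}

theorem Act.subj_subset_names (l : Act) : l.subj ⊆ l.names := by
  cases l <;> simp [Act.subj, Act.names]

/-- The channel and the object of a free output are global names of the source, and new global names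
come from the action. Communication needs the three facts simultaneously. -/
theorem Step.gn_aux {P P' : Proc} {l : Act} (h : Step P l P') :
    l.subj ⊆ P.gn ∧ (∀ a b, l = .out a b → b ∈ P.gn) ∧ P'.gn ⊆ P.gn ∪ l.names := by
  induction h with
  | inp a c k T i =>
    refine ⟨by simp [Act.subj, Term.gn, Nm.gn], by simp, fun x hx => ?_⟩
    have := Term.gn_inst_subset _ _ hx
    simp only [Finset.mem_insert] at this
    simp only [Term.gn, Act.names, Finset.mem_union, Finset.mem_biUnion, Finset.mem_univ, true_and,
      Finset.mem_insert, Finset.mem_singleton]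
    rcases this with h | h
    · exact .inr (.inr h)
    · exact .inl (.inr ⟨i, h⟩)
  | out a k c T i =>
    refine ⟨by simp [Act.subj, Term.gn, Nm.gn], ?_, fun x hx => ?_⟩
    · rintro a' b h
      simp only [Act.out.injEq] at h
      simp only [Term.gn, Finset.mem_union, Finset.mem_biUnion, Finset.mem_univ, true_and]
      exact .inr ⟨i, .inl (by simp [Nm.gn, h.2])⟩
    · simp only [Term.gn, Finset.mem_union, Finset.mem_biUnion, Finset.mem_univ, true_and]
      exact .inl (.inr ⟨i, .inr hx⟩)
  | parR _ _ ih =>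
    obtain ⟨h1, h2, h3⟩ := ih
    refine ⟨h1.trans Finset.subset_union_right, fun a b h => by simp [Term.gn, h2 a b h], ?_⟩
    intro x hx
    have := @h3 x
    simp only [Term.gn, Finset.mem_union] at *; tauto
  | parL _ _ ih =>
    obtain ⟨h1, h2, h3⟩ := ih
    refine ⟨h1.trans Finset.subset_union_left, fun a b h => by simp [Term.gn, h2 a b h], ?_⟩
    intro x hx
    have := @h3 x
    simp only [Term.gn, Finset.mem_union] at *; tauto
  | @commR S T S' T' a b _ _ ih1 ih2 =>
    have ha : a ∈ S.gn ∪ T.gn := Finset.subset_union_right (ih2.1 (by simp [Act.subj]))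
    have hb : b ∈ S.gn ∪ T.gn := Finset.subset_union_right (ih2.2.1 a b rfl)
    have hab : ({a, b} : Finset Name) ⊆ S.gn ∪ T.gn := by
      simp only [Finset.insert_subset_iff, Finset.singleton_subset_iff]; exact ⟨ha, hb⟩
    refine ⟨by simp [Act.subj], by simp, ?_⟩
    simp only [Act.names, Finset.union_empty]
    exact Finset.union_subset
      (ih1.2.2.trans (Finset.union_subset Finset.subset_union_left hab))
      (ih2.2.2.trans (Finset.union_subset Finset.subset_union_right hab))
  | @commL S T S' T' a b _ _ ih1 ih2 =>
    have ha : a ∈ S.gn ∪ T.gn := Finset.subset_union_left (ih1.1 (by simp [Act.subj]))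
    have hb : b ∈ S.gn ∪ T.gn := Finset.subset_union_left (ih1.2.1 a b rfl)
    have hab : ({a, b} : Finset Name) ⊆ S.gn ∪ T.gn := by
      simp only [Finset.insert_subset_iff, Finset.singleton_subset_iff]; exact ⟨ha, hb⟩
    refine ⟨by simp [Act.subj], by simp, ?_⟩
    simp only [Act.names, Finset.union_empty]
    exact Finset.union_subset
      (ih1.2.2.trans (Finset.union_subset Finset.subset_union_left hab))
      (ih2.2.2.trans (Finset.union_subset Finset.subset_union_right hab))
  | @closeR S T S' T' a c _ _ _ ih1 ih2 =>
    have ha : a ∈ S.gn ∪ T.gn := Finset.subset_union_right (ih2.1 (by simp [Act.subj]))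
    have hac : ({a, c} : Finset Name) ⊆ insert c (S.gn ∪ T.gn) := by
      simp only [Finset.insert_subset_iff, Finset.singleton_subset_iff]
      exact ⟨Finset.mem_insert_of_mem ha, Finset.mem_insert_self _ _⟩
    refine ⟨by simp [Act.subj], by simp, ?_⟩
    simp only [Act.names, Finset.union_empty, gn_nu]
    refine Finset.subset_insert_iff.1 (Finset.union_subset
      (ih1.2.2.trans (Finset.union_subset ?_ hac)) (ih2.2.2.trans (Finset.union_subset ?_ hac)))
    · exact Finset.subset_union_left.trans (Finset.subset_insert _ _)
    · exact Finset.subset_union_right.trans (Finset.subset_insert _ _)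
  | @closeL S T S' T' a c _ _ _ ih1 ih2 =>
    have ha : a ∈ S.gn ∪ T.gn := Finset.subset_union_left (ih1.1 (by simp [Act.subj]))
    have hac : ({a, c} : Finset Name) ⊆ insert c (S.gn ∪ T.gn) := by
      simp only [Finset.insert_subset_iff, Finset.singleton_subset_iff]
      exact ⟨Finset.mem_insert_of_mem ha, Finset.mem_insert_self _ _⟩
    refine ⟨by simp [Act.subj], by simp, ?_⟩
    simp only [Act.names, Finset.union_empty, gn_nu]
    refine Finset.subset_insert_iff.1 (Finset.union_subset
      (ih1.2.2.trans (Finset.union_subset ?_ hac)) (ih2.2.2.trans (Finset.union_subset ?_ hac)))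
    · exact Finset.subset_union_left.trans (Finset.subset_insert _ _)
    · exact Finset.subset_union_right.trans (Finset.subset_insert _ _)
  | @extrude T T' a c _ _ hac ih =>
    have h0 := Term.gn_inst_subset T c
    refine ⟨?_, by simp, fun x hx => ?_⟩
    · have h1 := h0 (ih.1 (Finset.mem_singleton_self a))
      simp only [Finset.mem_insert, hac, false_or] at h1
      simpa [Act.subj, Term.gn] using h1
    · have h1 := ih.2.2 hx
      have h2 := @h0 x
      simp only [Term.gn, Finset.mem_union, Act.names, Finset.mem_insert,
        Finset.mem_singleton] at *
      tauto
  | @res T T' l c _ _ hc ih =>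
    have h0 := Term.gn_inst_subset T c
    have key : ∀ x, x ≠ c → x ∈ (T.inst c).gn → x ∈ T.gn := fun x hx h => by
      simpa [hx] using h0 h
    refine ⟨fun x hx => key x ?_ (ih.1 hx), fun a b h => key b ?_ (ih.2.1 a b h), fun x hx => ?_⟩
    · rintro rfl; exact hc (l.subj_subset_names hx)
    · rintro rfl; subst h; simp [Act.names] at hc
    · simp only [gn_nu, Finset.mem_erase] at hx
      have h1 := ih.2.2 hx.2
      have h2 := key x hx.1
      simp only [Term.gn, Finset.mem_union] at *
      tauto
  | mat a _ ih =>
    obtain ⟨h1, h2, h3⟩ := ih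
    refine ⟨h1.trans Finset.subset_union_right, fun a b h => by simp [Term.gn, h2 a b h], ?_⟩
    intro x hx
    have := @h3 x
    simp only [Term.gn, Finset.mem_union] at *; tauto
  | mis a b _ _ ih =>
    obtain ⟨h1, h2, h3⟩ := ih
    refine ⟨h1.trans Finset.subset_union_right, fun a b h => by simp [Term.gn, h2 a b h], ?_⟩
    intro x hx
    have := @h3 x
    simp only [Term.gn, Finset.mem_union] at *; tauto
  | repOut a b T =>
    refine ⟨by simp [Act.subj, Term.gn, Nm.gn], ?_, fun x hx => ?_⟩
    · rintro a' b' h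
      simp only [Act.out.injEq] at h
      simp [Term.gn, Nm.gn, h.2]
    · simp only [Term.gn, Finset.mem_union] at *; tauto
  | repIn a b T =>
    refine ⟨by simp [Act.subj, Term.gn, Nm.gn], by simp, fun x hx => ?_⟩
    have : x ∈ _ → x ∈ _ := fun h => Term.gn_inst_subset T b h
    simp only [Term.gn, Finset.mem_union, Act.names, Finset.mem_insert,
      Finset.mem_singleton] at *
    tauto

theorem Step.subj_subset {P P' : Proc} {l : Act} (h : Step P l P') : l.subj ⊆ P.gn := h.gn_aux.1

theorem Step.gn_subset {P P' : Proc} {l : Act} (h : Step P l P') : P'.gn ⊆ P.gn ∪ l.names :=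
  h.gn_aux.2.2

theorem Step.obj_mem {P P' : Proc} {a b : Name} (h : Step P (.out a b) P') : b ∈ P.gn :=
  h.gn_aux.2.1 a b rfl

theorem Step.inp_subj_mem {P P' : Proc} {a b : Name} (h : Step P (.inp a b) P') : a ∈ P.gn :=
  h.subj_subset (by simp [Act.subj])

theorem Step.out_subj_mem {P P' : Proc} {a b : Name} (h : Step P (.out a b) P') : a ∈ P.gn :=
  h.subj_subset (by simp [Act.subj])

theorem Step.bout_subj_mem {P P' : Proc} {a b : Name} (h : Step P (.bout a b) P') : a ∈ P.gn :=
  h.subj_subset (by simp [Act.subj])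

theorem Tau.gn_subset {P P' : Proc} (h : Tau P P') : P'.gn ⊆ P.gn := by
  simpa [Act.names] using Step.gn_subset h

theorem Taus.gn_subset {P P' : Proc} (h : Taus P P') : P'.gn ⊆ P.gn := by
  induction h with
  | refl => exact subset_rfl
  | tail _ h ih => exact (Tau.gn_subset h).trans ih

theorem Step.bout_ne {P P' : Proc} {a c : Name} (h : Step P (.bout a c) P') : a ≠ c := by
  generalize hl : Act.bout a c = l at h
  induction h <;> simp_all

/-- Renaming a local name into a fresh one before or after localization. -/
theorem nu_ren_fresh {σ : Equiv.Perm Name} {c d : Name} {P : Proc} (hd : d ∉ (P.ren σ).gn) :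
    nu d (P.ren (Equiv.swap (σ c) d * σ)) = nu (σ c) (P.ren σ) := by
  rw [nu_alpha (d := d) (fun h => hd (Finset.mem_of_mem_erase h)), Term.ren_ren]

/-- Transitions are preserved by permutations `σ` of the global names. The bound name of the action
may be renamed by a different permutation `τ`, as long as it stays fresh. -/
theorem Step.ren_ren {P P' : Proc} {l : Act} (h : Step P l P') : ∀ (σ τ : Equiv.Perm Name),
    (∀ x ∈ P.gn, x ∉ l.bn → σ x = τ x) → (∀ c ∈ l.bn, σ c = τ c ∨ τ c ∉ (P.ren σ).gn) →
    Step (P.ren σ) (l.ren τ) (P'.ren τ) := by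
  induction h with
  | inp a c k T i =>
    intro σ τ h1 _
    rw [Term.ren_congr (τ := τ) (fun x hx => h1 x hx (by simp [Act.bn])), Term.inst_ren]
    simp only [Term.ren, Term.map, Nm.lift_ren]
    exact Step.inp (τ a) (τ c) k (fun j => (T j).ren τ) i
  | out a k c T i =>
    intro σ τ h1 _
    rw [Term.ren_congr (τ := τ) (fun x hx => h1 x hx (by simp [Act.bn]))]
    exact Step.out (τ a) k (fun j => τ (c j)) (fun j => (T j).ren τ) i
  | @parR S T T' l _ hd ih =>
    intro σ τ h1 h2
    have hS : ∀ x ∈ S.gn, x ∉ l.bn := fun x hx hl => Finset.disjoint_left.1 hd hl hx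
    have eS : S.ren σ = S.ren τ :=
      Term.ren_congr fun x hx => h1 x (by simp [Term.gn, hx]) (hS x hx)
    have := ih σ τ (fun x hx => h1 x (by simp [Term.gn, hx])) (fun c hc => (h2 c hc).imp_right
      fun h h' => h (by
        change _ ∈ (Term.par (S.ren σ) (T.ren σ)).gn
        simp only [Term.gn, Finset.mem_union, h', or_true]))
    change Step (.par (S.ren σ) (T.ren σ)) _ (.par (S.ren τ) (T'.ren τ))
    rw [← eS]
    refine Step.parR this ?_
    rw [Act.bn_ren, Finset.disjoint_left]
    intro x hx hx'
    obtain ⟨c, hc, rfl⟩ := Finset.mem_image.1 hx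
    rcases h2 c hc with h | h
    · rw [← h, Term.gn_ren] at hx'
      obtain ⟨c', hc', e⟩ := Finset.mem_image.1 hx'
      rw [σ.injective e] at hc'
      exact hS c hc' hc
    · exact h (by
        change _ ∈ (Term.par (S.ren σ) (T.ren σ)).gn
        simp only [Term.gn, Finset.mem_union, hx', true_or])
  | @parL S T S' l _ hd ih =>
    intro σ τ h1 h2
    have hT : ∀ x ∈ T.gn, x ∉ l.bn := fun x hx hl => Finset.disjoint_left.1 hd hl hx
    have eT : T.ren σ = T.ren τ :=
      Term.ren_congr fun x hx => h1 x (by simp [Term.gn, hx]) (hT x hx)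
    have := ih σ τ (fun x hx => h1 x (by simp [Term.gn, hx])) (fun c hc => (h2 c hc).imp_right
      fun h h' => h (by
        change _ ∈ (Term.par (S.ren σ) (T.ren σ)).gn
        simp only [Term.gn, Finset.mem_union, h', true_or]))
    change Step (.par (S.ren σ) (T.ren σ)) _ (.par (S'.ren τ) (T.ren τ))
    rw [← eT]
    refine Step.parL this ?_
    rw [Act.bn_ren, Finset.disjoint_left]
    intro x hx hx'
    obtain ⟨c, hc, rfl⟩ := Finset.mem_image.1 hx
    rcases h2 c hc with h | h
    · rw [← h, Term.gn_ren] at hx'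
      obtain ⟨c', hc', e⟩ := Finset.mem_image.1 hx'
      rw [σ.injective e] at hc'
      exact hT c hc' hc
    · exact h (by
        change _ ∈ (Term.par (S.ren σ) (T.ren σ)).gn
        simp only [Term.gn, Finset.mem_union, hx', or_true])
  | @commR S T S' T' a b _ _ ih1 ih2 =>
    intro σ τ h1 _
    rw [Term.ren_congr (τ := τ) (fun x hx => h1 x hx (by simp [Act.bn]))]
    exact Step.commR (ih1 τ τ (fun _ _ _ => rfl) (fun _ _ => .inl rfl))
      (ih2 τ τ (fun _ _ _ => rfl) (fun _ _ => .inl rfl))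
  | @commL S T S' T' a b _ _ ih1 ih2 =>
    intro σ τ h1 _
    rw [Term.ren_congr (τ := τ) (fun x hx => h1 x hx (by simp [Act.bn]))]
    exact Step.commL (ih1 τ τ (fun _ _ _ => rfl) (fun _ _ => .inl rfl))
      (ih2 τ τ (fun _ _ _ => rfl) (fun _ _ => .inl rfl))
  | @closeR S T S' T' a c _ _ hc ih1 ih2 =>
    intro σ τ h1 _
    rw [Term.ren_congr (τ := τ) (fun x hx => h1 x hx (by simp [Act.bn])), nu_ren]
    have := ih1 τ τ (fun _ _ _ => rfl) (fun _ _ => .inl rfl)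
    have := ih2 τ τ (fun _ _ _ => rfl) (fun _ _ => .inl rfl)
    refine Step.closeR (a := τ a) ‹_› ‹_› ?_
    change _ ∉ (S.ren τ).gn
    simpa using hc
  | @closeL S T S' T' a c _ _ hc ih1 ih2 =>
    intro σ τ h1 _
    rw [Term.ren_congr (τ := τ) (fun x hx => h1 x hx (by simp [Act.bn])), nu_ren]
    have := ih1 τ τ (fun _ _ _ => rfl) (fun _ _ => .inl rfl)
    have := ih2 τ τ (fun _ _ _ => rfl) (fun _ _ => .inl rfl)
    refine Step.closeL (a := τ a) ‹_› ‹_› ?_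
    change _ ∉ (T.ren τ).gn
    simpa using hc
  | @extrude T T' a c hc _ hac ih =>
    intro σ τ h1 _
    rw [Term.ren_congr (τ := τ) (fun x hx => h1 x hx (by
      simp only [Act.bn, Finset.mem_singleton]; rintro rfl; exact hc hx))]
    have := ih τ τ (fun _ _ _ => rfl) (fun _ _ => .inl rfl)
    rw [Term.inst_ren] at this
    simp only [Term.ren, Term.map, Nm.lift_ren]
    refine Step.extrude ?_ this (by simpa using hac)
    change _ ∉ (T.ren τ).gn
    simpa using hc
  | @res T T' l c hc _ hcl ih =>
    intro σ τ h1 h2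
    have e : (Term.res T).ren σ = .res (T.ren σ) := by
      simp only [Term.ren, Term.map, Nm.lift_ren]
    rw [e] at h2 ⊢
    obtain ⟨d, hd⟩ := exists_fresh ((T.ren σ).gn ∪ (T'.ren τ).gn ∪ l.names.image τ ∪
      l.names.image σ)
    simp only [Finset.mem_union, not_or] at hd
    obtain ⟨⟨⟨hdT, hdT'⟩, hdl⟩, hdl'⟩ := hd
    have hσ : ∀ x ∈ T.gn, (Equiv.swap (σ c) d * σ) x = σ x := by
      intro x hx
      refine Equiv.swap_apply_of_ne_of_ne ?_ ?_
      · intro h; rw [σ.injective h] at hx; exact hc hx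
      · rintro rfl; exact hdT (by simp only [Term.gn_ren]; exact Finset.mem_image_of_mem _ hx)
    have hτl : ∀ x ∈ l.names, (Equiv.swap (τ c) d * τ) x = τ x := by
      intro x hx
      refine Equiv.swap_apply_of_ne_of_ne ?_ ?_
      · intro h; rw [τ.injective h] at hx; exact hcl hx
      · rintro rfl; exact hdl (Finset.mem_image_of_mem _ hx)
    have hσl : ∀ x ∈ l.names, (Equiv.swap (σ c) d * σ) x = σ x := by
      intro x hx
      refine Equiv.swap_apply_of_ne_of_ne ?_ ?_
      · intro h; rw [σ.injective h] at hx; exact hcl hx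
      · rintro rfl; exact hdl' (Finset.mem_image_of_mem _ hx)
    have eT : T.ren (Equiv.swap (σ c) d * σ) = T.ren σ := Term.ren_congr hσ
    have := ih (Equiv.swap (σ c) d * σ) (Equiv.swap (τ c) d * τ) ?_ ?_
    · rw [Term.inst_ren, eT, Act.ren_congr hτl] at this
      simp only [Equiv.Perm.coe_mul, Function.comp_apply, Equiv.swap_apply_left] at this
      rw [nu_ren, ← nu_ren_fresh hdT']
      refine Step.res hdT this ?_
      rw [Act.names_ren]; exact hdl
    · intro x hx hxl
      by_cases hxc : x = c
      · simp [hxc]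
      have hx : x ∈ T.gn := by simpa [hxc] using Term.gn_inst_subset _ _ hx
      have hστ := h1 x hx hxl
      rw [hσ x hx, hστ]
      refine (Equiv.swap_apply_of_ne_of_ne ?_ ?_).symm
      · intro h; exact hxc (τ.injective h)
      · rintro rfl; exact hdT (by rw [← hστ, Term.gn_ren]; exact Finset.mem_image_of_mem _ hx)
    · intro x hx
      have hxl := l.bn_subset_names hx
      rw [hτl x hxl, hσl x hxl]
      refine (h2 x hx).imp_right fun h h' => h ?_
      rw [Term.inst_ren, eT] at h'
      have := Term.gn_inst_subset _ _ h'
      simp only [Equiv.Perm.coe_mul, Function.comp_apply, Equiv.swap_apply_left,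
        Finset.mem_insert] at this
      refine this.resolve_left ?_
      rintro rfl
      exact hdl (Finset.mem_image_of_mem _ hxl)
  | @mat T T' l a _ ih =>
    intro σ τ h1 h2
    exact Step.mat (σ a) (ih σ τ (fun x hx => h1 x (by simp [Term.gn, hx]))
      (fun c hc => (h2 c hc).imp_right fun h h' => h (by
        change _ ∈ (Term.mat _ _ (T.ren σ)).gn
        simp only [Term.gn, Finset.mem_union, h', or_true])))
  | @mis T T' l a b hab _ ih =>
    intro σ τ h1 h2
    exact Step.mis (σ a) (σ b) (by simpa using hab) (ih σ τ
      (fun x hx => h1 x (by simp [Term.gn, hx]))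
      (fun c hc => (h2 c hc).imp_right fun h h' => h (by
        change _ ∈ (Term.mis _ _ (T.ren σ)).gn
        simp only [Term.gn, Finset.mem_union, h', or_true])))
  | repOut a b T =>
    intro σ τ h1 _
    rw [Term.ren_congr (τ := τ) (fun x hx => h1 x hx (by simp [Act.bn]))]
    exact Step.repOut (τ a) (τ b) (T.ren τ)
  | repIn a b T =>
    intro σ τ h1 _
    rw [Term.ren_congr (τ := τ) (fun x hx => h1 x hx (by simp [Act.bn]))]
    have := Step.repIn (τ a) (τ b) (T.ren τ)
    rw [← Term.inst_ren] at this
    simp only [Term.ren, Term.map, Nm.lift_ren] at this ⊢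
    exact this

theorem Step.ren {P P' : Proc} {l : Act} (h : Step P l P') (σ : Equiv.Perm Name) :
    Step (P.ren σ) (l.ren σ) (P'.ren σ) :=
  h.ren_ren σ σ (fun _ _ _ => rfl) (fun _ _ => .inl rfl)

theorem Tau.ren {P P' : Proc} (h : Tau P P') (σ : Equiv.Perm Name) : Tau (P.ren σ) (P'.ren σ) :=
  Step.ren h σ

theorem Taus.ren {P P' : Proc} (h : Taus P P') (σ : Equiv.Perm Name) :
    Taus (P.ren σ) (P'.ren σ) :=
  Relation.ReflTransGen.lift (Term.ren σ) (fun _ _ h => Tau.ren h σ) _ _ h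

theorem TausPlus.ren {P P' : Proc} (h : TausPlus P P') (σ : Equiv.Perm Name) :
    TausPlus (P.ren σ) (P'.ren σ) :=
  Relation.TransGen.lift (Term.ren σ) (fun _ _ h => Tau.ren h σ) _ _ h

/-- The bound name of a bound output can be replaced by any fresh name. -/
theorem Step.bout_swap {P P' : Proc} {a c d : Name} (h : Step P (.bout a c) P') (hd : d ∉ P.gn) :
    Step P (.bout a d) (P'.ren (Equiv.swap c d)) := by
  have key : ∀ x ∈ P.gn, x ≠ c → Equiv.swap c d x = x := fun x hx hxc =>
    Equiv.swap_apply_of_ne_of_ne hxc (by rintro rfl; exact hd hx)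
  have := h.ren_ren 1 (Equiv.swap c d)
    (fun x hx hxc => (key x hx (by simpa [Act.bn] using hxc)).symm)
    (fun x hx => by
      simp only [Act.bn, Finset.mem_singleton] at hx
      subst hx
      simp [hd])
  rw [Term.ren_one] at this
  simpa [Act.ren, key a h.bout_subj_mem h.bout_ne] using this

theorem Step.localize {P P' : Proc} {l : Act} {c : Name} (h : Step P l P') (hc : c ∉ l.names) :
    Step (nu c P) l (nu c P') := by
  refine Step.res (c := c) ?_ ?_ hc
  · simp [gn_map_absNm]
  · rwa [absNm_inst]

theorem Step.nu_extrude {P P' : Proc} {a c d : Name} (h : Step P (.out a c) P') (hac : a ≠ c)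
    (hd : d ∉ P.gn) : Step (nu c P) (.bout a d) (P'.ren (Equiv.swap c d)) := by
  have had : a ≠ d := by rintro rfl; exact hd h.out_subj_mem
  rw [nu_alpha (d := d) (fun h => hd (Finset.mem_of_mem_erase h))]
  refine Step.extrude (by simp [gn_map_absNm]) ?_ had
  rw [absNm_inst]
  simpa [Act.ren, Equiv.swap_apply_of_ne_of_ne hac had] using h.ren (Equiv.swap c d)

theorem Step.nu_extrude_self {P P' : Proc} {a c : Name} (h : Step P (.out a c) P') (hac : a ≠ c) :
    Step (nu c P) (.bout a c) P' := by
  refine Step.extrude (by simp [gn_map_absNm]) ?_ hac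
  rwa [absNm_inst]

/-- Inversion for localizations, when the local name does not clash with the action. -/
theorem Step.nu_cases {P X : Proc} {l : Act} {c : Name} (h : Step (nu c P) l X)
    (hc : c ∉ l.names) : (∃ P', Step P l P' ∧ X = nu c P') ∨
      ∃ a d P', l = .bout a d ∧ d ∉ P.gn ∧ a ≠ c ∧ Step P (.out a c) P' ∧
        X = P'.ren (Equiv.swap c d) := by
  unfold nu at h
  cases h with
  | @extrude _ _ a d hd hs had =>
    right
    simp only [Act.names, Finset.mem_insert, Finset.mem_singleton, not_or] at hc
    rw [gn_map_absNm] at hd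
    rw [absNm_inst_ren hd] at hs
    refine ⟨a, d, X.ren (Equiv.swap c d), rfl, ?_, Ne.symm hc.1, ?_, by simp⟩
    · intro h; exact hd (Finset.mem_erase.2 ⟨Ne.symm hc.2, h⟩)
    · simpa [Act.ren, Equiv.swap_apply_of_ne_of_ne (Ne.symm hc.1) had] using
        hs.ren (Equiv.swap c d)
  | @res _ T' _ d hd hs hdl =>
    left
    rw [gn_map_absNm] at hd
    rw [absNm_inst_ren hd] at hs
    refine ⟨T'.ren (Equiv.swap c d), ?_, ?_⟩
    · simpa [Act.ren_swap_eq_self hc hdl] using hs.ren (Equiv.swap c d)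
    · by_cases hcd : c = d
      · subst hcd; simp [← Equiv.Perm.one_def]
      rw [Equiv.swap_comm]
      apply nu_alpha
      intro h
      have h := hs.gn_subset (Finset.mem_of_mem_erase h)
      simp only [Term.gn_ren, Finset.mem_union, Finset.mem_image, hc, or_false] at h
      obtain ⟨x, hx, e⟩ := h
      have : x = d := by
        rw [← Equiv.swap_apply_left c d] at e
        simpa using congrArg (Equiv.swap c d) e
      subst this
      exact hd (Finset.mem_erase.2 ⟨Ne.symm hcd, hx⟩)

theorem Tau.nu_cases {P X : Proc} {c : Name} (h : Tau (nu c P) X) :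
    ∃ P', Tau P P' ∧ X = nu c P' := by
  rcases Step.nu_cases h (by simp [Act.names]) with h | ⟨_, _, _, h, _⟩
  · exact h
  · cases h

theorem Tau.localize {P P' : Proc} (c : Name) (h : Tau P P') : Tau (nu c P) (nu c P') :=
  Step.localize h (by simp [Act.names])

theorem Taus.localize {P P' : Proc} (c : Name) (h : Taus P P') : Taus (nu c P) (nu c P') :=
  Relation.ReflTransGen.lift (nu c) (fun _ _ h => Tau.localize c h) _ _ h

theorem TausPlus.localize {P P' : Proc} (c : Name) (h : TausPlus P P') :
    TausPlus (nu c P) (nu c P') :=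
  Relation.TransGen.lift (nu c) (fun _ _ h => Tau.localize c h) _ _ h

theorem Tau.parL {P P' : Proc} (h : Tau P P') (L : Proc) : Tau (.par P L) (.par P' L) :=
  Step.parL h (by simp [Act.bn])

theorem Tau.parR {L L' : Proc} (P : Proc) (h : Tau L L') : Tau (.par P L) (.par P L') :=
  Step.parR h (by simp [Act.bn])

theorem Taus.par {P P' L L' : Proc} (h : Taus P P') (h' : Taus L L') :
    Taus (.par P L) (.par P' L') :=
  (Relation.ReflTransGen.lift (fun X => Term.par X L) (fun _ _ h => Tau.parL h L) _ _ h).trans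
    (Relation.ReflTransGen.lift (fun X => Term.par P' X) (fun _ _ h => Tau.parR P' h) _ _ h')

theorem Taus.parL {P P' : Proc} (h : Taus P P') (L : Proc) : Taus (.par P L) (.par P' L) :=
  Taus.par h .refl

theorem Taus.parR {L L' : Proc} (P : Proc) (h : Taus L L') : Taus (.par P L) (.par P L') :=
  Taus.par .refl h

theorem TausPlus.parL {P P' : Proc} (h : TausPlus P P') (L : Proc) :
    TausPlus (.par P L) (.par P' L) :=
  Relation.TransGen.lift (fun X => Term.par X L) (fun _ _ h => Tau.parL h L) _ _ h

theorem TausPlus.parR {L L' : Proc} (P : Proc) (h : TausPlus L L') :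
    TausPlus (.par P L) (.par P L') :=
  Relation.TransGen.lift (fun X => Term.par P X) (fun _ _ h => Tau.parR P h) _ _ h

/-- Inversion for compositions; the name that is extruded from one component to the other can be
taken outside any finite set. -/
theorem Step.par_cases {S T X : Proc} {l : Act} (h : Step (.par S T) l X) (F : Finset Name)
    {C : Prop}
    (parR : ∀ T', Step T l T' → Disjoint l.bn S.gn → X = .par S T' → C)
    (parL : ∀ S', Step S l S' → Disjoint l.bn T.gn → X = .par S' T → C)
    (commR : ∀ a b S' T', l = .tau → Step S (.inp a b) S' → Step T (.out a b) T' →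
      X = .par S' T' → C)
    (commL : ∀ a b S' T', l = .tau → Step S (.out a b) S' → Step T (.inp a b) T' →
      X = .par S' T' → C)
    (closeR : ∀ a c S' T', l = .tau → Step S (.inp a c) S' → Step T (.bout a c) T' →
      c ∉ F → c ∉ S.gn → c ∉ T.gn → X = nu c (.par S' T') → C)
    (closeL : ∀ a c S' T', l = .tau → Step S (.bout a c) S' → Step T (.inp a c) T' →
      c ∉ F → c ∉ S.gn → c ∉ T.gn → X = nu c (.par S' T') → C) : C := by
  cases h with
  | parR h hd => exact parR _ h hd rfl
  | parL h hd => exact parL _ h hd rfl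
  | commR h1 h2 => exact commR _ _ _ _ rfl h1 h2 rfl
  | commL h1 h2 => exact commL _ _ _ _ rfl h1 h2 rfl
  | @closeR _ _ S' T' a c h1 h2 hc =>
    obtain ⟨d, hd⟩ := exists_fresh (F ∪ S.gn ∪ T.gn ∪ S'.gn ∪ T'.gn ∪ {c})
    simp only [Finset.mem_union, Finset.mem_singleton, not_or] at hd
    obtain ⟨⟨⟨⟨⟨hF, hS⟩, hT⟩, hS'⟩, hT'⟩, hdc⟩ := hd
    have h1' := h1.ren (Equiv.swap c d)
    have had : a ≠ d := by rintro rfl; exact hS h1.inp_subj_mem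
    rw [Term.ren_swap_eq_self hc hS, Act.ren, Equiv.swap_apply_left,
      Equiv.swap_apply_of_ne_of_ne h2.bout_ne had] at h1'
    refine closeR a d _ _ rfl h1' (h2.bout_swap hT) hF hS hT ?_
    exact nu_alpha (d := d) (by simp [Term.gn, hS', hT'])
  | @closeL _ _ S' T' a c h1 h2 hc =>
    obtain ⟨d, hd⟩ := exists_fresh (F ∪ S.gn ∪ T.gn ∪ S'.gn ∪ T'.gn ∪ {c})
    simp only [Finset.mem_union, Finset.mem_singleton, not_or] at hd
    obtain ⟨⟨⟨⟨⟨hF, hS⟩, hT⟩, hS'⟩, hT'⟩, hdc⟩ := hd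
    have h2' := h2.ren (Equiv.swap c d)
    have had : a ≠ d := by rintro rfl; exact hT h2.inp_subj_mem
    rw [Term.ren_swap_eq_self hc hT, Act.ren, Equiv.swap_apply_left,
      Equiv.swap_apply_of_ne_of_ne h1.bout_ne had] at h2'
    refine closeL a d _ _ rfl (h1.bout_swap hS) h2' hF hS hT ?_
    exact nu_alpha (d := d) (by simp [Term.gn, hS', hT'])

/-! ### Bisimulations and codivergence -/

/-- `B` simulates every action of `A` in the branching style, with targets related by `R`. -/
def SimAt (R : Proc → Proc → Prop) (A B : Proc) : Prop :=
  ∀ l A', Step A l A' → Disjoint l.bn B.gn →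
    (l = .tau ∧ ∃ B', Taus B B' ∧ R A B' ∧ R A' B') ∨
    ∃ B'' B', Taus B B'' ∧ R A B'' ∧ Step B'' l B' ∧ R A' B'

/-- Every infinite internal action sequence of `A` is answered by `B`. -/
def CodivAt (R : Proc → Proc → Prop) (A B : Proc) : Prop :=
  ∀ s : ℕ → Proc, s 0 = A → (∀ i, Tau (s i) (s (i + 1))) →
    ∃ k B', 1 ≤ k ∧ TausPlus B B' ∧ R (s k) B'

theorem IsPiBisimulation.of_symm {R : Proc → Proc → Prop} (symm : ∀ {P Q}, R P Q → R Q P)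
    (sim : ∀ {P Q}, R P Q → SimAt R P Q) (codiv : ∀ {P Q}, R P Q → CodivAt R P Q) :
    IsPiBisimulation R where
  codivergent :=
    { left := fun h s h0 hs => by
        obtain ⟨k, P', hk, h1, h2⟩ := codiv (symm h) s h0 hs
        exact ⟨k, P', hk, h1, symm h2⟩
      right := fun h s h0 hs => codiv h s h0 hs }
  bisimulation :=
    { left := fun h hs => by
        rcases sim h _ _ hs (by simp [Act.bn]) with ⟨_, h⟩ | h
        · exact .inl h
        · exact .inr h
      right := fun h hs => by
        rcases sim (symm h) _ _ hs (by simp [Act.bn]) with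
          ⟨_, P', h1, h2, h3⟩ | ⟨P'', P', h1, h2, h3, h4⟩
        · exact .inl ⟨P', h1, symm h2, symm h3⟩
        · exact .inr ⟨P'', P', h1, symm h2, h3, symm h4⟩ }
  left := fun hl hd h hs => by
    rcases sim h _ _ hs hd with ⟨h, _⟩ | ⟨P'', P', h1, h2, h3, h4⟩
    · exact absurd h hl
    · exact ⟨P'', P', h1, h3, h4, h2⟩
  right := fun hl hd h hs => by
    rcases sim (symm h) _ _ hs hd with ⟨h, _⟩ | ⟨P'', P', h1, h2, h3, h4⟩
    · exact absurd h hl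
    · exact ⟨P'', P', h1, h3, symm h4, symm h2⟩

theorem IsCodivergent.flip {R : Proc → Proc → Prop} (h : IsCodivergent R) :
    IsCodivergent (flip R) := ⟨fun h' => h.right h', fun h' => h.left h'⟩

theorem IsBisimulation.flip {R : Proc → Proc → Prop} (h : IsBisimulation R) :
    IsBisimulation (flip R) := ⟨fun h' => h.right h', fun h' => h.left h'⟩

theorem IsPiBisimulation.flip {R : Proc → Proc → Prop} (h : IsPiBisimulation R) :
    IsPiBisimulation (flip R) :=
  ⟨h.codivergent.flip, h.bisimulation.flip, fun hl hd h' hs => h.right hl hd h' hs,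
    fun hl hd h' hs => h.left hl hd h' hs⟩

theorem IsPiBisimulation.simAt {R : Proc → Proc → Prop} (h : IsPiBisimulation R) {P Q : Proc}
    (hPQ : R P Q) : SimAt R P Q := by
  intro l P' hs hd
  by_cases hl : l = .tau
  · subst hl
    exact (h.bisimulation.left hPQ hs).imp (fun h => ⟨rfl, h⟩) id
  · obtain ⟨Q'', Q', h1, h2, h3, h4⟩ := h.left hl hd hPQ hs
    exact .inr ⟨Q'', Q', h1, h4, h2, h3⟩

theorem SimAt.mono {R S : Proc → Proc → Prop} (hRS : ∀ P Q, R P Q → S P Q) {P Q : Proc}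
    (h : SimAt R P Q) : SimAt S P Q := by
  intro l P' hs hd
  rcases h l P' hs hd with ⟨hl, Q', h1, h2, h3⟩ | ⟨Q'', Q', h1, h2, h3, h4⟩
  · exact .inl ⟨hl, Q', h1, hRS _ _ h2, hRS _ _ h3⟩
  · exact .inr ⟨Q'', Q', h1, hRS _ _ h2, h3, hRS _ _ h4⟩

theorem CodivAt.mono {R S : Proc → Proc → Prop} (hRS : ∀ P Q, R P Q → S P Q) {P Q : Proc}
    (h : CodivAt R P Q) : CodivAt S P Q := by
  intro s h0 hs
  obtain ⟨k, Q', h1, h2, h3⟩ := h s h0 hs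
  exact ⟨k, Q', h1, h2, hRS _ _ h3⟩

/-- Simulation is invariant under renaming when the relation is. -/
theorem SimAt.ren {R : Proc → Proc → Prop} (hR : ∀ (σ : Equiv.Perm Name) {P Q}, R P Q →
    R (P.ren σ) (Q.ren σ)) {P Q : Proc} (h : SimAt R P Q) (σ : Equiv.Perm Name) :
    SimAt R (P.ren σ) (Q.ren σ) := by
  intro l P' hs hd
  have hs' := hs.ren σ⁻¹
  rw [Term.ren_inv_ren] at hs'
  have hd' : Disjoint (l.ren σ⁻¹).bn Q.gn := by
    rw [Act.bn_ren]
    rw [Term.gn_ren] at hd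
    rw [Finset.disjoint_left] at hd ⊢
    intro x hx hx'
    obtain ⟨y, hy, rfl⟩ := Finset.mem_image.1 hx
    exact hd hy (Finset.mem_image.2 ⟨_, hx', by simp⟩)
  have e : (l.ren σ⁻¹).ren σ = l := by simp [Act.ren_ren]
  rcases h _ _ hs' hd' with ⟨hl, Q', h1, h2, h3⟩ | ⟨Q'', Q', h1, h2, h3, h4⟩
  · refine .inl ⟨Act.ren_eq_tau.1 hl, _, h1.ren σ, hR σ h2, ?_⟩
    simpa using hR σ h3
  · refine .inr ⟨_, _, h1.ren σ, hR σ h2, ?_, by simpa using hR σ h4⟩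
    simpa only [e] using h3.ren σ

theorem piBisimilar_isPiBisimulation : IsPiBisimulation PiBisimilar := by
  refine IsPiBisimulation.of_symm ?_ ?_ ?_
  · rintro P Q ⟨R, hR, h⟩
    exact ⟨_, hR.flip, h⟩
  · rintro P Q ⟨R, hR, h⟩
    exact (hR.simAt h).mono fun _ _ h => ⟨R, hR, h⟩
  · rintro P Q ⟨R, hR, h⟩
    exact CodivAt.mono (fun _ _ h => ⟨R, hR, h⟩) (hR.codivergent.right h)

theorem PiBisimilar.symm {P Q : Proc} : PiBisimilar P Q → PiBisimilar Q P := by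
  rintro ⟨R, hR, h⟩
  exact ⟨_, hR.flip, h⟩

theorem PiBisimilar.refl (P : Proc) : PiBisimilar P P := by
  refine ⟨Eq, IsPiBisimulation.of_symm Eq.symm ?_ ?_, rfl⟩
  · rintro P _ rfl l P' hs _
    exact .inr ⟨P, P', .refl, rfl, hs, rfl⟩
  · rintro P _ rfl s h0 hs
    exact ⟨1, s 1, le_rfl, .single (h0 ▸ hs 0), rfl⟩

theorem PiBisimilar.ren {P Q : Proc} (h : PiBisimilar P Q) (σ : Equiv.Perm Name) :
    PiBisimilar (P.ren σ) (Q.ren σ) := by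
  refine ⟨fun P Q => ∃ σ : Equiv.Perm Name, PiBisimilar (P.ren σ) (Q.ren σ),
    IsPiBisimulation.of_symm (fun ⟨σ, h⟩ => ⟨σ, h.symm⟩) ?_ ?_, σ⁻¹, by simpa using h⟩
  · rintro P Q ⟨σ, h⟩
    have hsim := (piBisimilar_isPiBisimulation.simAt h).mono
      (S := fun P Q => ∃ σ : Equiv.Perm Name, PiBisimilar (P.ren σ) (Q.ren σ))
      (fun P Q h => ⟨1, by simpa using h⟩)
    have := SimAt.ren (fun τ P Q ⟨σ, h⟩ => ⟨σ * τ⁻¹, by simpa [Term.ren_ren] using h⟩) hsim σ⁻¹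
    simpa using this
  · rintro P Q ⟨σ, h⟩ s h0 hs
    obtain ⟨k, Q', hk, h1, h2⟩ := piBisimilar_isPiBisimulation.codivergent.right h
      (fun i => (s i).ren σ) (by rw [h0]) (fun i => (hs i).ren σ)
    refine ⟨k, Q'.ren σ⁻¹, hk, by simpa using h1.ren σ⁻¹, σ, by simpa using h2⟩

theorem PiBisimilar.simAt {P Q : Proc} (h : PiBisimilar P Q) : SimAt PiBisimilar P Q :=
  piBisimilar_isPiBisimulation.simAt h

/-- Bisimulations also answer sequences of internal actions. -/
theorem IsBisimulation.taus {R : Proc → Proc → Prop} (hR : IsBisimulation R) {P Q P' : Proc}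
    (h : R P Q) (hs : Taus P P') : ∃ Q', Taus Q Q' ∧ R P' Q' := by
  induction hs with
  | refl => exact ⟨Q, .refl, h⟩
  | tail _ hs ih =>
    obtain ⟨Q₁, h1, h2⟩ := ih
    rcases hR.left h2 hs with ⟨Q', h3, _, h4⟩ | ⟨Q'', Q', h3, _, h4, h5⟩
    · exact ⟨Q', h1.trans h3, h4⟩
    · exact ⟨Q', (h1.trans h3).tail h4, h5⟩

/-- If every infinite internal action sequence from `A` eventually enters `G`, then the internal
actions that avoid `G` are well-founded below `A`. -/
theorem acc_of_forall_seq {G : Proc → Prop} {A : Proc}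
    (h : ∀ s : ℕ → Proc, s 0 = A → (∀ i, Tau (s i) (s (i + 1))) → ∃ k, 1 ≤ k ∧ G (s k)) :
    Acc (fun y x => Tau x y ∧ ¬ G y) A := by
  by_contra hA
  obtain ⟨s, h0, hs⟩ := not_acc_iff_exists_descending_chain.1 hA
  obtain ⟨k, hk, hG⟩ := h s h0 fun i => (hs i).1
  obtain ⟨k, rfl⟩ := Nat.exists_eq_add_of_le' hk
  exact (hs k).2 hG

/-- Internal actions from `P` to `P'` either avoid `G` altogether or pass through `G`. The
relation is written in the direction of `acc_of_forall_seq`. -/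
theorem TausPlus.avoid_or {G : Proc → Prop} {P P' : Proc} (h : TausPlus P P') :
    Relation.TransGen (fun y x => Tau x y ∧ ¬ G y) P' P ∨ ∃ X, G X ∧ Taus X P' := by
  induction h with
  | @single P₁ h =>
    by_cases hG : G P₁
    · exact .inr ⟨P₁, hG, .refl⟩
    · exact .inl (.single ⟨h, hG⟩)
  | @tail P₁ P₂ _ h ih =>
    by_cases hG : G P₂
    · exact .inr ⟨P₂, hG, .refl⟩
    · rcases ih with ih | ⟨X, h1, h2⟩
      · exact .inl (.head ⟨h, hG⟩ ih)
      · exact .inr ⟨X, h1, h2.tail h⟩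

theorem IsBisimulation.of_symm {R : Proc → Proc → Prop} (symm : ∀ {P Q}, R P Q → R Q P)
    (h : ∀ {P Q P'}, R P Q → Tau P P' → (∃ Q', Taus Q Q' ∧ R P Q' ∧ R P' Q') ∨
      (∃ Q'' Q', Taus Q Q'' ∧ R P Q'' ∧ Tau Q'' Q' ∧ R P' Q')) : IsBisimulation R where
  left := h
  right := fun hr hs => by
    rcases h (symm hr) hs with ⟨P', h1, h2, h3⟩ | ⟨P'', P', h1, h2, h3, h4⟩
    · exact .inl ⟨P', h1, symm h2, symm h3⟩
    · exact .inr ⟨P'', P', h1, symm h2, h3, symm h4⟩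

theorem IsBisimulation.comp_left {R S : Proc → Proc → Prop} (hR : IsBisimulation R)
    (hS : IsBisimulation S) {P Q P' : Proc} (h : Relation.Comp R S P Q) (hs : Tau P P') :
    (∃ Q', Taus Q Q' ∧ Relation.Comp R S P Q' ∧ Relation.Comp R S P' Q') ∨
    (∃ Q'' Q', Taus Q Q'' ∧ Relation.Comp R S P Q'' ∧ Tau Q'' Q' ∧ Relation.Comp R S P' Q') := by
  obtain ⟨M, hPM, hMQ⟩ := h
  rcases hR.left hPM hs with ⟨M', h1, h2, h3⟩ | ⟨M'', M', h1, h2, h3, h4⟩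
  · obtain ⟨Q', h4, h5⟩ := hS.taus hMQ h1
    exact .inl ⟨Q', h4, ⟨M', h2, h5⟩, ⟨M', h3, h5⟩⟩
  · obtain ⟨Q₁, h5, h6⟩ := hS.taus hMQ h1
    rcases hS.left h6 h3 with ⟨Q', h7, h8, h9⟩ | ⟨Q'', Q', h7, h8, h9, h10⟩
    · exact .inl ⟨Q', h5.trans h7, ⟨M'', h2, h8⟩, ⟨M', h4, h9⟩⟩
    · exact .inr ⟨Q'', Q', h5.trans h7, ⟨M'', h2, h8⟩, h9, ⟨M', h4, h10⟩⟩

/-- Codivergence is preserved by composition: the answers of the intermediate process either reach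
a point that the last process has answered, or form a well-founded descent. -/
theorem codivAt_comp {R S : Proc → Proc → Prop} (hR : IsCodivergent R)
    (hS : IsCodivergent S) (hS' : IsBisimulation S) {P M Q : Proc} (hPM : R P M) (hMQ : S M Q) :
    CodivAt (Relation.Comp R S) P Q := by
  have hacc : Acc (fun y x => Tau x y ∧ ¬ ∃ Q', TausPlus Q Q' ∧ S y Q') M :=
    acc_of_forall_seq fun s h0 hs => by
      obtain ⟨k, Q', h1, h2, h3⟩ := hS.right hMQ s h0 hs
      exact ⟨k, h1, Q', h2, h3⟩
  clear hMQ
  replace hacc := hacc.transGen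
  induction hacc generalizing P with
  | intro M _ ih =>
    intro s h0 hs
    obtain ⟨k, M', hk, h1, h2⟩ := hR.right hPM s h0 hs
    rcases h1.avoid_or (G := fun y => ∃ Q', TausPlus Q Q' ∧ S y Q') with
      h3 | ⟨X, ⟨Q', h3, h4⟩, h5⟩
    · obtain ⟨k', Q', _, h4, h5⟩ := ih M' h3 h2 (fun i => s (k + i)) rfl (fun i => hs (k + i))
      exact ⟨k + k', Q', by omega, h4, h5⟩
    · obtain ⟨Q'', h6, h7⟩ := hS'.taus h4 h5
      exact ⟨k, Q'', hk, Relation.TransGen.trans_left h3 h6, M', h2, h7⟩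

theorem IsAbsolute.flip {R : Proc → Proc → Prop} (h : IsAbsolute R) : IsAbsolute (flip R) :=
  ⟨h.refl, fun P Q h' => (h.equipollent Q P h').symm,
    ⟨fun h1 h2 => h.extensional.par h1 h2, fun c h' => h.extensional.nu c h'⟩,
    h.codivergent.flip, h.bisimulation.flip⟩

theorem IsAbsolute.comp {R S : Proc → Proc → Prop} (hR : IsAbsolute R) (hS : IsAbsolute S) :
    IsAbsolute (Relation.Comp R S) where
  refl P := ⟨P, hR.refl P, hS.refl P⟩
  equipollent := fun P Q ⟨M, h1, h2⟩ => (hR.equipollent P M h1).trans (hS.equipollent M Q h2)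
  extensional :=
    ⟨fun ⟨M, h1, h2⟩ ⟨N, h3, h4⟩ => ⟨.par M N, hR.extensional.par h1 h3,
      hS.extensional.par h2 h4⟩,
      fun c ⟨M, h1, h2⟩ => ⟨nu c M, hR.extensional.nu c h1, hS.extensional.nu c h2⟩⟩
  codivergent :=
    { left := fun ⟨M, h1, h2⟩ s h0 hs => by
        obtain ⟨k, P', hk, h3, N, h4, h5⟩ := codivAt_comp hS.codivergent.flip
          hR.codivergent.flip hR.bisimulation.flip h2 h1 s h0 hs
        exact ⟨k, P', hk, h3, N, h5, h4⟩
      right := fun ⟨M, h1, h2⟩ s h0 hs =>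
        codivAt_comp hR.codivergent hS.codivergent hS.bisimulation h1 h2 s h0 hs }
  bisimulation :=
    { left := fun h hs => hR.bisimulation.comp_left hS.bisimulation h hs
      right := fun ⟨M, h1, h2⟩ hs => by
        rcases hS.bisimulation.flip.comp_left hR.bisimulation.flip ⟨M, h2, h1⟩ hs with
          ⟨P', h3, ⟨N, h4, h5⟩, ⟨N', h6, h7⟩⟩ | ⟨P'', P', h3, ⟨N, h4, h5⟩, h8, ⟨N', h6, h7⟩⟩
        · exact .inl ⟨P', h3, ⟨N, h5, h4⟩, ⟨N', h7, h6⟩⟩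
        · exact .inr ⟨P'', P', h3, ⟨N, h5, h4⟩, h8, ⟨N', h7, h6⟩⟩ }

theorem AbsEq.symm {P Q : Proc} : AbsEq P Q → AbsEq Q P := by
  rintro ⟨R, hR, h⟩
  exact ⟨_, hR.flip, h⟩

theorem AbsEq.trans {P Q S : Proc} : AbsEq P Q → AbsEq Q S → AbsEq P S := by
  rintro ⟨R, hR, h⟩ ⟨R', hR', h'⟩
  exact ⟨_, hR.comp hR', Q, h, h'⟩

theorem isAbsolute_eq : IsAbsolute (Eq : Proc → Proc → Prop) where
  refl P := rfl
  equipollent := by rintro P _ rfl; rfl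
  extensional := ⟨by rintro L _ P _ rfl rfl; rfl, by rintro P _ c rfl; rfl⟩
  codivergent :=
    ⟨by rintro P _ rfl s h0 hs; exact ⟨1, s 1, le_rfl, .single (h0 ▸ hs 0), rfl⟩,
      by rintro P _ rfl s h0 hs; exact ⟨1, s 1, le_rfl, .single (h0 ▸ hs 0), rfl⟩⟩
  bisimulation :=
    ⟨by rintro P _ P' rfl hs; exact .inr ⟨P, P', .refl, rfl, hs, rfl⟩,
      by rintro P _ P' rfl hs; exact .inr ⟨P, P', .refl, rfl, hs, rfl⟩⟩

/-- The union of all relations that meet the requirements of the absolute equality meets them. For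
closure under composition this uses that these relations compose. -/
theorem absEq_isAbsolute : IsAbsolute AbsEq where
  refl P := ⟨_, isAbsolute_eq, rfl⟩
  equipollent := fun P Q ⟨_, hR, h⟩ => hR.equipollent P Q h
  extensional :=
    ⟨fun {_ M P _} ⟨R, hR, h⟩ ⟨_, hS, h'⟩ => ⟨_, hR.comp hS, .par M P,
      hR.extensional.par h (hR.refl P), hS.extensional.par (hS.refl M) h'⟩,
      fun c ⟨R, hR, h⟩ => ⟨R, hR, hR.extensional.nu c h⟩⟩
  codivergent :=
    ⟨fun ⟨R, hR, h⟩ s h0 hs => by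
      obtain ⟨k, P', hk, h1, h2⟩ := hR.codivergent.left h s h0 hs
      exact ⟨k, P', hk, h1, R, hR, h2⟩,
      fun ⟨R, hR, h⟩ s h0 hs => by
      obtain ⟨k, P', hk, h1, h2⟩ := hR.codivergent.right h s h0 hs
      exact ⟨k, P', hk, h1, R, hR, h2⟩⟩
  bisimulation := IsBisimulation.of_symm AbsEq.symm fun ⟨R, hR, h⟩ hs => by
    rcases hR.bisimulation.left h hs with ⟨Q', h1, h2, h3⟩ | ⟨Q'', Q', h1, h2, h3, h4⟩
    · exact .inl ⟨Q', h1, ⟨R, hR, h2⟩, ⟨R, hR, h3⟩⟩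
    · exact .inr ⟨Q'', Q', h1, ⟨R, hR, h2⟩, h3, ⟨R, hR, h4⟩⟩

theorem AbsEq.refl (P : Proc) : AbsEq P P := absEq_isAbsolute.refl P

theorem AbsEq.par {L M P Q : Proc} (h : AbsEq L M) (h' : AbsEq P Q) :
    AbsEq (.par L P) (.par M Q) := absEq_isAbsolute.extensional.par h h'

theorem AbsEq.nu {P Q : Proc} (c : Name) (h : AbsEq P Q) : AbsEq (nu c P) (nu c Q) :=
  absEq_isAbsolute.extensional.nu c h

/-! ### The external bisimilarity is an absolute relation -/

/-- The closure of the external bisimilarity under composition, followed by localization. -/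
inductive Cl : Proc → Proc → Prop
  | base {P Q : Proc} : PiBisimilar P Q → Cl P Q
  | par {P Q L M : Proc} : PiBisimilar P Q → PiBisimilar L M → Cl (.par P L) (.par Q M)
  | nu {A B : Proc} (c : Name) : Cl A B → Cl (nu c A) (nu c B)

theorem Cl.symm {A B : Proc} (h : Cl A B) : Cl B A := by
  induction h with
  | base h => exact .base h.symm
  | par h h' => exact .par h.symm h'.symm
  | nu c _ ih => exact .nu c ih

theorem Cl.ren {A B : Proc} (h : Cl A B) (σ : Equiv.Perm Name) : Cl (A.ren σ) (B.ren σ) := by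
  induction h with
  | base h => exact .base (h.ren σ)
  | par h h' => exact .par (h.ren σ) (h'.ren σ)
  | nu c _ ih => rw [nu_ren, nu_ren]; exact .nu _ ih

theorem PiBisimilar.simulate {P Q P' : Proc} {l : Act} (h : PiBisimilar P Q) (hl : l ≠ .tau)
    (hd : Disjoint l.bn Q.gn) (hs : Step P l P') :
    ∃ Q'' Q', Taus Q Q'' ∧ PiBisimilar P Q'' ∧ Step Q'' l Q' ∧ PiBisimilar P' Q' := by
  rcases h.simAt _ _ hs hd with ⟨h, _⟩ | h
  · exact absurd h hl
  · exact h

/-- How an action of a composition is simulated: by the same action, or, if it is an internal action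
of one component, possibly by internal actions of the matching component. -/
theorem sim_par {P Q L M X : Proc} {l : Act} (hPQ : PiBisimilar P Q) (hLM : PiBisimilar L M)
    (hs : Step (.par P L) l X) (hd : Disjoint l.bn (Term.par Q M).gn) :
    (∃ Y' Y, Taus (.par Q M) Y' ∧ Cl (.par P L) Y' ∧ Step Y' l Y ∧ Cl X Y) ∨
    (l = .tau ∧ ∃ P' Q', X = .par P' L ∧ Tau P P' ∧ Taus Q Q' ∧ PiBisimilar P Q' ∧
      PiBisimilar P' Q') ∨
    (l = .tau ∧ ∃ L' M', X = .par P L' ∧ Tau L L' ∧ Taus M M' ∧ PiBisimilar L M' ∧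
      PiBisimilar L' M') := by
  have hdQ : Disjoint l.bn Q.gn := hd.mono_right Finset.subset_union_left
  have hdM : Disjoint l.bn M.gn := hd.mono_right Finset.subset_union_right
  refine hs.par_cases (Q.gn ∪ M.gn) ?_ ?_ ?_ ?_ ?_ ?_
  · rintro L' hs' _ rfl
    rcases hLM.simAt _ _ hs' hdM with ⟨rfl, M', h1, h2, h3⟩ | ⟨M'', M', h1, h2, h3, h4⟩
    · exact .inr (.inr ⟨rfl, L', M', rfl, hs', h1, h2, h3⟩)
    · exact .inl ⟨_, _, h1.parR Q, .par hPQ h2, .parR h3 hdQ, .par hPQ h4⟩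
  · rintro P' hs' _ rfl
    rcases hPQ.simAt _ _ hs' hdQ with ⟨rfl, Q', h1, h2, h3⟩ | ⟨Q'', Q', h1, h2, h3, h4⟩
    · exact .inr (.inl ⟨rfl, P', Q', rfl, hs', h1, h2, h3⟩)
    · exact .inl ⟨_, _, h1.parL M, .par h2 hLM, .parL h3 hdM, .par h4 hLM⟩
  · rintro a b P' L' rfl h1 h2 rfl
    obtain ⟨Q'', Q', q1, q2, q3, q4⟩ := hPQ.simulate (by simp) (by simp [Act.bn]) h1
    obtain ⟨M'', M', m1, m2, m3, m4⟩ := hLM.simulate (by simp) (by simp [Act.bn]) h2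
    exact .inl ⟨_, _, q1.par m1, .par q2 m2, .commR q3 m3, .par q4 m4⟩
  · rintro a b P' L' rfl h1 h2 rfl
    obtain ⟨Q'', Q', q1, q2, q3, q4⟩ := hPQ.simulate (by simp) (by simp [Act.bn]) h1
    obtain ⟨M'', M', m1, m2, m3, m4⟩ := hLM.simulate (by simp) (by simp [Act.bn]) h2
    exact .inl ⟨_, _, q1.par m1, .par q2 m2, .commL q3 m3, .par q4 m4⟩
  · rintro a c P' L' rfl h1 h2 hF _ _ rfl
    simp only [Finset.mem_union, not_or] at hF
    obtain ⟨Q'', Q', q1, q2, q3, q4⟩ := hPQ.simulate (by simp) (by simp [Act.bn]) h1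
    obtain ⟨M'', M', m1, m2, m3, m4⟩ := hLM.simulate (by simp) (by simp [Act.bn, hF]) h2
    exact .inl ⟨_, _, q1.par m1, .par q2 m2, .closeR q3 m3 (fun h => hF.1 (q1.gn_subset h)),
      .nu c (.par q4 m4)⟩
  · rintro a c P' L' rfl h1 h2 hF _ _ rfl
    simp only [Finset.mem_union, not_or] at hF
    obtain ⟨Q'', Q', q1, q2, q3, q4⟩ := hPQ.simulate (by simp) (by simp [Act.bn, hF]) h1
    obtain ⟨M'', M', m1, m2, m3, m4⟩ := hLM.simulate (by simp) (by simp [Act.bn]) h2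
    exact .inl ⟨_, _, q1.par m1, .par q2 m2, .closeL q3 m3 (fun h => hF.2 (m1.gn_subset h)),
      .nu c (.par q4 m4)⟩

theorem simAt_par {P Q L M : Proc} (hPQ : PiBisimilar P Q) (hLM : PiBisimilar L M) :
    SimAt Cl (.par P L) (.par Q M) := by
  intro l X hs hd
  rcases sim_par hPQ hLM hs hd with h | ⟨hl, P', Q', rfl, _, h1, h2, h3⟩ |
    ⟨hl, L', M', rfl, _, h1, h2, h3⟩
  · exact .inr h
  · exact .inl ⟨hl, _, h1.parL M, .par h2 hLM, .par h3 hLM⟩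
  · exact .inl ⟨hl, _, h1.parR Q, .par hPQ h2, .par hPQ h3⟩

/-- The local name is first renamed apart from the action and from both processes. A bound output of
it stems from a free output of the body. -/
theorem simAt_nu {A B : Proc} (c : Name) (hAB : Cl A B) (h : SimAt Cl A B) :
    SimAt Cl (nu c A) (nu c B) := by
  intro l X hs hd
  obtain ⟨d, hdf⟩ := exists_fresh (A.gn ∪ B.gn ∪ l.names)
  simp only [Finset.mem_union, not_or] at hdf
  obtain ⟨⟨hdA, hdB⟩, hdl⟩ := hdf
  rw [nu_alpha (c := c) (d := d) (fun h => hdA (Finset.mem_of_mem_erase h))] at hs ⊢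
  rw [nu_alpha (c := c) (d := d) (fun h => hdB (Finset.mem_of_mem_erase h))] at hd ⊢
  replace h := h.ren (fun σ _ _ h => Cl.ren h σ) (Equiv.swap c d)
  replace hAB := hAB.ren (Equiv.swap c d)
  generalize A.ren (Equiv.swap c d) = A at *
  generalize B.ren (Equiv.swap c d) = B at *
  rw [gn_nu] at hd
  rcases hs.nu_cases hdl with ⟨A', hs', rfl⟩ | ⟨a, b, A', rfl, hbA, had, hs', rfl⟩
  · have hd' : Disjoint l.bn B.gn := by
      rw [Finset.disjoint_left] at hd ⊢
      intro x hx hx'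
      exact hd hx (Finset.mem_erase.2 ⟨by rintro rfl; exact hdl (l.bn_subset_names hx), hx'⟩)
    rcases h _ _ hs' hd' with ⟨hl, B', h1, h2, h3⟩ | ⟨B'', B', h1, h2, h3, h4⟩
    · exact .inl ⟨hl, _, h1.localize d, .nu d h2, .nu d h3⟩
    · exact .inr ⟨_, _, h1.localize d, .nu d h2, h3.localize hdl, .nu d h4⟩
  · rcases h _ _ hs' (by simp [Act.bn]) with ⟨hl, _⟩ | ⟨B'', B', h1, h2, h3, h4⟩
    · cases hl
    · have hb : b ∉ B''.gn := by
        intro h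
        simp only [Act.bn, Finset.disjoint_singleton_left, Finset.mem_erase, not_and] at hd
        refine hd ?_ (h1.gn_subset h)
        rintro rfl; simp [Act.names] at hdl
      exact .inr ⟨_, _, h1.localize d, .nu d h2, h3.nu_extrude had hb, h4.ren _⟩

/-- An infinite computation of a composition either contains a step that is answered, or stems from
an infinite computation of a component: the steps that are not answered descend in the product of
two well-founded orders. -/
theorem codivAt_par {P Q L M : Proc} (hPQ : PiBisimilar P Q) (hLM : PiBisimilar L M) :
    CodivAt Cl (.par P L) (.par Q M) := by
  have hP : Acc (fun y x => Tau x y ∧ ¬ ∃ Q', TausPlus Q Q' ∧ PiBisimilar y Q') P :=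
    acc_of_forall_seq fun s h0 hs => by
      obtain ⟨k, Q', h1, h2, h3⟩ := piBisimilar_isPiBisimulation.codivergent.right hPQ s h0 hs
      exact ⟨k, h1, Q', h2, h3⟩
  have hL : Acc (fun y x => Tau x y ∧ ¬ ∃ M', TausPlus M M' ∧ PiBisimilar y M') L :=
    acc_of_forall_seq fun s h0 hs => by
      obtain ⟨k, Q', h1, h2, h3⟩ := piBisimilar_isPiBisimulation.codivergent.right hLM s h0 hs
      exact ⟨k, h1, Q', h2, h3⟩
  induction hP generalizing L with
  | intro P _ ihP =>
  induction hL with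
  | intro L hL ihL =>
  intro s h0 hs
  have h1 : Tau (.par P L) (s 1) := h0 ▸ hs 0
  rcases sim_par hPQ hLM h1 (by simp [Act.bn]) with ⟨Y', Y, h2, _, h3, h4⟩ |
    ⟨-, P', Q', hX, hs', h2, _, h3⟩ | ⟨-, L', M', hX, hs', h2, _, h3⟩
  · exact ⟨1, Y, le_rfl, Relation.TransGen.tail' h2 h3, h4⟩
  · by_cases hG : ∃ Q', TausPlus Q Q' ∧ PiBisimilar P' Q'
    · obtain ⟨Q₁, h5, h6⟩ := hG
      exact ⟨1, _, le_rfl, h5.parL M, hX ▸ .par h6 hLM⟩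
    · rcases Relation.reflTransGen_iff_eq_or_transGen.1 h2 with rfl | h5
      · obtain ⟨k, Y, hk, h7, h8⟩ := ihP P' ⟨hs', hG⟩ h3 hLM (Acc.intro _ hL)
          (fun i => s (i + 1)) hX (fun i => hs (i + 1))
        exact ⟨k + 1, Y, by omega, h7, h8⟩
      · exact absurd ⟨Q', h5, h3⟩ hG
  · by_cases hG : ∃ M', TausPlus M M' ∧ PiBisimilar L' M'
    · obtain ⟨M₁, h5, h6⟩ := hG
      exact ⟨1, _, le_rfl, h5.parR Q, hX ▸ .par hPQ h6⟩
    · rcases Relation.reflTransGen_iff_eq_or_transGen.1 h2 with rfl | h5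
      · obtain ⟨k, Y, hk, h7, h8⟩ := ihL L' ⟨hs', hG⟩ h3 (fun i => s (i + 1)) hX
          (fun i => hs (i + 1))
        exact ⟨k + 1, Y, by omega, h7, h8⟩
      · exact absurd ⟨M', h5, h3⟩ hG

/-- The internal actions of a localization are those of its body. -/
theorem codivAt_nu {A B : Proc} (c : Name) (h : CodivAt Cl A B) :
    CodivAt Cl (nu c A) (nu c B) := by
  intro s h0 hs
  have key : ∀ i X, s i = nu c X → ∃ X', Tau X X' ∧ s (i + 1) = nu c X' := fun i X hX =>
    Tau.nu_cases (hX ▸ hs i)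
  choose! f hf hf' using key
  let t : ℕ → Proc := fun i => Nat.rec A (fun i X => f i X) i
  have ht : ∀ i, s i = nu c (t i) := fun i => by
    induction i with
    | zero => exact h0
    | succ i ih => exact hf' i _ ih
  obtain ⟨k, B', hk, h1, h2⟩ := h t rfl fun i => hf i _ (ht i)
  exact ⟨k, _, hk, h1.localize c, ht k ▸ .nu c h2⟩

theorem Cl.isPiBisimulation : IsPiBisimulation Cl := by
  refine IsPiBisimulation.of_symm Cl.symm (fun h => ?_) (fun h => ?_)
  · induction h with
    | base h => exact h.simAt.mono fun _ _ => .base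
    | par h h' => exact simAt_par h h'
    | nu c h ih => exact simAt_nu c h ih
  · induction h with
    | base h =>
      exact CodivAt.mono (fun _ _ => .base) (piBisimilar_isPiBisimulation.codivergent.right h)
    | par h h' => exact codivAt_par h h'
    | nu c _ ih => exact codivAt_nu c ih

/-- The name of a bound output is renamed apart before it is simulated. -/
theorem PiBisimilar.observable {P Q : Proc} (h : PiBisimilar P Q) (hP : Observable P) :
    Observable Q := by
  obtain ⟨P₁, P', l, hl, h1, h2⟩ := hP
  obtain ⟨Q₁, h3, h4⟩ := piBisimilar_isPiBisimulation.bisimulation.taus h h1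
  have : ∃ l P', l ≠ .tau ∧ Step P₁ l P' ∧ Disjoint l.bn Q₁.gn := by
    cases l with
    | bout a c =>
      obtain ⟨d, hd⟩ := exists_fresh (P₁.gn ∪ Q₁.gn)
      simp only [Finset.mem_union, not_or] at hd
      exact ⟨_, _, by simp, h2.bout_swap hd.1, by simp [Act.bn, hd.2]⟩
    | _ => exact ⟨_, _, hl, h2, by simp [Act.bn]⟩
  obtain ⟨l, P', hl, h2, hd⟩ := this
  obtain ⟨Q'', Q', h5, _, h6, _⟩ := h4.simulate hl hd h2
  exact ⟨Q'', Q', l, hl, h3.trans h5, h6⟩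

theorem piBisimilar_isAbsolute : IsAbsolute PiBisimilar where
  refl := .refl
  equipollent := fun _ _ h => ⟨h.observable, h.symm.observable⟩
  extensional :=
    ⟨fun h h' => ⟨Cl, Cl.isPiBisimulation, .par h h'⟩,
      fun c h => ⟨Cl, Cl.isPiBisimulation, .nu c (.base h)⟩⟩
  codivergent := piBisimilar_isPiBisimulation.codivergent
  bisimulation := piBisimilar_isPiBisimulation.bisimulation

theorem PiBisimilar.absEq {P Q : Proc} (h : PiBisimilar P Q) : AbsEq P Q :=
  ⟨_, piBisimilar_isAbsolute, h⟩

/-! ### Structural congruence -/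

/-- Structural congruence: composition is a commutative monoid, and localizations can be permuted
and extruded. Symmetry is derivable. -/
inductive SC : Proc → Proc → Prop
  | refl (P : Proc) : SC P P
  | trans {P Q S : Proc} : SC P Q → SC Q S → SC P S
  | comm (P Q : Proc) : SC (.par P Q) (.par Q P)
  | assoc (P Q S : Proc) : SC (.par (.par P Q) S) (.par P (.par Q S))
  | par_nil (P : Proc) : SC (.par P .nil) P
  | par_nil' (P : Proc) : SC P (.par P .nil)
  | ext {P Q : Proc} {c : Name} : c ∉ Q.gn → SC (.par (nu c P) Q) (nu c (.par P Q))
  | ext' {P Q : Proc} {c : Name} : c ∉ Q.gn → SC (nu c (.par P Q)) (.par (nu c P) Q)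
  | swap (c d : Name) (P : Proc) : SC (nu c (nu d P)) (nu d (nu c P))
  | parL {P P' : Proc} (Q : Proc) : SC P P' → SC (.par P Q) (.par P' Q)
  | nu {P P' : Proc} (c : Name) : SC P P' → SC (nu c P) (nu c P')

namespace SC

theorem parR {Q Q' : Proc} (P : Proc) (h : SC Q Q') : SC (.par P Q) (.par P Q') :=
  (comm P Q).trans ((h.parL P).trans (comm Q' P))

theorem assoc' (P Q S : Proc) : SC (.par P (.par Q S)) (.par (.par P Q) S) :=
  (comm _ _).trans <| (assoc _ _ _).trans <| (comm _ _).trans <| (assoc _ _ _).trans (comm _ _)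

theorem symm {P Q : Proc} (h : SC P Q) : SC Q P := by
  induction h with
  | refl P => exact .refl P
  | trans _ _ ih1 ih2 => exact ih2.trans ih1
  | comm P Q => exact .comm Q P
  | assoc P Q S => exact .assoc' P Q S
  | par_nil P => exact .par_nil' P
  | par_nil' P => exact .par_nil P
  | ext h => exact .ext' h
  | ext' h => exact .ext h
  | swap c d P => exact .swap d c P
  | parL Q _ ih => exact .parL Q ih
  | nu c _ ih => exact .nu c ih

theorem extR {P Q : Proc} {c : Name} (hc : c ∉ P.gn) :
    SC (.par P (PiCalc.nu c Q)) (PiCalc.nu c (.par P Q)) :=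
  (comm _ _).trans ((ext hc).trans (.nu c (comm _ _)))

theorem gn_eq {P Q : Proc} (h : SC P Q) : P.gn = Q.gn := by
  induction h with
  | refl P => rfl
  | trans _ _ ih1 ih2 => exact ih1.trans ih2
  | comm P Q => exact Finset.union_comm _ _
  | assoc P Q S => exact Finset.union_assoc _ _ _
  | par_nil P => simp [Term.gn]
  | par_nil' P => simp [Term.gn]
  | ext h => simp [Term.gn, Finset.erase_union_distrib, Finset.erase_eq_of_notMem h]
  | ext' h => simp [Term.gn, Finset.erase_union_distrib, Finset.erase_eq_of_notMem h]
  | swap c d P => simp [Finset.erase_right_comm]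
  | parL Q _ ih => simp [Term.gn, ih]
  | nu c _ ih => simp [ih]

theorem ren {P Q : Proc} (h : SC P Q) (σ : Equiv.Perm Name) : SC (P.ren σ) (Q.ren σ) := by
  induction h with
  | refl P => exact .refl _
  | trans _ _ ih1 ih2 => exact ih1.trans ih2
  | comm P Q => exact .comm _ _
  | assoc P Q S => exact .assoc _ _ _
  | par_nil P => exact .par_nil _
  | par_nil' P => exact .par_nil' _
  | @ext P Q c h =>
    rw [nu_ren]
    change SC (.par ((PiCalc.nu c P).ren σ) (Q.ren σ)) (PiCalc.nu _ (.par _ (Q.ren σ)))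
    rw [nu_ren]; exact .ext (by simpa using h)
  | @ext' P Q c h =>
    rw [nu_ren]
    change SC (PiCalc.nu _ (.par _ (Q.ren σ))) (.par ((PiCalc.nu c P).ren σ) (Q.ren σ))
    rw [nu_ren]; exact .ext' (by simpa using h)
  | swap c d P => simp only [nu_ren]; exact .swap _ _ _
  | parL Q _ ih => exact .parL _ ih
  | nu c _ ih => simp only [nu_ren]; exact .nu _ ih

end SC

/-- `B` simulates every action of `A` strongly, up to structural congruence. -/
def StrongSim (A B : Proc) : Prop :=
  ∀ l A', Step A l A' → ∃ B', Step B l B' ∧ SC A' B'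

theorem StrongSim.ren {A B : Proc} (h : StrongSim A B) (σ : Equiv.Perm Name) :
    StrongSim (A.ren σ) (B.ren σ) := by
  intro l A' hs
  have hs' := hs.ren σ⁻¹
  rw [Term.ren_inv_ren] at hs'
  obtain ⟨B', h1, h2⟩ := h _ _ hs'
  refine ⟨B'.ren σ, ?_, by simpa using h2.ren σ⟩
  simpa [Act.ren_ren] using h1.ren σ

theorem strongSim_comm (P Q : Proc) : StrongSim (.par P Q) (.par Q P) := by
  intro l X hs
  refine hs.par_cases ∅ ?_ ?_ ?_ ?_ ?_ ?_
  · rintro Q' h hd rfl; exact ⟨_, .parL h hd, .comm _ _⟩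
  · rintro P' h hd rfl; exact ⟨_, .parR h hd, .comm _ _⟩
  · rintro a b P' Q' rfl h1 h2 rfl; exact ⟨_, .commL h2 h1, .comm _ _⟩
  · rintro a b P' Q' rfl h1 h2 rfl; exact ⟨_, .commR h2 h1, .comm _ _⟩
  · rintro a c P' Q' rfl h1 h2 _ hP _ rfl; exact ⟨_, .closeL h2 h1 hP, .nu _ (.comm _ _)⟩
  · rintro a c P' Q' rfl h1 h2 _ _ hQ rfl; exact ⟨_, .closeR h2 h1 hQ, .nu _ (.comm _ _)⟩

theorem strongSim_assoc (P Q S : Proc) :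
    StrongSim (.par (.par P Q) S) (.par P (.par Q S)) := by
  intro l X hs
  refine hs.par_cases (P.gn ∪ Q.gn ∪ S.gn) ?_ ?_ ?_ ?_ ?_ ?_
  · rintro S' h hd rfl
    simp only [Term.gn, Finset.disjoint_union_right] at hd
    exact ⟨_, .parR (.parR h hd.2) hd.1, .assoc _ _ _⟩
  · rintro Y h hd rfl
    refine h.par_cases (P.gn ∪ Q.gn ∪ S.gn) ?_ ?_ ?_ ?_ ?_ ?_
    · rintro Q' g hd' rfl
      exact ⟨_, .parR (.parL g hd) hd', .assoc _ _ _⟩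
    · rintro P' g hd' rfl
      exact ⟨_, .parL g (by simp only [Term.gn, Finset.disjoint_union_right]; exact ⟨hd', hd⟩),
        .assoc _ _ _⟩
    · rintro a b P' Q' rfl h1 h2 rfl
      exact ⟨_, .commR h1 (.parL h2 (by simp [Act.bn])), .assoc _ _ _⟩
    · rintro a b P' Q' rfl h1 h2 rfl
      exact ⟨_, .commL h1 (.parL h2 (by simp [Act.bn])), .assoc _ _ _⟩
    · rintro a c P' Q' rfl h1 h2 hF _ _ rfl
      simp only [Finset.mem_union, not_or] at hF
      exact ⟨_, .closeR h1 (.parL h2 (by simp [Act.bn, hF])) hF.1.1,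
        (SC.ext hF.2).trans (.nu _ (.assoc _ _ _))⟩
    · rintro a c P' Q' rfl h1 h2 hF _ _ rfl
      simp only [Finset.mem_union, not_or] at hF
      exact ⟨_, .closeL h1 (.parL h2 (by simp [Act.bn])) (by simp [Term.gn, hF]),
        (SC.ext hF.2).trans (.nu _ (.assoc _ _ _))⟩
  · rintro a b Y S' rfl h h2 rfl
    refine h.par_cases ∅ ?_ ?_ ?_ ?_ ?_ ?_
    · rintro Q' g - rfl
      exact ⟨_, .parR (.commR g h2) (by simp [Act.bn]), .assoc _ _ _⟩
    · rintro P' g - rfl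
      exact ⟨_, .commR g (.parR h2 (by simp [Act.bn])), .assoc _ _ _⟩
    all_goals intro _ _ _ _ h; cases h
  · rintro a b Y S' rfl h h2 rfl
    refine h.par_cases ∅ ?_ ?_ ?_ ?_ ?_ ?_
    · rintro Q' g - rfl
      exact ⟨_, .parR (.commL g h2) (by simp [Act.bn]), .assoc _ _ _⟩
    · rintro P' g - rfl
      exact ⟨_, .commL g (.parR h2 (by simp [Act.bn])), .assoc _ _ _⟩
    all_goals intro _ _ _ _ h; cases h
  · rintro a c Y S' rfl h h2 hF _ _ rfl
    simp only [Finset.mem_union, not_or] at hF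
    refine h.par_cases ∅ ?_ ?_ ?_ ?_ ?_ ?_
    · rintro Q' g - rfl
      exact ⟨_, .parR (.closeR g h2 hF.1.2) (by simp [Act.bn]),
        (SC.nu _ (.assoc _ _ _)).trans (SC.extR hF.1.1).symm⟩
    · rintro P' g - rfl
      exact ⟨_, .closeR g (.parR h2 (by simp [Act.bn, hF])) hF.1.1, .nu _ (.assoc _ _ _)⟩
    all_goals intro _ _ _ _ h; cases h
  · rintro a c Y S' rfl h h2 hF _ _ rfl
    simp only [Finset.mem_union, not_or] at hF
    refine h.par_cases ∅ ?_ ?_ ?_ ?_ ?_ ?_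
    · rintro Q' g - rfl
      exact ⟨_, .parR (.closeL g h2 hF.2) (by simp [Act.bn]),
        (SC.nu _ (.assoc _ _ _)).trans (SC.extR hF.1.1).symm⟩
    · rintro P' g - rfl
      exact ⟨_, .closeL g (.parR h2 (by simp [Act.bn])) (by simp [Term.gn, hF]),
        .nu _ (.assoc _ _ _)⟩
    all_goals intro _ _ _ _ h; cases h

theorem not_step_nil {l : Act} {X : Proc} (h : Step .nil l X) : False := by cases h

theorem strongSim_par_nil (P : Proc) : StrongSim (.par P .nil) P := by
  intro l X hs
  refine hs.par_cases ∅ ?_ ?_ ?_ ?_ ?_ ?_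
  · rintro _ h; exact (not_step_nil h).elim
  · rintro P' h _ rfl; exact ⟨P', h, .par_nil P'⟩
  · rintro _ _ _ _ _ _ h; exact (not_step_nil h).elim
  · rintro _ _ _ _ _ _ h; exact (not_step_nil h).elim
  · rintro _ _ _ _ _ _ h; exact (not_step_nil h).elim
  · rintro _ _ _ _ _ _ h; exact (not_step_nil h).elim

/-- Scope extrusion for a local name that is fresh for the action. If the local name is sent to `Q`,
then this is an extrusion on the left and an ordinary communication on the right. -/
theorem ext_sim {P Q X : Proc} {l : Act} {c : Name} (hcQ : c ∉ Q.gn) (hcl : c ∉ l.names)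
    (hs : Step (.par (nu c P) Q) l X) : ∃ Y, Step (nu c (.par P Q)) l Y ∧ SC X Y := by
  have hQ' : ∀ {l Q'}, Step Q l Q' → c ∉ l.names → c ∉ Q'.gn := fun h hl h' => by
    have := h.gn_subset h'
    simp only [Finset.mem_union] at this
    tauto
  refine hs.par_cases (P.gn ∪ Q.gn ∪ {c}) ?_ ?_ ?_ ?_ ?_ ?_
  · rintro Q' h hd rfl
    refine ⟨_, (Step.parR h ?_).localize hcl, .ext (hQ' h hcl)⟩
    rw [gn_nu] at hd
    rw [Finset.disjoint_left] at hd ⊢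
    intro x hx hx'
    exact hd hx (Finset.mem_erase.2 ⟨by rintro rfl; exact hcl (l.bn_subset_names hx), hx'⟩)
  · rintro Y h hd rfl
    rcases h.nu_cases hcl with ⟨P', g, rfl⟩ | ⟨a, b, P', rfl, hb, hac, g, rfl⟩
    · exact ⟨_, (Step.parL g hd).localize hcl, .ext hcQ⟩
    · have hbQ : b ∉ Q.gn := Finset.disjoint_singleton_left.1 hd
      refine ⟨_, (Step.parL (T := Q) g (by simp [Act.bn])).nu_extrude hac
        (d := b) (by
          simp only [Term.gn, Finset.mem_union, hb, hbQ, or_self, not_false_eq_true]), ?_⟩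
      change SC _ (.par (P'.ren _) (Q.ren _))
      rw [Term.ren_swap_eq_self hcQ hbQ]
      exact .refl _
  · rintro a b Y Q' rfl h h2 rfl
    have hca : c ≠ a := by rintro rfl; exact hcQ h2.out_subj_mem
    have hcb : c ≠ b := by rintro rfl; exact hcQ h2.obj_mem
    rcases h.nu_cases (by simp [Act.names, hca, hcb]) with ⟨P', g, rfl⟩ | ⟨_, _, _, h, _⟩
    · exact ⟨_, (Step.commR g h2).localize hcl, .ext (hQ' h2 (by simp [Act.names, hca, hcb]))⟩
    · cases h
  · rintro a b Y Q' rfl h h2 rfl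
    have hca : c ≠ a := by rintro rfl; exact hcQ h2.inp_subj_mem
    have hcb : c ≠ b := by rintro rfl; simpa using h.obj_mem
    rcases h.nu_cases (by simp [Act.names, hca, hcb]) with ⟨P', g, rfl⟩ | ⟨_, _, _, h, _⟩
    · exact ⟨_, (Step.commL g h2).localize hcl, .ext (hQ' h2 (by simp [Act.names, hca, hcb]))⟩
    · cases h
  · rintro a b Y Q' rfl h h2 hF _ _ rfl
    simp only [Finset.mem_union, Finset.mem_singleton, not_or] at hF
    have hca : c ≠ a := by rintro rfl; exact hcQ h2.bout_subj_mem
    have hcb : c ≠ b := Ne.symm hF.2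
    rcases h.nu_cases (by simp [Act.names, hca, hcb]) with ⟨P', g, rfl⟩ | ⟨_, _, _, h, _⟩
    · exact ⟨_, (Step.closeR g h2 hF.1.1).localize hcl,
        (SC.nu _ (.ext (hQ' h2 (by simp [Act.names, hca, hcb])))).trans (.swap _ _ _)⟩
    · cases h
  · rintro a b Y Q' rfl h h2 hF _ _ rfl
    simp only [Finset.mem_union, Finset.mem_singleton, not_or] at hF
    have hca : c ≠ a := by rintro rfl; exact hcQ h2.inp_subj_mem
    have hcb : c ≠ b := Ne.symm hF.2
    rcases h.nu_cases (by simp [Act.names, hca, hcb]) with 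
        ⟨P', g, rfl⟩ | ⟨a', b', P', e, hb, hac, g, rfl⟩
    · exact ⟨_, (Step.closeL g h2 hF.1.2).localize hcl,
        (SC.nu _ (.ext (hQ' h2 (by simp [Act.names, hca, hcb])))).trans (.swap _ _ _)⟩
    · -- The local name `c` is extruded to `Q` under the name `b`.
      cases e
      have hab : a ≠ b := by rintro rfl; exact hF.1.2 h2.inp_subj_mem
      have h2' := h2.ren (Equiv.swap c b)
      rw [Term.ren_swap_eq_self hcQ hF.1.2, Act.ren, Equiv.swap_apply_right,
        Equiv.swap_apply_of_ne_of_ne hac hab] at h2'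
      refine ⟨_, (Step.commL g h2').localize hcl, ?_⟩
      have hX : b ∉ (Term.par P' (Q'.ren (Equiv.swap c b))).gn := by
        simp only [Term.gn, Finset.mem_union, not_or]
        constructor
        · intro h'
          have := g.gn_subset h'
          simp only [Act.names, Finset.mem_union, Finset.mem_insert, Finset.mem_singleton] at this
          rcases this with h' | h' | h'
          · exact hF.1.1 h'
          · exact hab h'.symm
          · exact hcb h'.symm
        · rw [Term.gn_ren]
          intro h'
          obtain ⟨x, hx, e⟩ := Finset.mem_image.1 h'
          obtain rfl : x = c :=
            (Equiv.swap c b).injective (e.trans (Equiv.swap_apply_left c b).symm)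
          exact hQ' h2 (by simp [Act.names, hca, hcb]) hx
      rw [nu_alpha (c := c) (d := b) (fun h' => hX (Finset.mem_of_mem_erase h'))]
      change SC _ (nu b (.par _ ((Q'.ren _).ren _)))
      rw [Term.ren_swap_swap]
      exact .refl _

theorem ext_sim' {P Q X : Proc} {l : Act} {c : Name} (hcQ : c ∉ Q.gn) (hcl : c ∉ l.names)
    (hs : Step (nu c (.par P Q)) l X) : ∃ Y, Step (.par (nu c P) Q) l Y ∧ SC X Y := by
  have hQ' : ∀ {l Q'}, Step Q l Q' → c ∉ l.names → c ∉ Q'.gn := fun h hl h' => by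
    have := h.gn_subset h'
    simp only [Finset.mem_union] at this
    tauto
  have hnu : ∀ x, x ∉ P.gn → x ∉ (nu c P).gn := fun x hx h => by
    rw [gn_nu] at h; exact hx (Finset.mem_of_mem_erase h)
  rcases hs.nu_cases hcl with ⟨Z, h, rfl⟩ | ⟨a, d, Z, rfl, hd, hac, h, rfl⟩
  · refine h.par_cases (P.gn ∪ Q.gn ∪ {c}) ?_ ?_ ?_ ?_ ?_ ?_
    · rintro Q' g hd rfl
      refine ⟨_, .parR g (hd.mono_right ?_), .ext' (hQ' g hcl)⟩
      rw [gn_nu]; exact Finset.erase_subset _ _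
    · rintro P' g hd rfl
      exact ⟨_, .parL (g.localize hcl) hd, .ext' hcQ⟩
    · rintro a b P' Q' rfl g g2 rfl
      have hca : c ≠ a := by rintro rfl; exact hcQ g2.out_subj_mem
      have hcb : c ≠ b := by rintro rfl; exact hcQ g2.obj_mem
      have hcn : c ∉ (Act.inp a b).names := by simp [Act.names, hca, hcb]
      exact ⟨_, .commR (g.localize hcn) g2, .ext' (hQ' g2 hcn)⟩
    · rintro a b P' Q' rfl g g2 rfl
      have hca : c ≠ a := by rintro rfl; exact hcQ g2.inp_subj_mem
      by_cases hcb : c = b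
      · subst hcb
        exact ⟨_, .closeL (g.nu_extrude_self (Ne.symm hca)) g2 hcQ, .refl _⟩
      · have hcn : c ∉ (Act.inp a b).names := by simp [Act.names, hca, hcb]
        exact ⟨_, .commL (g.localize hcn) g2, .ext' (hQ' g2 hcn)⟩
    · rintro a b P' Q' rfl g g2 hF _ _ rfl
      simp only [Finset.mem_union, Finset.mem_singleton, not_or] at hF
      have hca : c ≠ a := by rintro rfl; exact hcQ g2.bout_subj_mem
      have hcn : c ∉ (Act.inp a b).names := by simp [Act.names, hca, Ne.symm hF.2]
      exact ⟨_, .closeR (g.localize hcn) g2 (hnu _ hF.1.1),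
        (SC.swap _ _ _).trans (.nu _ (.ext' (hQ' g2 hcn)))⟩
    · rintro a b P' Q' rfl g g2 hF _ _ rfl
      simp only [Finset.mem_union, Finset.mem_singleton, not_or] at hF
      have hca : c ≠ a := by rintro rfl; exact hcQ g2.inp_subj_mem
      have hcn : c ∉ (Act.inp a b).names := by simp [Act.names, hca, Ne.symm hF.2]
      exact ⟨_, .closeL (g.localize hcn) g2 hF.1.2,
        (SC.swap _ _ _).trans (.nu _ (.ext' (hQ' g2 hcn)))⟩
  · simp only [Term.gn, Finset.mem_union, not_or] at hd
    refine h.par_cases ∅ ?_ ?_ ?_ ?_ ?_ ?_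
    · rintro Q' g _ rfl
      exact absurd g.obj_mem hcQ
    · rintro P' g _ rfl
      refine ⟨_, .parL (g.nu_extrude hac hd.1) (by simpa [Act.bn] using hd.2), ?_⟩
      change SC (.par _ (Q.ren _)) _
      rw [Term.ren_swap_eq_self hcQ hd.2]
      exact .refl _
    all_goals intro _ _ _ _ h; cases h

/-- The local name in the law of scope extrusion can be renamed on both sides. -/
theorem ext_alpha {P Q : Proc} {c d : Name} (hc : c ∉ Q.gn) (hdP : d ∉ P.gn) (hdQ : d ∉ Q.gn) :
    Term.par (nu c P) Q = .par (nu d (P.ren (Equiv.swap c d))) Q ∧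
      nu c (.par P Q) = nu d (.par (P.ren (Equiv.swap c d)) Q) := by
  refine ⟨by rw [← nu_alpha (fun h => hdP (Finset.mem_of_mem_erase h))], ?_⟩
  have hd : d ∉ (Term.par P Q).gn.erase c := fun h => by
    have := Finset.mem_of_mem_erase h
    simp only [Term.gn, Finset.mem_union] at this
    tauto
  rw [nu_alpha hd]
  change nu d (.par (P.ren _) (Q.ren _)) = _
  rw [Term.ren_swap_eq_self hc hdQ]

theorem strongSim_ext {P Q : Proc} {c : Name} (hc : c ∉ Q.gn) :
    StrongSim (.par (nu c P) Q) (nu c (.par P Q)) := by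
  intro l X hs
  obtain ⟨d, hd⟩ := exists_fresh (P.gn ∪ Q.gn ∪ l.names)
  simp only [Finset.mem_union, not_or] at hd
  obtain ⟨e1, e2⟩ := ext_alpha (P := P) hc hd.1.1 hd.1.2
  rw [e1] at hs
  rw [e2]
  exact ext_sim hd.1.2 hd.2 hs

theorem strongSim_ext' {P Q : Proc} {c : Name} (hc : c ∉ Q.gn) :
    StrongSim (nu c (.par P Q)) (.par (nu c P) Q) := by
  intro l X hs
  obtain ⟨d, hd⟩ := exists_fresh (P.gn ∪ Q.gn ∪ l.names)
  simp only [Finset.mem_union, not_or] at hd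
  obtain ⟨e1, e2⟩ := ext_alpha (P := P) hc hd.1.1 hd.1.2
  rw [e2] at hs
  rw [e1]
  exact ext_sim' hd.1.2 hd.2 hs

theorem swap_sim {P X : Proc} {l : Act} {c d : Name} (hcd : c ≠ d) (hc : c ∉ l.names)
    (hd : d ∉ l.names) (hs : Step (nu c (nu d P)) l X) :
    ∃ Y, Step (nu d (nu c P)) l Y ∧ SC X Y := by
  rcases hs.nu_cases hc with ⟨Z, h, rfl⟩ | ⟨a, b, Z, rfl, hb, hac, h, rfl⟩
  · rcases h.nu_cases hd with ⟨P', g, rfl⟩ | ⟨a, b, P', rfl, hb, had, g, rfl⟩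
    · exact ⟨_, (g.localize hc).localize hd, .swap _ _ _⟩
    · simp only [Act.names, Finset.mem_insert, Finset.mem_singleton, not_or] at hc
      have g' := (g.localize (c := c) (by simp [Act.names, hc, hcd])).nu_extrude had (d := b)
        (by rw [gn_nu]; exact fun h => hb (Finset.mem_of_mem_erase h))
      rw [nu_ren, Equiv.swap_apply_of_ne_of_ne hcd hc.2] at g'
      exact ⟨_, g', .refl _⟩
  · simp only [Act.names, Finset.mem_insert, Finset.mem_singleton, not_or] at hd
    rcases h.nu_cases (by simp [Act.names, hd, Ne.symm hcd]) with ⟨P', g, rfl⟩ | ⟨_, _, _, e, _⟩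
    · have hbP : b ∉ P.gn := fun h => hb (by
        rw [gn_nu]; exact Finset.mem_erase.2 ⟨Ne.symm hd.2, h⟩)
      have g' := (g.nu_extrude hac hbP).localize (c := d) (by simp [Act.names, hd])
      rw [nu_ren, Equiv.swap_apply_of_ne_of_ne (Ne.symm hcd) hd.2]
      exact ⟨_, g', .refl _⟩
    · cases e

theorem swap_alpha {P : Proc} {c d c' d' : Name} (hc' : c' ∉ P.gn) (hd' : d' ∉ P.gn)
    (h2 : d' ≠ c) (h3 : c' ≠ d') :
    nu c (nu d P) = nu c' (nu d' ((P.ren (Equiv.swap d d')).ren (Equiv.swap c c'))) := by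
  have e1 : nu d P = nu d' (P.ren (Equiv.swap d d')) :=
    nu_alpha fun h => hd' (Finset.mem_of_mem_erase h)
  rw [nu_alpha (c := c) (d := c'), e1, nu_ren, Equiv.swap_apply_of_ne_of_ne h2 (Ne.symm h3)]
  rw [gn_nu]
  exact fun h => hc' (Finset.mem_of_mem_erase (Finset.mem_of_mem_erase h))

theorem strongSim_swap (c d : Name) (P : Proc) : StrongSim (nu c (nu d P)) (nu d (nu c P)) := by
  intro l X hs
  by_cases hcd : c = d
  · subst hcd; exact ⟨X, hs, .refl _⟩
  obtain ⟨c', hc'⟩ := exists_fresh (P.gn ∪ l.names ∪ {c, d})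
  obtain ⟨d', hd'⟩ := exists_fresh (P.gn ∪ l.names ∪ {c, d, c'})
  simp only [Finset.mem_union, Finset.mem_insert, Finset.mem_singleton, not_or] at hc' hd'
  obtain ⟨⟨hcP, hcl⟩, hcc, hcd'⟩ := hc'
  obtain ⟨⟨hdP, hdl⟩, hdc, hdd, hdc'⟩ := hd'
  rw [swap_alpha hcP hdP hdc (Ne.symm hdc')] at hs
  rw [swap_alpha hdP hcP hcd' hdc']
  have e : (P.ren (Equiv.swap c c')).ren (Equiv.swap d d') =
      (P.ren (Equiv.swap d d')).ren (Equiv.swap c c') := by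
    rw [Term.ren_ren, Term.ren_ren]
    refine Term.ren_congr fun x hx => ?_
    have hx1 : x ≠ c' := by rintro rfl; exact hcP hx
    have hx2 : x ≠ d' := by rintro rfl; exact hdP hx
    simp only [Equiv.Perm.coe_mul, Function.comp_apply, Equiv.swap_apply_def]
    split_ifs <;> simp_all
  rw [e]
  exact swap_sim (Ne.symm hdc') hcl hdl hs

theorem strongSim_parL {P P' : Proc} (Q : Proc) (hP : SC P P') (h : StrongSim P P') :
    StrongSim (.par P Q) (.par P' Q) := by
  intro l X hs
  refine hs.par_cases ∅ ?_ ?_ ?_ ?_ ?_ ?_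
  · rintro Q' g hd rfl
    exact ⟨_, .parR g (hP.gn_eq ▸ hd), hP.parL _⟩
  · rintro P₁ g hd rfl
    obtain ⟨P₂, g', h'⟩ := h _ _ g
    exact ⟨_, .parL g' hd, h'.parL _⟩
  · rintro a b P₁ Q' rfl g g2 rfl
    obtain ⟨P₂, g', h'⟩ := h _ _ g
    exact ⟨_, .commR g' g2, h'.parL _⟩
  · rintro a b P₁ Q' rfl g g2 rfl
    obtain ⟨P₂, g', h'⟩ := h _ _ g
    exact ⟨_, .commL g' g2, h'.parL _⟩
  · rintro a c P₁ Q' rfl g g2 _ hc _ rfl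
    obtain ⟨P₂, g', h'⟩ := h _ _ g
    exact ⟨_, .closeR g' g2 (hP.gn_eq ▸ hc), .nu _ (h'.parL _)⟩
  · rintro a c P₁ Q' rfl g g2 _ _ hc rfl
    obtain ⟨P₂, g', h'⟩ := h _ _ g
    exact ⟨_, .closeL g' g2 hc, .nu _ (h'.parL _)⟩

theorem strongSim_nu {A B : Proc} (c : Name) (hAB : SC A B) (h : StrongSim A B) :
    StrongSim (nu c A) (nu c B) := by
  intro l X hs
  obtain ⟨d, hdf⟩ := exists_fresh (A.gn ∪ B.gn ∪ l.names)
  simp only [Finset.mem_union, not_or] at hdf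
  obtain ⟨⟨hdA, hdB⟩, hdl⟩ := hdf
  rw [nu_alpha (c := c) (d := d) (fun h => hdA (Finset.mem_of_mem_erase h))] at hs
  rw [nu_alpha (c := c) (d := d) (fun h => hdB (Finset.mem_of_mem_erase h))]
  replace h := h.ren (Equiv.swap c d)
  replace hAB := (hAB.ren (Equiv.swap c d)).gn_eq
  rcases hs.nu_cases hdl with ⟨A', g, rfl⟩ | ⟨a, b, A', rfl, hbA, had, g, rfl⟩
  · obtain ⟨B', g', h'⟩ := h _ _ g
    exact ⟨_, g'.localize hdl, .nu d h'⟩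
  · obtain ⟨B', g', h'⟩ := h _ _ g
    exact ⟨_, g'.nu_extrude had (hAB ▸ hbA), h'.ren _⟩

theorem SC.strongSim {A B : Proc} (h : SC A B) : StrongSim A B := by
  induction h with
  | refl P => exact fun l X hs => ⟨X, hs, .refl X⟩
  | trans _ _ ih1 ih2 =>
    intro l X hs
    obtain ⟨Y, h1, h2⟩ := ih1 l X hs
    obtain ⟨Z, h3, h4⟩ := ih2 l Y h1
    exact ⟨Z, h3, h2.trans h4⟩
  | comm P Q => exact strongSim_comm P Q
  | assoc P Q S => exact strongSim_assoc P Q S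
  | par_nil P => exact strongSim_par_nil P
  | par_nil' P => exact fun l X hs => ⟨_, .parL hs (by simp [Term.gn]), .par_nil' X⟩
  | ext h => exact strongSim_ext h
  | ext' h => exact strongSim_ext' h
  | swap c d P => exact strongSim_swap c d P
  | parL Q h ih => exact strongSim_parL Q h ih
  | nu c h ih => exact strongSim_nu c h ih

/-- Structural congruence is a strong bisimulation, hence a pi-bisimulation. -/
theorem SC.absEq {A B : Proc} (h : SC A B) : AbsEq A B := by
  refine PiBisimilar.absEq ⟨SC, IsPiBisimulation.of_symm SC.symm ?_ ?_, h⟩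
  · intro P Q h l P' hs _
    obtain ⟨Q', h1, h2⟩ := h.strongSim _ _ hs
    exact .inr ⟨Q, Q', .refl, h, h1, h2⟩
  · rintro P Q h s rfl hs
    obtain ⟨Q', h1, h2⟩ := h.strongSim _ _ (hs 0)
    exact ⟨1, Q', le_rfl, .single h1, h2⟩

/-! ### Signals -/

/-- The localization of a list of names; the head of the list is the innermost one. -/
def nus : List Name → Proc → Proc
  | [], P => P
  | c :: cs, P => nus cs (nu c P)

theorem gn_nus (cs : List Name) (P : Proc) : (nus cs P).gn = P.gn \ cs.toFinset := by
  induction cs generalizing P with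
  | nil => simp [nus]
  | cons c cs ih => ext x; simp [nus, ih]; tauto

theorem Tau.nus_cases {cs : List Name} {P X : Proc} (h : Tau (nus cs P) X) :
    ∃ P', Tau P P' ∧ X = nus cs P' := by
  induction cs generalizing P with
  | nil => exact ⟨X, h, rfl⟩
  | cons c cs ih =>
    obtain ⟨Y, h1, rfl⟩ := ih h
    obtain ⟨P', h2, rfl⟩ := h1.nu_cases
    exact ⟨P', h2, rfl⟩

theorem Tau.nus (cs : List Name) {P P' : Proc} (h : Tau P P') :
    Tau (nus cs P) (PiCalc.nus cs P') := by
  induction cs generalizing P P' with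
  | nil => exact h
  | cons c cs ih => exact ih (h.localize c)

theorem Taus.nus (cs : List Name) {P P' : Proc} (h : Taus P P') :
    Taus (nus cs P) (PiCalc.nus cs P') :=
  Relation.ReflTransGen.lift (PiCalc.nus cs) (fun _ _ h => Tau.nus cs h) _ _ h

theorem AbsEq.nus (cs : List Name) {P P' : Proc} (h : AbsEq P P') :
    AbsEq (nus cs P) (PiCalc.nus cs P') := by
  induction cs generalizing P P' with
  | nil => exact h
  | cons c cs ih => exact ih (h.nu c)

theorem SC.nus (cs : List Name) {P P' : Proc} (h : SC P P') :
    SC (PiCalc.nus cs P) (PiCalc.nus cs P') := by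
  induction cs generalizing P P' with
  | nil => exact h
  | cons c cs ih => exact ih (h.nu c)

theorem SC.nus_par (cs : List Name) {P C : Proc} (h : ∀ c ∈ cs, c ∉ C.gn) :
    SC (.par (PiCalc.nus cs P) C) (PiCalc.nus cs (.par P C)) := by
  induction cs generalizing P with
  | nil => exact .refl _
  | cons c cs ih =>
    exact (ih fun d hd => h d (List.mem_cons_of_mem _ hd)).trans
      (SC.nus cs (.ext (h c List.mem_cons_self)))

/-- The persistent signal on the channel `g`. -/
def sig {n : ℕ} (g : Name) : Term n := .repOut (.free g) (.free g) .nil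

/-- `X` is absolutely equal to a process that does not know `g`. -/
def Silent (g : Name) (X : Proc) : Prop := ∃ X₀, AbsEq X X₀ ∧ g ∉ X₀.gn

/-- The signal on `g` is active in `X`. -/
inductive Loud (g : Name) : Proc → Prop
  | sig : Loud g (sig g)
  | parL {S : Proc} (T : Proc) : Loud g S → Loud g (.par S T)
  | parR (S : Proc) {T : Proc} : Loud g T → Loud g (.par S T)
  | nu {X : Proc} {c : Name} : c ≠ g → Loud g X → Loud g (nu c X)
  | mat {X : Proc} (a : Name) : Loud g X → Loud g (.mat (.free a) (.free a) X)
  | mis {X : Proc} {a b : Name} : a ≠ b → Loud g X → Loud g (.mis (.free a) (.free b) X)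

theorem Loud.ren {g : Name} {X : Proc} (h : Loud g X) (σ : Equiv.Perm Name) :
    Loud (σ g) (X.ren σ) := by
  induction h with
  | sig => exact .sig
  | parL T _ ih => exact .parL _ ih
  | parR S _ ih => exact .parR _ ih
  | nu hc _ ih => rw [nu_ren]; exact .nu (by simpa using hc) ih
  | mat a _ ih => exact .mat _ ih
  | mis hab _ ih => exact .mis (by simpa using hab) ih

theorem Loud.mem_gn {g : Name} {X : Proc} (h : Loud g X) : g ∈ X.gn := by
  induction h with
  | sig => simp [PiCalc.sig, Term.gn, Nm.gn]
  | parL T _ ih => simp [Term.gn, ih]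
  | parR S _ ih => simp [Term.gn, ih]
  | nu hc _ ih => simp [ih, Ne.symm hc]
  | mat a _ ih => simp [Term.gn, ih]
  | mis hab _ ih => simp [Term.gn, ih]

/-- An active signal stays active, and its channel is not the bound name of an action. -/
theorem Loud.step {g : Name} {X X' : Proc} {l : Act} (h : Loud g X) (hs : Step X l X') :
    g ∉ l.bn ∧ Loud g X' := by
  induction h generalizing l X' with
  | sig => cases hs; exact ⟨by simp [Act.bn], .parR _ .sig⟩
  | @parL S T h ih =>
    refine hs.par_cases {g} ?_ ?_ ?_ ?_ ?_ ?_
    · rintro T' _ hd rfl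
      exact ⟨fun h' => Finset.disjoint_left.1 hd h' h.mem_gn, .parL _ h⟩
    · rintro S' g' _ rfl; exact ⟨(ih g').1, .parL _ (ih g').2⟩
    · rintro a b S' T' rfl g1 _ rfl; exact ⟨by simp [Act.bn], .parL _ (ih g1).2⟩
    · rintro a b S' T' rfl g1 _ rfl; exact ⟨by simp [Act.bn], .parL _ (ih g1).2⟩
    · rintro a b S' T' rfl g1 _ hF _ _ rfl
      exact ⟨by simp [Act.bn], .nu (by simpa using hF) (.parL _ (ih g1).2)⟩
    · rintro a b S' T' rfl g1 _ hF _ _ rfl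
      exact ⟨by simp [Act.bn], .nu (by simpa using hF) (.parL _ (ih g1).2)⟩
  | @parR S T h ih =>
    refine hs.par_cases {g} ?_ ?_ ?_ ?_ ?_ ?_
    · rintro T' g' _ rfl; exact ⟨(ih g').1, .parR _ (ih g').2⟩
    · rintro S' _ hd rfl
      exact ⟨fun h' => Finset.disjoint_left.1 hd h' h.mem_gn, .parR _ h⟩
    · rintro a b S' T' rfl _ g1 rfl; exact ⟨by simp [Act.bn], .parR _ (ih g1).2⟩
    · rintro a b S' T' rfl _ g1 rfl; exact ⟨by simp [Act.bn], .parR _ (ih g1).2⟩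
    · rintro a b S' T' rfl _ g1 hF _ _ rfl
      exact ⟨by simp [Act.bn], .nu (by simpa using hF) (.parR _ (ih g1).2)⟩
    · rintro a b S' T' rfl _ g1 hF _ _ rfl
      exact ⟨by simp [Act.bn], .nu (by simpa using hF) (.parR _ (ih g1).2)⟩
  | @nu X c hc h ih =>
    obtain ⟨d, hd⟩ := exists_fresh (X.gn ∪ l.names ∪ {g})
    simp only [Finset.mem_union, Finset.mem_singleton, not_or] at hd
    obtain ⟨⟨hdX, hdl⟩, hdg⟩ := hd
    have hσg : Equiv.swap c d g = g := Equiv.swap_apply_of_ne_of_ne (Ne.symm hc) (Ne.symm hdg)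
    rw [nu_alpha (d := d) (fun h => hdX (Finset.mem_of_mem_erase h))] at hs
    have back : ∀ {l Y}, Step (X.ren (Equiv.swap c d)) l Y → Loud g Y ∧ g ∉ l.bn := by
      intro l Y hs
      have h' := hs.ren (Equiv.swap c d)
      rw [Term.ren_swap_swap] at h'
      have h2 := (ih h').2.ren (Equiv.swap c d)
      rw [hσg, Term.ren_swap_swap] at h2
      refine ⟨h2, fun hg => (ih h').1 ?_⟩
      rw [Act.bn_ren]
      exact Finset.mem_image.2 ⟨g, hg, hσg⟩
    rcases hs.nu_cases hdl with ⟨X', g', rfl⟩ | ⟨a, b, X', rfl, hb, _, g', rfl⟩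
    · exact ⟨(back g').2, .nu hdg (back g').1⟩
    · have hg := h.ren (Equiv.swap c d)
      rw [hσg] at hg
      have hbg : g ≠ b := by rintro rfl; exact hb hg.mem_gn
      have h2 := (back g').1.ren (Equiv.swap d b)
      rw [Equiv.swap_apply_of_ne_of_ne (Ne.symm hdg) hbg] at h2
      exact ⟨by simpa [Act.bn] using hbg, h2⟩
  | mat a _ ih => cases hs; exact ih ‹_›
  | mis _ _ ih => cases hs; exact ih ‹_›

theorem Loud.taus {g : Name} {X X' : Proc} (h : Loud g X) (hs : Taus X X') : Loud g X' := by
  induction hs with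
  | refl => exact h
  | tail _ hs ih => exact (ih.step hs).2

theorem Loud.exists_step {g : Name} {X : Proc} (h : Loud g X) : ∃ X', Step X (.out g g) X' := by
  induction h with
  | sig => exact ⟨_, .repOut g g .nil⟩
  | parL T _ ih => obtain ⟨X', h⟩ := ih; exact ⟨_, .parL h (by simp [Act.bn])⟩
  | parR S _ ih => obtain ⟨X', h⟩ := ih; exact ⟨_, .parR h (by simp [Act.bn])⟩
  | nu hc _ ih => obtain ⟨X', h⟩ := ih; exact ⟨_, h.localize (by simp [Act.names, hc])⟩
  | mat a _ ih => obtain ⟨X', h⟩ := ih; exact ⟨X', .mat a h⟩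
  | mis hab _ ih => obtain ⟨X', h⟩ := ih; exact ⟨X', .mis _ _ hab h⟩

theorem Loud.nus {g : Name} {X : Proc} {cs : List Name} (hg : g ∉ cs) (h : Loud g X) :
    Loud g (PiCalc.nus cs X) := by
  induction cs generalizing X with
  | nil => exact h
  | cons c cs ih =>
    simp only [List.mem_cons, not_or] at hg
    exact ih hg.2 (.nu (Ne.symm hg.1) h)

theorem Silent.of_notMem {g : Name} {X : Proc} (h : g ∉ X.gn) : Silent g X := ⟨X, .refl X, h⟩

theorem Silent.congr {g : Name} {X Y : Proc} (h : Silent g X) (hXY : AbsEq X Y) : Silent g Y := by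
  obtain ⟨X₀, h1, h2⟩ := h
  exact ⟨X₀, hXY.symm.trans h1, h2⟩

theorem Silent.par {g : Name} {X Y : Proc} (h : Silent g X) (h' : Silent g Y) :
    Silent g (.par X Y) := by
  obtain ⟨X₀, h1, h2⟩ := h
  obtain ⟨Y₀, h3, h4⟩ := h'
  exact ⟨_, h1.par h3, by simp [Term.gn, h2, h4]⟩

theorem Silent.nus {g : Name} {X : Proc} (cs : List Name) (h : Silent g X) :
    Silent g (PiCalc.nus cs X) := by
  obtain ⟨X₀, h1, h2⟩ := h
  exact ⟨_, h1.nus cs, by simp [gn_nus, h2]⟩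

theorem Silent.taus {g : Name} {X X' : Proc} (h : Silent g X) (hs : Taus X X') :
    Silent g X' := by
  obtain ⟨X₀, h1, h2⟩ := h
  obtain ⟨Y, h3, h4⟩ := absEq_isAbsolute.bisimulation.taus h1 hs
  exact ⟨Y, h4, fun h => h2 (h3.gn_subset h)⟩

theorem Observable.gn_nonempty {P : Proc} (h : Observable P) : P.gn.Nonempty := by
  obtain ⟨P₁, P', l, hl, h1, h2⟩ := h
  have : l.subj.Nonempty := by cases l <;> simp_all [Act.subj]
  exact (this.mono h2.subj_subset).mono h1.gn_subset

/-- The absolute equality respects signals: after localization of all other names, an active signal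
is the only source of observability. -/
theorem Silent.not_loud {g : Name} {X Y : Proc} (hX : Silent g X) (hXY : AbsEq X Y) :
    ¬ Loud g Y := by
  intro hY
  obtain ⟨X₀, h1, h2⟩ := hX
  have h := h1.symm.trans hXY
  have h3 := h.nus ((X₀.gn ∪ Y.gn).erase g).toList
  have hg : g ∉ ((X₀.gn ∪ Y.gn).erase g).toList := by simp
  obtain ⟨Y', h4⟩ := (hY.nus hg).exists_step
  have h5 := (absEq_isAbsolute.equipollent _ _ h3).2 ⟨_, Y', _, by simp, .refl, h4⟩
  have h6 := h5.gn_nonempty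
  rw [gn_nus, Finset.toList_toFinset] at h6
  obtain ⟨x, hx⟩ := h6
  simp only [Finset.mem_sdiff, Finset.mem_erase, Finset.mem_union, not_and, not_or] at hx
  have : x ≠ g := by rintro rfl; exact h2 hx.1
  exact (hx.2 this).1 hx.1

/-- `X` either does not know the signal on `g`, or the signal is active. -/
def Decided (g : Name) (X : Proc) : Prop := Silent g X ∨ Loud g X

/-- Up to absolute equality, some context without `g` can activate the signal on `g` in `X`, and some
context can destroy it. -/
def Undecided (g : Name) (X : Proc) : Prop :=
  (∃ C Z X', g ∉ C.gn ∧ AbsEq (.par X C) Z ∧ Taus Z X' ∧ Loud g X') ∧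
  (∃ C Z X', AbsEq (.par X C) Z ∧ Taus Z X' ∧ Silent g X')

/-- A silent process stays silent in contexts without `g`, and a loud process stays loud in all
contexts; neither can be true of an undecided process. -/
theorem Undecided.not_decided {g : Name} {X Y : Proc} (h : Undecided g X) (hXY : AbsEq X Y) :
    ¬ Decided g Y := by
  obtain ⟨⟨C, Z, X', hC, h1, h2, h3⟩, C', Z', X'', h4, h5, h6⟩ := h
  rintro (hY | hY)
  · have hY' : Silent g Z := (hY.par (.of_notMem hC)).congr ((hXY.symm.par (.refl C)).trans h1)
    exact (hY'.taus h2).not_loud (.refl _) h3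
  · obtain ⟨W, h7, h8⟩ := absEq_isAbsolute.bisimulation.taus
      (h4.symm.trans (hXY.par (.refl C'))) h5
    exact h6.not_loud h8 ((Loud.parL C' hY).taus h7)

theorem Decided.taus {g : Name} {X X' : Proc} (h : Decided g X) (hs : Taus X X') :
    Decided g X' := h.imp (fun h => h.taus hs) (fun h => h.taus hs)

theorem Decided.parR {g : Name} {P T : Proc} (h : Decided g T) (hP : g ∉ P.gn) :
    Decided g (.par P T) := h.imp (fun h => (Silent.of_notMem hP).par h) (fun h => .parR P h)

theorem Decided.parL {g : Name} {P T : Proc} (h : Decided g T) (hP : g ∉ P.gn) :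
    Decided g (.par T P) := h.imp (fun h => h.par (.of_notMem hP)) (fun h => .parL P h)

theorem Decided.nus {g : Name} {cs : List Name} {T : Proc} (h : Decided g T) (hg : g ∉ cs) :
    Decided g (nus cs T) := h.imp (fun h => h.nus cs) (fun h => h.nus hg)

/-! ### Environments -/

/-- The process `P` in an environment `T`, with which it shares the local names `cs`. -/
def cfg (cs : List Name) (P T : Proc) : Proc := nus cs (.par P T)

theorem AbsEq.cfg (cs : List Name) (P : Proc) {T T' : Proc} (h : AbsEq T T') :
    AbsEq (cfg cs P T) (PiCalc.cfg cs P T') := ((AbsEq.refl P).par h).nus cs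

theorem Decided.cfg {g : Name} {cs : List Name} {P T : Proc} (h : Decided g T) (hg : g ∉ cs)
    (hP : g ∉ P.gn) : Decided g (cfg cs P T) := (h.parR hP).nus hg

/-- A context that does not know the shared names can be moved into the environment. -/
theorem SC.cfg_par {cs : List Name} (P T : Proc) {C : Proc} (h : ∀ c ∈ cs, c ∉ C.gn) :
    SC (.par (cfg cs P T) C) (cfg cs P (.par T C)) :=
  (SC.nus_par cs h).trans (SC.nus cs (.assoc P T C))

/-- The signal on `g` in the environment `T` is undecided: contexts with names from `H` can activate
it, without knowing `g`, and destroy it. -/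
def Trig (H : Finset Name) (g : Name) (T : Proc) : Prop :=
  (∃ C Z T', C.gn ⊆ H ∧ g ∉ C.gn ∧ AbsEq (.par T C) Z ∧ Taus Z T' ∧ Loud g T') ∧
  (∃ C Z T', C.gn ⊆ H ∧ AbsEq (.par T C) Z ∧ Taus Z T' ∧ Silent g T')

theorem Trig.undecided {H : Finset Name} {g : Name} {T : Proc} (h : Trig H g T) {cs : List Name}
    {P : Proc} (hcs : ∀ c ∈ cs, c ∉ H) (hg : g ∉ cs) (hP : g ∉ P.gn) :
    Undecided g (cfg cs P T) := by
  obtain ⟨⟨C, Z, T', hC, hgC, h1, h2, h3⟩, C', Z', T'', hC', h4, h5, h6⟩ := h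
  refine ⟨⟨C, cfg cs P Z, cfg cs P T', hgC, ?_, (h2.parR P).nus cs, (h3.parR P).nus hg⟩,
    C', cfg cs P Z', cfg cs P T'', ?_, (h5.parR P).nus cs, ((Silent.of_notMem hP).par h6).nus cs⟩
  · exact (SC.cfg_par P T fun c hc h => hcs c hc (hC h)).absEq.trans (h1.cfg cs P)
  · exact (SC.cfg_par P T fun c hc h => hcs c hc (hC' h)).absEq.trans (h4.cfg cs P)

theorem Trig.par {H H' : Finset Name} {g : Name} {T : Proc} (h : Trig H g T) (hH : H ⊆ H')
    {D : Proc} (hD : g ∉ D.gn) : Trig H' g (.par T D) := by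
  have key : ∀ C, SC (.par (.par T D) C) (.par (.par T C) D) := fun C =>
    (SC.assoc _ _ _).trans ((SC.parR T (.comm D C)).trans (SC.assoc' _ _ _))
  obtain ⟨⟨C, Z, T', hC, hgC, h1, h2, h3⟩, C', Z', T'', hC', h4, h5, h6⟩ := h
  refine ⟨⟨C, .par Z D, .par T' D, hC.trans hH, hgC, ?_, h2.parL D, .parL D h3⟩,
    C', .par Z' D, .par T'' D, hC'.trans hH, ?_, h5.parL D, h6.par (.of_notMem hD)⟩
  · exact (key C).absEq.trans (h1.par (.refl D))
  · exact (key C').absEq.trans (h4.par (.refl D))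

/-- Environments of processes that do not know the names in `H` and `G`. Any interaction of such an
environment with the process, and any internal action of it, decides an undecided signal from `G`.
For every local name in `cs` the environment has a channel in `H` on which the name, and nothing
else, can be fetched as often as needed. -/
structure Env (cs : List Name) (H G : Finset Name) (T : Proc) : Prop where
  notMem_H : ∀ c ∈ cs, c ∉ H
  notMem_G : ∀ c ∈ cs, c ∉ G
  disj : Disjoint H G
  no_bout : ∀ {a c T'}, ¬ Step T (.bout a c) T'
  decide : ∀ {l T'}, Step T l T' → (∀ x ∈ l.subj, x ∉ H ∪ G) →
    (∀ a b, l = .inp a b → b ∉ H ∪ G) → ∃ g ∈ G, g ∉ l.names ∧ Decided g T' ∧ Trig H g T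
  serve : ∀ c ∈ cs, ∃ e ∈ H, (∃ T', Step T (.out e c) T') ∧
    ∀ c' T', Step T (.out e c') T' → c' = c ∧ AbsEq T' T

theorem Env.undecided {cs : List Name} {H G : Finset Name} {T : Proc} (hT : Env cs H G T)
    {P : Proc} (hP : Disjoint P.gn (H ∪ G)) {g : Name} (hg : g ∈ G) (h : Trig H g T) :
    Undecided g (cfg cs P T) :=
  h.undecided hT.notMem_H (fun h' => hT.notMem_G g h' hg)
    (fun h' => Finset.disjoint_left.1 hP h' (by simp [hg]))

theorem Env.nil : Env [] ∅ ∅ .nil where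
  notMem_H := by simp
  notMem_G := by simp
  disj := by simp
  no_bout := not_step_nil
  decide h := (not_step_nil h).elim
  serve := by simp

/-- The name under which a local name is extruded to a partner can be chosen freely. -/
theorem Step.close_rename {Q E Q' E' : Proc} {a c d : Name} (h1 : Step Q (.bout a c) Q')
    (h2 : Step E (.inp a c) E') (hcE : c ∉ E.gn) (hdQ : d ∉ Q.gn) (hdE : d ∉ E.gn) :
    ∃ Q₁ E₁, Step Q (.bout a d) Q₁ ∧ Step E (.inp a d) E₁ ∧
      nu c (.par Q' E') = nu d (.par Q₁ E₁) := by
  have had : a ≠ d := by rintro rfl; exact hdE h2.inp_subj_mem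
  by_cases hcd : d = c
  · subst hcd; exact ⟨Q', E', h1, h2, rfl⟩
  have h2' := h2.ren (Equiv.swap c d)
  rw [Term.ren_swap_eq_self hcE hdE, Act.ren, Equiv.swap_apply_left,
    Equiv.swap_apply_of_ne_of_ne h1.bout_ne had] at h2'
  refine ⟨_, _, h1.bout_swap hdQ, h2', nu_alpha fun h => ?_⟩
  have h := Finset.mem_of_mem_erase h
  simp only [Term.gn, Finset.mem_union] at h
  rcases h with h | h
  · have := h1.gn_subset h
    simp [Act.names, hdQ, Ne.symm had, hcd] at this
  · have := h2.gn_subset h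
    simp [Act.names, hdE, Ne.symm had, hcd] at this

/-! ### Internal actions in an environment -/

/-- An internal action of a process in an environment is one of the process, or decides a signal. -/
theorem Env.cfg_step {cs : List Name} {H G : Finset Name} {T Q X : Proc} (hT : Env cs H G T)
    (hQ : Disjoint Q.gn (H ∪ G)) (hs : Tau (cfg cs Q T) X) :
    (∃ Q', Tau Q Q' ∧ X = cfg cs Q' T) ∨ ∃ g ∈ G, Decided g X ∧ Trig H g T := by
  obtain ⟨Y, hs', rfl⟩ := hs.nus_cases
  have hq : ∀ {x}, x ∈ Q.gn → x ∉ H ∪ G := fun h => Finset.disjoint_left.1 hQ h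
  have hG : ∀ {g}, g ∈ G → g ∉ cs := fun hg h => hT.notMem_G _ h hg
  have hfin : ∀ {l Q'} {g : Name}, Step Q l Q' → g ∉ l.names → g ∈ G → g ∉ Q'.gn :=
    fun h hl hg h' => by
      rcases Finset.mem_union.1 (h.gn_subset h') with h' | h'
      · exact hq h' (by simp [hg])
      · exact hl h'
  refine Step.par_cases hs' (H ∪ G) ?_ ?_ ?_ ?_ ?_ ?_
  · rintro T' h _ rfl
    obtain ⟨g, hg, _, hd, ht⟩ := hT.decide h (by simp [Act.subj]) (by simp)
    exact .inr ⟨g, hg, hd.cfg (hG hg) (fun h => hq h (by simp [hg])), ht⟩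
  · rintro Q' h _ rfl
    exact .inl ⟨Q', h, rfl⟩
  · rintro a b Q' T' - h1 h2 rfl
    obtain ⟨g, hg, hgl, hd, ht⟩ := hT.decide h2
      (by simpa [Act.subj] using hq h1.inp_subj_mem) (by simp)
    exact .inr ⟨g, hg, hd.cfg (hG hg) (hfin h1 hgl hg), ht⟩
  · rintro a b Q' T' - h1 h2 rfl
    obtain ⟨g, hg, hgl, hd, ht⟩ := hT.decide h2
      (by simpa [Act.subj] using hq h1.out_subj_mem) (by
        rintro _ _ h; cases h; exact hq h1.obj_mem)
    exact .inr ⟨g, hg, hd.cfg (hG hg) (hfin h1 hgl hg), ht⟩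
  · rintro a c Q' T' - _ h2
    exact (hT.no_bout h2).elim
  · rintro a c Q' T' - h1 h2 hF _ _ rfl
    obtain ⟨g, hg, hgl, hd, ht⟩ := hT.decide h2
      (by simpa [Act.subj] using hq h1.bout_subj_mem) (by
        rintro _ _ h; cases h; exact hF)
    have hgc : c ≠ g := by rintro rfl; exact hF (by simp [hg])
    refine .inr ⟨g, hg, Decided.nus (cs := c :: cs) (hd.parR (hfin h1 hgl hg)) ?_, ht⟩
    simp [Ne.symm hgc, hG hg]

theorem Taus.disjoint {Q Q' : Proc} {s : Finset Name} (h : Taus Q Q') (hQ : Disjoint Q.gn s) :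
    Disjoint Q'.gn s := hQ.mono_left h.gn_subset

/-- As long as no signal of the environment has been decided, only the process has moved. -/
theorem Env.cfg_taus {cs : List Name} {H G : Finset Name} {T Q Y A : Proc} (hT : Env cs H G T)
    (hQ : Disjoint Q.gn (H ∪ G)) (hA : ∀ g ∈ G, Trig H g T → Undecided g A) (hAY : AbsEq A Y)
    (hs : Taus (cfg cs Q T) Y) : ∃ Q', Taus Q Q' ∧ Y = cfg cs Q' T := by
  generalize hX : cfg cs Q T = X at hs
  induction hs using Relation.ReflTransGen.head_induction_on generalizing Q with
  | refl => exact ⟨Q, .refl, hX.symm⟩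
  | head h1 h2 ih =>
    subst hX
    rcases hT.cfg_step hQ h1 with ⟨Q₁, h3, h4⟩ | ⟨g, hg, hd, ht⟩
    · obtain ⟨Q', h5, h6⟩ := ih (Taus.disjoint (.single h3) hQ) h4.symm
      exact ⟨Q', .head h3 h5, h6⟩
    · exact ((hA g hg ht).not_decided hAY (hd.taus h2)).elim

/-- The version of `Env.cfg_taus` for at least one internal action. -/
theorem Env.cfg_tausPlus {cs : List Name} {H G : Finset Name} {T Q Y A : Proc}
    (hT : Env cs H G T) (hQ : Disjoint Q.gn (H ∪ G))
    (hA : ∀ g ∈ G, Trig H g T → Undecided g A) (hAY : AbsEq A Y)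
    (hs : TausPlus (cfg cs Q T) Y) : ∃ Q', TausPlus Q Q' ∧ Y = cfg cs Q' T := by
  obtain ⟨X, h1, h2⟩ := Relation.TransGen.head'_iff.1 hs
  rcases hT.cfg_step hQ h1 with ⟨Q₁, h3, rfl⟩ | ⟨g, hg, hd, ht⟩
  · obtain ⟨Q', h5, h6⟩ := hT.cfg_taus (Taus.disjoint (.single h3) hQ) hA hAY h2
    exact ⟨Q', Relation.TransGen.head' h3 h5, h6⟩
  · exact ((hA g hg ht).not_decided hAY (hd.taus h2)).elim

/-- A move of `P` in its environment that changes the behaviour is answered by `Q` in the same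
environment by an actual move, up to which only `Q` has moved. -/
theorem Env.answer {cs : List Name} {H G : Finset Name} {T P Q A' : Proc} (hT : Env cs H G T)
    (hP : Disjoint P.gn (H ∪ G)) (hQ : Disjoint Q.gn (H ∪ G))
    (h : AbsEq (cfg cs P T) (cfg cs Q T)) (hs : Tau (cfg cs P T) A')
    (hne : ¬ AbsEq (cfg cs P T) A') :
    ∃ Q₂ X, Taus Q Q₂ ∧ AbsEq (cfg cs P T) (cfg cs Q₂ T) ∧ Tau (cfg cs Q₂ T) X ∧ AbsEq A' X := by
  rcases absEq_isAbsolute.bisimulation.left h hs with ⟨Y, h1, h2, h3⟩ | ⟨Y, X, h1, h2, h3, h4⟩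
  · exact (hne (h2.trans h3.symm)).elim
  · obtain ⟨Q₂, h5, rfl⟩ := hT.cfg_taus hQ (fun g hg ht => hT.undecided hP hg ht) h2 h1
    exact ⟨Q₂, X, h5, h2, h3, h4⟩

/-- The internal actions of a process in an environment with a gadget `D` that decide none of the
signals of `T`: an action of the process, of the gadget, or an interaction of the gadget with the
environment or the process. A name that is extruded to the gadget can be taken to be `d`. -/
theorem Env.gadget_cases {cs : List Name} {H G : Finset Name} {T Q D X A' : Proc}
    (hT : Env cs H G T) (hQ : Disjoint Q.gn (H ∪ G)) (hDG : Disjoint D.gn G)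
    (hD : ∀ {a c D'}, ¬ Step D (.bout a c) D')
    (hA : ∀ g ∈ G, Trig H g T → Undecided g A') (hAX : AbsEq A' X)
    (hs : Tau (cfg cs Q (.par T D)) X) {d : Name} (hdH : d ∉ H ∪ G) (hdQ : d ∉ Q.gn)
    (hdT : d ∉ T.gn) (hdD : d ∉ D.gn) {C : Prop}
    (stage : ∀ Q', Tau Q Q' → X = cfg cs Q' (.par T D) → C)
    (gadget : ∀ D', Tau D D' → X = cfg cs Q (.par T D') → C)
    (fetch : ∀ a b T' D', Step T (.out a b) T' → Step D (.inp a b) D' →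
      X = cfg cs Q (.par T' D') → C)
    (send : ∀ a b T' D', Step T (.inp a b) T' → Step D (.out a b) D' →
      X = cfg cs Q (.par T' D') → C)
    (inp : ∀ a b Q' D', Step Q (.inp a b) Q' → Step D (.out a b) D' →
      X = cfg cs Q' (.par T D') → C)
    (out : ∀ a b Q' D', Step Q (.out a b) Q' → Step D (.inp a b) D' →
      X = cfg cs Q' (.par T D') → C)
    (bout : ∀ a Q' D', Step Q (.bout a d) Q' → Step D (.inp a d) D' →
      X = cfg (d :: cs) Q' (.par T D') → C) : C := by
  obtain ⟨Y, hs', rfl⟩ := hs.nus_cases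
  have hq : ∀ {x}, x ∈ Q.gn → x ∉ H ∪ G := fun h => Finset.disjoint_left.1 hQ h
  have hG : ∀ {g}, g ∈ G → g ∉ cs := fun hg h => hT.notMem_G _ h hg
  have hfin : ∀ {l Q'} {g : Name}, Step Q l Q' → g ∉ l.names → g ∈ G → g ∉ Q'.gn :=
    fun h hl hg h' => by
      rcases Finset.mem_union.1 (h.gn_subset h') with h' | h'
      · exact hq h' (by simp [hg])
      · exact hl h'
  have hDg : ∀ {g}, g ∈ G → g ∉ D.gn := fun hg h => Finset.disjoint_left.1 hDG h hg
  have contra : ∀ g ∈ G, Trig H g T → Decided g (nus cs Y) → C := fun g hg ht hd =>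
    ((hA g hg ht).not_decided hAX hd).elim
  refine Step.par_cases hs' (H ∪ G) ?_ ?_ ?_ ?_ ?_ ?_
  · rintro E h _ rfl
    refine h.par_cases ∅ ?_ ?_ ?_ ?_ ?_ ?_
    · rintro D' k _ rfl; exact gadget D' k rfl
    · rintro T' k _ rfl
      obtain ⟨g, hg, _, hd, ht⟩ := hT.decide k (by simp [Act.subj]) (by simp)
      exact contra g hg ht ((hd.parL (hDg hg)).cfg (hG hg) (fun h => hq h (by simp [hg])))
    · rintro a b T' D' - h1 h2 rfl; exact send a b T' D' h1 h2 rfl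
    · rintro a b T' D' - h1 h2 rfl; exact fetch a b T' D' h1 h2 rfl
    · rintro a c T' D' - _ h2; exact (hD h2).elim
    · rintro a c T' D' - h1; exact (hT.no_bout h1).elim
  · rintro Q' h _ rfl; exact stage Q' h rfl
  · rintro a b Q' E - h1 h rfl
    refine h.par_cases ∅ ?_ ?_ ?_ ?_ ?_ ?_
    · rintro D' k _ rfl; exact inp a b Q' D' h1 k rfl
    · rintro T' k _ rfl
      obtain ⟨g, hg, hgl, hd, ht⟩ := hT.decide k
        (by simpa [Act.subj] using hq h1.inp_subj_mem) (by simp)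
      exact contra g hg ht ((hd.parL (hDg hg)).cfg (hG hg) (hfin h1 hgl hg))
    all_goals intro _ _ _ _ h; cases h
  · rintro a b Q' E - h1 h rfl
    refine h.par_cases ∅ ?_ ?_ ?_ ?_ ?_ ?_
    · rintro D' k _ rfl; exact out a b Q' D' h1 k rfl
    · rintro T' k _ rfl
      obtain ⟨g, hg, hgl, hd, ht⟩ := hT.decide k
        (by simpa [Act.subj] using hq h1.out_subj_mem) (by
          rintro _ _ h; cases h; exact hq h1.obj_mem)
      exact contra g hg ht ((hd.parL (hDg hg)).cfg (hG hg) (hfin h1 hgl hg))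
    all_goals intro _ _ _ _ h; cases h
  · rintro a c Q' E - _ h
    refine h.par_cases ∅ ?_ ?_ ?_ ?_ ?_ ?_
    · rintro D' h; exact (hD h).elim
    · rintro T' h; exact (hT.no_bout h).elim
    all_goals intro _ _ _ _ h; cases h
  · rintro a c Q' E - h1 h _ _ hc hY
    obtain ⟨Q₁, E₁, h1, h, e⟩ := h1.close_rename h hc hdQ (by simp [Term.gn, hdT, hdD])
    rw [e] at hY
    subst hY
    refine h.par_cases ∅ ?_ ?_ ?_ ?_ ?_ ?_
    · rintro D' k _ rfl; exact bout a Q₁ D' h1 k rfl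
    · rintro T' k _ rfl
      obtain ⟨g, hg, hgl, hd, ht⟩ := hT.decide k
        (by simpa [Act.subj] using hq h1.bout_subj_mem) (by
          rintro _ _ h; cases h; exact hdH)
      have hgd : g ≠ d := by rintro rfl; exact hdH (by simp [hg])
      exact contra g hg ht (Decided.nus (cs := d :: cs)
        ((hd.parL (hDg hg)).parR (hfin h1 hgl hg)) (by simp [hgd, hG hg]))
    all_goals intro _ _ _ _ h; cases h

/-- Adding a gadget `D` with a fresh signal `g` and fresh channels `L` to an environment. Every
action of the gadget must use a channel in `L`, where the process cannot interact, or decide the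
signal. Inputs of `g` itself are exempt: nobody knows `g`. -/
theorem Env.add {cs : List Name} {H G : Finset Name} {T : Proc} (hT : Env cs H G T) {D : Proc}
    {L : Finset Name} {g : Name} (hgH : g ∉ H) (hgL : g ∉ L) (hgcs : g ∉ cs) (hgT : g ∉ T.gn)
    (hLT : Disjoint L T.gn) (hLG : Disjoint L G) (hLcs : ∀ c ∈ cs, c ∉ L)
    (hDG : Disjoint D.gn G) (hDb : ∀ {a c D'}, ¬ Step D (.bout a c) D')
    (hDH : ∀ {a b D'}, Step D (.out a b) D' → a ∉ H)
    (hD : ∀ {l D'}, Step D l D' → (∀ a b, l = .inp a b → b ≠ g) → (∃ e ∈ L, e ∈ l.subj) ∨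
      (g ∉ l.names ∧ Decided g D' ∧ Trig (H ∪ L) g (.par T D))) :
    Env cs (H ∪ L) (insert g G) (.par T D) where
  notMem_H c hc h := (Finset.mem_union.1 h).elim (hT.notMem_H c hc) (hLcs c hc)
  notMem_G c hc h := (Finset.mem_insert.1 h).elim (by rintro rfl; exact hgcs hc) (hT.notMem_G c hc)
  disj := by
    rw [Finset.disjoint_insert_right, Finset.disjoint_union_left]
    exact ⟨by simp [hgH, hgL], hT.disj, hLG⟩
  no_bout h := by
    refine h.par_cases ∅ ?_ ?_ ?_ ?_ ?_ ?_
    · rintro D' h; exact (hDb h).elim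
    · rintro T' h; exact (hT.no_bout h).elim
    all_goals intro _ _ _ _ h; cases h
  decide {l X} h hl hi := by
    have hl' : ∀ x ∈ l.subj, x ∉ H ∪ G := fun x hx h => hl x hx (by
      simp only [Finset.mem_union, Finset.mem_insert] at h ⊢; tauto)
    have hLl : ¬ ∃ e ∈ L, e ∈ l.subj := by
      rintro ⟨e, he, hx⟩
      exact hl e hx (by simp [he])
    have hDg : ∀ {g}, g ∈ G → g ∉ D.gn := fun hg h => Finset.disjoint_left.1 hDG h hg
    refine h.par_cases ∅ ?_ ?_ ?_ ?_ ?_ ?_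
    · rintro D' k _ rfl
      rcases hD k (by rintro a b rfl rfl; exact hi _ _ rfl (by simp)) with h' | ⟨h1, h2, h3⟩
      · exact (hLl h').elim
      · exact ⟨g, by simp, h1, h2.parR hgT, h3⟩
    · rintro T' k _ rfl
      obtain ⟨g', hg, hgl, hd, ht⟩ := hT.decide k hl' (fun a b e h => hi a b e (by
        simp only [Finset.mem_union, Finset.mem_insert] at h ⊢; tauto))
      exact ⟨g', by simp [hg], hgl, hd.parL (hDg hg), ht.par Finset.subset_union_left (hDg hg)⟩
    · rintro a b T' D' rfl h1 h2 rfl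
      rcases hD h2 (by simp) with ⟨e, he, h'⟩ | ⟨h3, h4, h5⟩
      · obtain rfl := Finset.mem_singleton.1 h'
        exact (Finset.disjoint_left.1 hLT he h1.inp_subj_mem).elim
      · refine ⟨g, by simp, by simp [Act.names], h4.parR fun h => ?_, h5⟩
        exact (Finset.mem_union.1 (h1.gn_subset h)).elim hgT h3
    · rintro a b T' D' rfl h1 h2 rfl
      rcases hD h2 (by rintro _ _ e rfl; cases e; exact hgT h1.obj_mem) with
        ⟨e, he, h'⟩ | ⟨h3, h4, h5⟩
      · obtain rfl := Finset.mem_singleton.1 h'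
        exact (Finset.disjoint_left.1 hLT he h1.out_subj_mem).elim
      · refine ⟨g, by simp, by simp [Act.names], h4.parR fun h => ?_, h5⟩
        exact (Finset.mem_union.1 (h1.gn_subset h)).elim hgT h3
    · rintro a c T' D' - _ h2; exact (hDb h2).elim
    · rintro a c T' D' - h1; exact (hT.no_bout h1).elim
  serve c hc := by
    obtain ⟨e, he, ⟨T', h1⟩, h2⟩ := hT.serve c hc
    refine ⟨e, by simp [he], ⟨_, .parL h1 (by simp [Act.bn])⟩, fun c' X h => ?_⟩
    refine h.par_cases ∅ ?_ ?_ ?_ ?_ ?_ ?_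
    · rintro D' h; exact (hDH h he).elim
    · rintro T'' k _ rfl
      exact ⟨(h2 c' T'' k).1, (h2 c' T'' k).2.par (.refl D)⟩
    all_goals intro _ _ _ _ h; cases h

/-- Sharing one more local name with an environment that serves it. -/
theorem Env.cons {cs : List Name} {H G : Finset Name} {T : Proc} (hT : Env cs H G T) {c e : Name}
    (hcH : c ∉ H) (hcG : c ∉ G) (he : e ∈ H) (hc : ∃ T', Step T (.out e c) T')
    (hc' : ∀ c' T', Step T (.out e c') T' → c' = c ∧ AbsEq T' T) : Env (c :: cs) H G T where
  notMem_H := by simpa [hcH] using hT.notMem_H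
  notMem_G := by simpa [hcG] using hT.notMem_G
  disj := hT.disj
  no_bout := hT.no_bout
  decide := hT.decide
  serve d hd := by
    rcases List.mem_cons.1 hd with rfl | hd
    · exact ⟨e, he, hc, hc'⟩
    · exact hT.serve d hd

/-! ### Testers -/

/-- Receive a name `x` along `a` and either continue as `M` or activate the signal on `g`. -/
def recvTest (a : Name) (M : Term 1) (g : Name) : Proc := .inp (.free a) 1 ![M, sig g]

/-- Send `b` along `a` and either stop or activate the signal on `g`. -/
def sendTest (a b g : Name) : Proc := .out (.free a) 1 (fun _ => .free b) ![.nil, sig g]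

theorem Step.inp_cases {m : Nm 0} {k : ℕ} {M : Fin (k + 1) → Term 1} {l : Act} {X : Proc}
    (h : Step (.inp m k M) l X) : ∃ a b i, m = .free a ∧ l = .inp a b ∧ X = (M i).inst b := by
  cases h; exact ⟨_, _, _, rfl, rfl, rfl⟩

theorem Step.out_cases {m : Nm 0} {k : ℕ} {o : Fin (k + 1) → Nm 0} {M : Fin (k + 1) → Proc}
    {l : Act} {X : Proc} (h : Step (.out m k o M) l X) :
    ∃ a b i, m = .free a ∧ o i = .free b ∧ l = .out a b ∧ X = M i := by
  generalize hP : Term.out m k o M = P at h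
  cases h <;> cases hP
  exact ⟨_, _, _, rfl, rfl, rfl, rfl⟩

@[simp] theorem sig_inst (g b : Name) : (sig g : Term 1).inst b = sig g := by
  simp [sig, Term.inst, Term.map, instNm]

theorem recvTest_cases {a g : Name} {M : Term 1} {l : Act} {X : Proc}
    (h : Step (recvTest a M g) l X) : ∃ b, l = .inp a b ∧ (X = M.inst b ∨ X = sig g) := by
  obtain ⟨a', b, i, e, rfl, rfl⟩ := h.inp_cases
  cases e
  refine ⟨b, rfl, ?_⟩
  fin_cases i
  · exact .inl rfl
  · exact .inr (sig_inst g b)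

theorem recvTest_fst (a g : Name) (M : Term 1) (b : Name) :
    Step (recvTest a M g) (.inp a b) (M.inst b) := Step.inp a b 1 ![M, sig g] 0

theorem recvTest_snd (a g : Name) (M : Term 1) (b : Name) :
    Step (recvTest a M g) (.inp a b) (sig g) := by
  have := Step.inp a b 1 ![M, sig g] 1
  rwa [show (![M, sig g] : Fin 2 → Term 1) 1 = sig g from rfl, sig_inst] at this

theorem sendTest_cases {a b g : Name} {l : Act} {X : Proc}
    (h : Step (sendTest a b g) l X) : l = .out a b ∧ (X = .nil ∨ X = sig g) := by
  obtain ⟨a', b', i, e, e', rfl, rfl⟩ := h.out_cases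
  cases e; cases e'
  refine ⟨rfl, ?_⟩
  fin_cases i
  · exact .inl rfl
  · exact .inr rfl

theorem sendTest_fst (a b g : Name) : Step (sendTest a b g) (.out a b) .nil :=
  Step.out a 1 (fun _ => b) ![.nil, sig g] 0

theorem sendTest_snd (a b g : Name) : Step (sendTest a b g) (.out a b) (sig g) :=
  Step.out a 1 (fun _ => b) ![.nil, sig g] 1

theorem gn_recvTest (a g : Name) (M : Term 1) : (recvTest a M g).gn = {a, g} ∪ M.gn := by
  ext x; simp [recvTest, sig, Term.gn, Nm.gn, Fin.exists_fin_two]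
  tauto

theorem gn_sendTest (a b g : Name) : (sendTest a b g).gn = {a, b, g} := by
  ext x; simp [sendTest, sig, Term.gn, Nm.gn, Fin.exists_fin_two]

/-! ### Gadgets that know shared local names -/

/-- Any two processes without actions are bisimilar. -/
theorem absEq_nil_of_stuck {A : Proc} (h : ∀ l X, ¬ Step A l X) : AbsEq A .nil := by
  refine PiBisimilar.absEq ⟨fun P Q => (∀ l X, ¬ Step P l X) ∧ ∀ l X, ¬ Step Q l X, ?_, h,
    fun _ _ => not_step_nil⟩
  exact ⟨⟨fun h s hs h' => (h.2 _ _ (hs ▸ h' 0)).elim, fun h s hs h' => (h.1 _ _ (hs ▸ h' 0)).elim⟩,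
    ⟨fun h h' => (h.1 _ _ h').elim, fun h h' => (h.2 _ _ h').elim⟩,
    fun _ _ h h' => (h.1 _ _ h').elim, fun _ _ h h' => (h.2 _ _ h').elim⟩

theorem Undecided.congr {g : Name} {X Y : Proc} (h : Undecided g X) (hXY : AbsEq X Y) :
    Undecided g Y := by
  obtain ⟨⟨C, Z, X', hC, h1, h2, h3⟩, C', Z', X'', h4, h5, h6⟩ := h
  exact ⟨⟨C, Z, X', hC, (hXY.symm.par (.refl C)).trans h1, h2, h3⟩,
    C', Z', X'', (hXY.symm.par (.refl C')).trans h4, h5, h6⟩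

theorem Decided.sig (g : Name) : Decided g (sig g) := .inr .sig

/-- Adding a receiver along a channel that serves a local name `c`. -/
theorem Env.add_recvTest {cs : List Name} {H G : Finset Name} {T : Proc} (hT : Env cs H G T)
    {e c g : Name} {M : Term 1} {T₁ : Proc} (he : e ∈ H) (h1 : Step T (.out e c) T₁)
    (hgH : g ∉ H) (hgcs : g ∉ cs) (hgT : g ∉ T.gn) (hgM : g ∉ M.gn) (hM : Disjoint M.gn G)
    (hgG : g ∉ G) :
    Trig (H ∪ ∅) g (.par T (recvTest e M g)) ∧
    Env cs (H ∪ ∅) (insert g G) (.par T (recvTest e M g)) := by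
  have heg : g ≠ e := by rintro rfl; exact hgH he
  have hinst : ∀ b, b ≠ g → g ∉ (M.inst b).gn := fun b hb h => by
    have := Term.gn_inst_subset _ _ h
    simp only [Finset.mem_insert] at this
    exact this.elim (fun h => hb h.symm) hgM
  have hT₁ : g ∉ T₁.gn := fun h => by
    rcases Finset.mem_union.1 (h1.gn_subset h) with h | h
    · exact hgT h
    · simp only [Act.names, Finset.mem_insert, Finset.mem_singleton] at h
      exact h.elim heg (by rintro rfl; exact hgT h1.obj_mem)
  have hc : c ≠ g := by rintro rfl; exact hgT h1.obj_mem
  have ht : Trig (H ∪ ∅) g (.par T (recvTest e M g)) := by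
    refine ⟨⟨.nil, _, _, by simp [Term.gn], by simp [Term.gn], (SC.par_nil _).absEq,
      .single (.commL h1 (recvTest_snd e g M c)), .parR _ .sig⟩,
      .nil, _, _, by simp [Term.gn], (SC.par_nil _).absEq,
      .single (.commL h1 (recvTest_fst e g M c)), .of_notMem ?_⟩
    simp [Term.gn, hT₁, hinst c hc]
  refine ⟨ht, hT.add hgH (by simp) hgcs hgT (by simp) (by simp) (by simp) ?_ ?_ ?_ ?_⟩
  · rw [gn_recvTest, Finset.disjoint_union_left]
    refine ⟨?_, hM⟩
    simp [hgG, Finset.disjoint_left.1 hT.disj he]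
  · intro a c D' h
    obtain ⟨b, h, _⟩ := recvTest_cases h
    cases h
  · intro a b D' h
    obtain ⟨b, h, _⟩ := recvTest_cases h
    cases h
  · intro l D' h hb
    obtain ⟨b, rfl, rfl | rfl⟩ := recvTest_cases h
    · have hb := hb _ _ rfl
      exact .inr ⟨by simp [Act.names, heg, hb.symm], .inl (.of_notMem (hinst b hb)), ht⟩
    · have hb := hb _ _ rfl
      exact .inr ⟨by simp [Act.names, heg, hb.symm], .sig g, ht⟩

/-- A gadget can be added to the environments of equal configurations, even if it knows local names:
each of them is fetched from the environment, by a receiver that is installed first. -/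
theorem Env.install {cs : List Name} {H G : Finset Name} {T P Q : Proc} (hT : Env cs H G T)
    (hP : Disjoint P.gn (H ∪ G)) (hQ : Disjoint Q.gn (H ∪ G))
    (h : AbsEq (cfg cs P T) (cfg cs Q T)) (M : Proc) (hM : Disjoint M.gn G) :
    ∃ Q₁, Taus Q Q₁ ∧ AbsEq (cfg cs P (.par T M)) (cfg cs Q₁ (.par T M)) := by
  generalize hn : (M.gn ∩ cs.toFinset).card = n
  induction n generalizing M with
  | zero =>
    have hM : ∀ c ∈ cs, c ∉ M.gn := fun c hc h => by
      rw [Finset.card_eq_zero] at hn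
      exact Finset.notMem_empty c (hn ▸ by simp [hc, h])
    exact ⟨Q, .refl, (SC.cfg_par P T hM).absEq.symm.trans
      ((h.par (.refl M)).trans (SC.cfg_par Q T hM).absEq)⟩
  | succ n ih =>
    obtain ⟨c, hc⟩ := Finset.card_pos.1 (show 0 < (M.gn ∩ cs.toFinset).card by omega)
    simp only [Finset.mem_inter, List.mem_toFinset] at hc
    obtain ⟨hcM, hc⟩ := hc
    obtain ⟨e, he, ⟨T₁, h1⟩, h2⟩ := hT.serve c hc
    obtain ⟨g, hg⟩ := exists_fresh (H ∪ G ∪ P.gn ∪ Q.gn ∪ T.gn ∪ M.gn ∪ cs.toFinset)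
    simp only [Finset.mem_union, not_or, List.mem_toFinset] at hg
    obtain ⟨⟨⟨⟨⟨⟨hgH, hgG⟩, hgP⟩, hgQ⟩, hgT⟩, hgM⟩, hgcs⟩ := hg
    -- `N` is the gadget `M` with a parameter for `c`; the receiver of `c` no longer knows `c`, so
    -- that it can be installed by the induction hypothesis.
    set N := M.map (absNm c) with hN
    have hNgn : N.gn = M.gn.erase c := gn_map_absNm c M
    have hNc : N.inst c = M := absNm_inst c M
    have hgN : g ∉ N.gn := by simp [hNgn, hgM]
    have hNG : Disjoint N.gn G := hM.mono_left (hNgn ▸ Finset.erase_subset _ _)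
    have hOG : Disjoint (recvTest e N g).gn G := by
      rw [gn_recvTest, Finset.disjoint_union_left]
      refine ⟨?_, hNG⟩
      simp [hgG, Finset.disjoint_left.1 hT.disj he]
    obtain ⟨Q₁, h3, h4⟩ := ih (recvTest e N g) hOG (by
      have : (recvTest e N g).gn ∩ cs.toFinset = (M.gn ∩ cs.toFinset).erase c := by
        have hecs : e ∉ cs := fun h => hT.notMem_H e h he
        ext x
        simp only [gn_recvTest, hNgn, Finset.mem_inter, Finset.mem_union, Finset.mem_insert,
          Finset.mem_singleton, Finset.mem_erase, List.mem_toFinset]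
        constructor
        · rintro ⟨(rfl | rfl) | h, h'⟩
          · exact (hecs h').elim
          · exact (hgcs h').elim
          · exact ⟨h.1, h.2, h'⟩
        · rintro ⟨h, h', h''⟩; exact ⟨.inr ⟨h, h'⟩, h''⟩
      rw [this, Finset.card_erase_of_mem (by simp [hcM, hc]), hn]; rfl)
    obtain ⟨ht, hTO⟩ := hT.add_recvTest he h1 hgH hgcs hgT hgN hNG hgG
    have disj : ∀ {S : Proc}, Disjoint S.gn (H ∪ G) → g ∉ S.gn →
        Disjoint S.gn (H ∪ ∅ ∪ insert g G) := fun hS hg => by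
      rw [Finset.union_empty, Finset.union_insert, Finset.disjoint_insert_right]
      exact ⟨hg, hS⟩
    have hQ₁ := Taus.disjoint h3 hQ
    have hgQ₁ : g ∉ Q₁.gn := fun h => hgQ (h3.gn_subset h)
    -- The receiver fetches `c`, which destroys its signal. In the system of `Q` it must also fetch
    -- a name, and on `e` only `c` is offered.
    have hmove : Tau (cfg cs P (.par T (recvTest e N g))) (cfg cs P (.par T₁ M)) := by
      have := recvTest_fst e g N c
      rw [hNc] at this
      exact Tau.nus cs (Tau.parR P (.commL h1 this))
    have hA : AbsEq (cfg cs P (.par T M)) (cfg cs P (.par T₁ M)) :=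
      AbsEq.cfg cs P ((h2 c T₁ h1).2.symm.par (.refl M))
    have hsil : Silent g (cfg cs P (.par T M)) :=
      .of_notMem (by simp [cfg, gn_nus, Term.gn, hgP, hgT, hgM])
    obtain ⟨Q₂, X, h5, h6, h7, h8⟩ := hTO.answer (disj hP hgP) (disj hQ₁ hgQ₁) h4 hmove fun h =>
      (hTO.undecided (disj hP hgP) (by simp) ht).not_decided h (.inl (hsil.congr hA))
    have hQ₂ := Taus.disjoint h5 hQ₁
    have hgQ₂ : g ∉ Q₂.gn := fun h => hgQ₁ (h5.gn_subset h)
    have hAX := hA.trans h8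
    obtain ⟨d, hd⟩ := exists_fresh (H ∪ G ∪ Q₂.gn ∪ T.gn ∪ (recvTest e N g).gn)
    rw [Finset.mem_union, Finset.mem_union, Finset.mem_union, not_or, not_or, not_or] at hd
    have heQ : e ∉ Q₂.gn := fun h => Finset.disjoint_left.1 hQ₂ h (by simp [he])
    refine hT.gadget_cases hQ₂ hOG ?_ ?_ hAX h7 hd.1.1.1 hd.1.1.2 hd.1.2 hd.2 ?_ ?_ ?_ ?_ ?_ ?_ ?_
    · intro a c D' h
      obtain ⟨b, h, _⟩ := recvTest_cases h
      cases h
    · intro g' hg' ht'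
      have hg'M : g' ∉ M.gn := fun h => Finset.disjoint_left.1 hM h hg'
      refine (ht'.par subset_rfl hg'M).undecided hT.notMem_H (fun h => hT.notMem_G _ h hg') ?_
      exact fun h => Finset.disjoint_left.1 hP h (by simp [hg'])
    · rintro Q' h' rfl
      exact ((hTO.undecided (disj (Taus.disjoint (.single h') hQ₂)
        fun h => hgQ₂ (h'.gn_subset h)) (by simp) ht).not_decided hAX.symm (.inl hsil)).elim
    · intro D' h
      obtain ⟨b, h, _⟩ := recvTest_cases h
      cases h
    · rintro a b T' D' h9 h10 rfl
      obtain ⟨b', h, h11⟩ := recvTest_cases h10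
      cases h
      obtain ⟨rfl, h12⟩ := h2 _ _ h9
      rcases h11 with rfl | rfl
      · rw [hNc] at hAX
        exact ⟨Q₂, h3.trans h5, hAX.trans (AbsEq.cfg cs Q₂ (h12.par (.refl M)))⟩
      · exact (hsil.not_loud hAX (.nus hgcs (.parR _ (.parR _ .sig)))).elim
    · intro a b T' D' _ h
      obtain ⟨b, h, _⟩ := recvTest_cases h
      cases h
    · intro a b T' D' _ h
      obtain ⟨b, h, _⟩ := recvTest_cases h
      cases h
    · rintro a b T' D' h9 h10 -
      obtain ⟨b', h, h11⟩ := recvTest_cases h10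
      cases h
      exact (heQ h9.out_subj_mem).elim
    · rintro a T' D' h9 h10 -
      obtain ⟨b', h, h11⟩ := recvTest_cases h10
      cases h
      exact (heQ h9.bout_subj_mem).elim

/-! ### Probes -/

/-- A sender of `o` along `a` in parallel with a receiver along `a`. -/
def probeBody {n : ℕ} (a o : Name) : Term n :=
  .par (.out (.free a) 0 (fun _ => .free o) (fun _ => .nil)) (.inp (.free a) 0 (fun _ => .nil))

/-- The communication partners of a tester on the channel `a`, locked by an input on `h`. -/
def probe (a o h : Name) : Proc := .inp (.free h) 0 (fun _ => probeBody a o)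

theorem probe_cases {a o h : Name} {l : Act} {X : Proc} (hs : Step (probe a o h) l X) :
    ∃ b, l = .inp h b := by
  obtain ⟨a', b, i, e, rfl, rfl⟩ := hs.inp_cases
  cases e
  exact ⟨b, rfl⟩

theorem probe_step (a o h b : Name) : Step (probe a o h) (.inp h b) (probeBody a o) :=
  Step.inp h b 0 (fun _ => probeBody a o) 0

theorem gn_probe (a o h : Name) : (probe a o h).gn = {a, o, h} := by
  ext x
  simp [probe, probeBody, Term.gn, Nm.gn]
  tauto

/-- A tester on the channel `a` with the signal `g`: it can communicate once, and its signal can be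
activated as well as destroyed by sending `o` to it or by receiving from it. -/
structure Tester (a o g : Name) (O : Proc) : Prop where
  label : ∀ {l O'}, Step O l O' → ∃ b, l = .inp a b ∨ l = .out a b
  decided : ∀ {l O'}, Step O l O' → (∀ b, l = .inp a b → b ≠ g) → g ∉ l.names ∧ Decided g O'
  loud : ∃ W, Tau (.par O (probeBody a o)) W ∧ Loud g W
  silent : ∃ W, Tau (.par O (probeBody a o)) W ∧ Silent g W

/-- The only actions of a tester with its probe are those of the tester and the unlocking of the
probe. -/
theorem Tester.cases {a o g h : Name} {O X : Proc} {l : Act} (hO : Tester a o g O) (hah : a ≠ h)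
    (hs : Step (.par O (probe a o h)) l X) {C : Prop}
    (key : ∀ b, l = .inp h b → C)
    (test : ∀ O', Step O l O' → X = .par O' (probe a o h) → C) : C := by
  refine hs.par_cases ∅ ?_ ?_ ?_ ?_ ?_ ?_
  · rintro D' h _ -
    obtain ⟨b, rfl⟩ := probe_cases h
    exact key b rfl
  · rintro O' h _ e; exact test O' h e
  · rintro x b O' D' - _ h2
    obtain ⟨b, h⟩ := probe_cases h2
    cases h
  · rintro x b O' D' - h1 h2
    obtain ⟨b, h⟩ := probe_cases h2
    cases h
    obtain ⟨b, h | h⟩ := hO.label h1 <;> cases h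
    exact (hah rfl).elim
  · rintro x b O' D' - _ h2
    obtain ⟨b, h⟩ := probe_cases h2
    cases h
  · rintro x b O' D' - h1
    obtain ⟨b, h | h⟩ := hO.label h1 <;> cases h

/-- The signal of a tester is undecided: its probe can be unlocked along `h` and then interact with
the tester in both ways. -/
theorem Tester.trig {H : Finset Name} {T O : Proc} {a o g h : Name} (hO : Tester a o g O)
    (hgT : g ∉ T.gn) (hgh : g ≠ h) : Trig (H ∪ {h}) g (.par T (.par O (probe a o h))) := by
  set C : Proc := .out (.free h) 0 (fun _ => .free h) (fun _ => .nil) with hC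
  have hCgn : C.gn = {h} := by ext x; simp [hC, Term.gn, Nm.gn]
  have hCs : Step C (.out h h) .nil := Step.out h 0 (fun _ => h) (fun _ => .nil) 0
  have h1 : ∀ {W}, Tau (.par O (probeBody a o)) W →
      Taus (.par (.par T (.par O (probe a o h))) C) (.par (.par T W) .nil) := fun hW =>
    .head (.commR (.parR (.parR (probe_step a o h h) (by simp [Act.bn])) (by simp [Act.bn])) hCs)
      (.single (Tau.parL (Tau.parR T hW) _))
  obtain ⟨W, h2, h3⟩ := hO.loud
  obtain ⟨W', h4, h5⟩ := hO.silent
  exact ⟨⟨C, _, _, by simp [hCgn], by simpa [hCgn] using hgh, .refl _, h1 h2,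
      .parL _ (.parR _ h3)⟩,
    C, _, _, by simp [hCgn], .refl _, h1 h4,
      ((Silent.of_notMem hgT).par h5).par (.of_notMem (by simp [Term.gn]))⟩

/-- A tester together with its probe is a gadget in the sense of `Env.add`. -/
theorem Env.add_tester {cs : List Name} {H G : Finset Name} {T : Proc} (hT : Env cs H G T)
    {O : Proc} {a o g h : Name} (hO : Tester a o g O) (hg : g ∉ H ∪ G ∪ cs.toFinset ∪ T.gn)
    (hh : h ∉ H ∪ G ∪ cs.toFinset ∪ T.gn) (hgh : g ≠ h) (hah : a ≠ h) (hga : g ≠ a) (hgo : g ≠ o)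
    (hOG : Disjoint O.gn (H ∪ G)) (ha : a ∉ H ∪ G) (ho : o ∉ G) :
    Env cs (H ∪ {h}) (insert g G) (.par T (.par O (probe a o h))) := by
  simp only [Finset.mem_union, not_or, List.mem_toFinset] at hg hh ha
  refine hT.add hg.1.1.1 (by simpa using hgh) hg.1.2 hg.2 (by simpa using hh.2)
    (by simpa using hh.1.1.2) ?_ ?_ ?_ ?_ ?_
  · rintro c hc h
    rw [Finset.mem_singleton.1 h] at hc
    exact hh.1.2 hc
  · rw [Term.gn, Finset.disjoint_union_left, gn_probe]
    exact ⟨hOG.mono_right Finset.subset_union_right, by simp [ha, ho, hh]⟩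
  · intro x c D' h
    refine hO.cases hah h (by simp) fun O' h _ => ?_
    obtain ⟨b, h | h⟩ := hO.label h <;> cases h
  · intro x c D' h
    refine hO.cases hah h (by simp) fun O' h _ => ?_
    obtain ⟨b, h | h⟩ := hO.label h <;> cases h
    exact ha.1
  · intro l D' h hi
    refine hO.cases hah h ?_ ?_
    · rintro b rfl; exact .inl ⟨_, Finset.mem_singleton_self _, by simp [Act.subj]⟩
    · rintro O' k rfl
      obtain ⟨h1, h2⟩ := hO.decided k (fun b => hi a b)
      exact .inr ⟨h1, h2.parL (by simp [gn_probe, hga, hgo, hgh]), hO.trig hg.2 hgh⟩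

/-- `P` and `Q` are absolutely equal in some environment in the sense of `Env`. -/
def EnvEq (P Q : Proc) : Prop := ∃ cs H G T, Env cs H G T ∧ Disjoint P.gn (H ∪ G) ∧
  Disjoint Q.gn (H ∪ G) ∧ AbsEq (cfg cs P T) (cfg cs Q T)

/-- If an interaction of `P` with a tester destroys the signal of the tester, then `Q` answers by
an interaction of a successor with the tester, which does not activate the signal. -/
theorem Env.test {cs : List Name} {H G : Finset Name} {T P Q : Proc} (hT : Env cs H G T)
    (hP : Disjoint P.gn (H ∪ G)) (hQ : Disjoint Q.gn (H ∪ G))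
    (hPQ : AbsEq (cfg cs P T) (cfg cs Q T))
    {O : Proc} {a o g h : Name} (hO : Tester a o g O) (hg : g ∉ H ∪ G ∪ cs.toFinset ∪ T.gn)
    (hh : h ∉ H ∪ G ∪ cs.toFinset ∪ T.gn) (hgh : g ≠ h) (hah : a ≠ h) (hga : g ≠ a) (hgo : g ≠ o)
    (hOG : Disjoint O.gn (H ∪ G)) (ha : a ∉ H ∪ G) (ho : o ∉ G)
    (hgP : g ∉ P.gn) (hgQ : g ∉ Q.gn) (hhP : h ∉ P.gn) (hhQ : h ∉ Q.gn)
    {A' : Proc} (hA : Tau (cfg cs P (.par T (.par O (probe a o h)))) A') (hsil : Silent g A')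
    (hund : ∀ g ∈ G, Trig H g T → Undecided g A')
    {d : Name} (hd : d ∉ H ∪ G ∪ Q.gn ∪ T.gn ∪ O.gn ∪ {a, o, h})
    (hdg : d ≠ g) :
    ∃ Q₂ O' Q', Taus Q Q₂ ∧ EnvEq P Q₂ ∧ ¬ Loud g O' ∧
      ((∃ b, Step Q₂ (.inp a b) Q' ∧ Step O (.out a b) O' ∧
          AbsEq A' (cfg cs Q' (.par T (.par O' (probe a o h))))) ∨
       (∃ b, Step Q₂ (.out a b) Q' ∧ Step O (.inp a b) O' ∧
          AbsEq A' (cfg cs Q' (.par T (.par O' (probe a o h))))) ∨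
       (Step Q₂ (.bout a d) Q' ∧ Step O (.inp a d) O' ∧
          AbsEq A' (cfg (d :: cs) Q' (.par T (.par O' (probe a o h)))))) := by
  have hE := hT.add_tester hO hg hh hgh hah hga hgo hOG ha ho
  have ht : Trig (H ∪ {h}) g (.par T (.par O (probe a o h))) :=
    hO.trig (by simp only [Finset.mem_union, not_or] at hg; exact hg.2) hgh
  have hDG : Disjoint (Term.par O (probe a o h)).gn G := by
    simp only [Finset.mem_union, not_or] at hh ha
    rw [Term.gn, Finset.disjoint_union_left, gn_probe]
    exact ⟨hOG.mono_right Finset.subset_union_right, by simp [ha, ho, hh]⟩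
  obtain ⟨Q₁, h1, h2⟩ := hT.install hP hQ hPQ _ hDG
  have disj : ∀ {S : Proc}, Disjoint S.gn (H ∪ G) → g ∉ S.gn → h ∉ S.gn →
      Disjoint S.gn (H ∪ {h} ∪ insert g G) := fun {S} hS hg hh => by
    rw [show H ∪ {h} ∪ insert g G = insert h (insert g (H ∪ G)) by ext; simp; tauto,
      Finset.disjoint_insert_right, Finset.disjoint_insert_right]
    exact ⟨hh, hg, hS⟩
  have hQ₁ : Disjoint Q₁.gn (H ∪ G) := Taus.disjoint h1 hQ
  obtain ⟨Q₂, X, h3, h4, h5, h6⟩ := hE.answer (disj hP hgP hhP)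
    (disj hQ₁ (fun h => hgQ (h1.gn_subset h)) fun h => hhQ (h1.gn_subset h)) h2 hA
    fun h' => (hE.undecided (disj hP hgP hhP) (by simp) ht).not_decided h' (.inl hsil)
  have h7 : Taus Q Q₂ := h1.trans h3
  have hQ₂ : Disjoint Q₂.gn (H ∪ G) := Taus.disjoint h7 hQ
  have hq : ∀ {x}, x ∉ Q.gn → x ∉ Q₂.gn := fun hx h => hx (h7.gn_subset h)
  rw [Finset.mem_union, Finset.mem_union, Finset.mem_union, Finset.mem_union] at hd
  simp only [not_or] at hd
  obtain ⟨⟨⟨⟨hdH, hdQ⟩, hdT⟩, hdO⟩, hdp⟩ := hd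
  replace h4 : EnvEq P Q₂ :=
    ⟨cs, _, _, _, hE, disj hP hgP hhP, disj hQ₂ (hq hgQ) (hq hhQ), h4⟩
  have hgcs : g ∉ cs := fun h => hg (by simp [h])
  have hhT : h ∉ T.gn := fun h => hh (by simp [h])
  -- The answer cannot activate the new signal.
  have quiet : ∀ {O' S cs'}, g ∉ cs' → AbsEq A' (cfg cs' S (.par T (.par O' (probe a o h)))) →
      ¬ Loud g O' := fun hg' h' h'' =>
    hsil.not_loud h' (.nus hg' (.parR _ (.parR _ (.parL _ h''))))
  -- The tester cannot have interacted with the rest of the environment.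
  have inner : ∀ {l l' T' O'}, Step T l T' → a ∈ l.subj → (∀ x b, l = .inp x b → b ∉ H ∪ G) →
      Step O l' O' → l'.names = l.names →
      AbsEq A' (cfg cs Q₂ (.par T' (.par O' (probe a o h)))) → False := by
    intro l l' T' O' hs hal hi hs' hl hX
    have hx : ∀ x ∈ l.subj, x ∉ H ∪ G := fun x hx => by
      have : x = a := by cases l <;> simp_all [Act.subj]
      exact this ▸ ha
    obtain ⟨g', hg', hgl, hdec, htr⟩ := hT.decide hs hx hi
    refine (hund g' hg' htr).not_decided hX ?_
    refine (hdec.parL fun h' => ?_).cfg (fun h => hT.notMem_G _ h hg')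
      fun h => Finset.disjoint_left.1 hQ₂ h (by simp [hg'])
    rcases Finset.mem_union.1 h' with h' | h'
    · rcases Finset.mem_union.1 (hs'.gn_subset h') with h' | h'
      · exact Finset.disjoint_left.1 hOG h' (by simp [hg'])
      · exact hgl (hl ▸ h')
    · exact Finset.disjoint_left.1 hDG (Finset.mem_union_right _ h') hg'
  refine hT.gadget_cases hQ₂ hDG ?_ hund h6 h5 hdH (hq hdQ) hdT
    (by simp only [Term.gn, Finset.mem_union, not_or, gn_probe]; exact ⟨hdO, hdp⟩)
    ?_ ?_ ?_ ?_ ?_ ?_ ?_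
  · intro x c D' h
    refine hO.cases hah h (by simp) fun O' h _ => ?_
    obtain ⟨b, h | h⟩ := hO.label h <;> cases h
  · rintro Q' h' rfl
    exact ((hE.undecided (disj (Taus.disjoint (.single h') hQ₂)
      (fun h => hq hgQ (h'.gn_subset h)) fun h => hq hhQ (h'.gn_subset h))
      (by simp) ht).not_decided h6.symm (.inl hsil)).elim
  · intro D' h
    refine hO.cases hah h (by simp) fun O' h _ => ?_
    obtain ⟨b, h | h⟩ := hO.label h <;> cases h
  · rintro x b T' D' h8 h9 rfl
    refine hO.cases hah h9 ?_ ?_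
    · rintro b' e; cases e; exact (hhT h8.out_subj_mem).elim
    · rintro O' h10 rfl
      obtain ⟨b', e | e⟩ := hO.label h10 <;> cases e
      exact (inner h8 (by simp [Act.subj]) (by simp) h10 rfl h6).elim
  · rintro x b T' D' h8 h9 rfl
    refine hO.cases hah h9 (by simp) ?_
    rintro O' h10 rfl
    obtain ⟨b', e | e⟩ := hO.label h10 <;> cases e
    refine (inner h8 (by simp [Act.subj]) ?_ h10 rfl h6).elim
    rintro _ _ e; cases e
    exact Finset.disjoint_left.1 hOG h10.obj_mem
  · rintro x b Q' D' h8 h9 rfl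
    refine hO.cases hah h9 (by simp) ?_
    rintro O' h10 rfl
    obtain ⟨b', e | e⟩ := hO.label h10 <;> cases e
    exact ⟨Q₂, O', Q', h7, h4, quiet hgcs h6, .inl ⟨b, h8, h10, h6⟩⟩
  · rintro x b Q' D' h8 h9 rfl
    refine hO.cases hah h9 ?_ ?_
    · rintro b' e; cases e; exact (hq hhQ h8.out_subj_mem).elim
    · rintro O' h10 rfl
      obtain ⟨b', e | e⟩ := hO.label h10 <;> cases e
      exact ⟨Q₂, O', Q', h7, h4, quiet hgcs h6, .inr (.inl ⟨b, h8, h10, h6⟩)⟩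
  · rintro x Q' D' h8 h9 rfl
    refine hO.cases hah h9 ?_ ?_
    · rintro b' e; cases e; exact (hq hhQ h8.bout_subj_mem).elim
    · rintro O' h10 rfl
      obtain ⟨b', e | e⟩ := hO.label h10 <;> cases e
      exact ⟨Q₂, O', Q', h7, h4, quiet (by simp [Ne.symm hdg, hgcs]) h6,
        .inr (.inr ⟨h8, h10, h6⟩)⟩

/-! ### Bisimulation up to an environment -/

theorem EnvEq.symm {P Q : Proc} : EnvEq P Q → EnvEq Q P := by
  rintro ⟨cs, H, G, T, hT, hP, hQ, h⟩
  exact ⟨cs, H, G, T, hT, hQ, hP, h.symm⟩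

/-- Internal actions are answered by the process alone, as an action of the environment would decide
a signal that is undecided on the other side. -/
theorem EnvEq.tau {P Q P' : Proc} (h : EnvEq P Q) (hs : Tau P P') :
    (∃ Q', Taus Q Q' ∧ EnvEq P Q' ∧ EnvEq P' Q') ∨
    (∃ Q'' Q', Taus Q Q'' ∧ EnvEq P Q'' ∧ Tau Q'' Q' ∧ EnvEq P' Q') := by
  obtain ⟨cs, H, G, T, hT, hP, hQ, h⟩ := h
  have hP' := Taus.disjoint (.single hs) hP
  have hu : ∀ g ∈ G, Trig H g T → Undecided g (cfg cs P T) := fun g hg ht => hT.undecided hP hg ht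
  rcases absEq_isAbsolute.bisimulation.left h (Tau.nus cs (hs.parL T)) with
    ⟨Y, h1, h2, h3⟩ | ⟨Y, X, h1, h2, h3, h4⟩
  · obtain ⟨Q', h5, rfl⟩ := hT.cfg_taus hQ hu h2 h1
    have hQ' := Taus.disjoint h5 hQ
    exact .inl ⟨Q', h5, ⟨cs, H, G, T, hT, hP, hQ', h2⟩, cs, H, G, T, hT, hP', hQ', h3⟩
  · obtain ⟨Q₂, h5, rfl⟩ := hT.cfg_taus hQ hu h2 h1
    have hQ₂ := Taus.disjoint h5 hQ
    rcases hT.cfg_step hQ₂ h3 with ⟨Q', h6, rfl⟩ | ⟨g, hg, hd, ht⟩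
    · exact .inr ⟨Q₂, Q', h5, ⟨cs, H, G, T, hT, hP, hQ₂, h2⟩, h6, cs, H, G, T, hT, hP',
        Taus.disjoint (.single h6) hQ₂, h4⟩
    · exact ((hT.undecided hP' hg ht).not_decided h4 hd).elim

theorem EnvEq.codivAt {P Q : Proc} (h : EnvEq P Q) : CodivAt EnvEq P Q := by
  obtain ⟨cs, H, G, T, hT, hP, hQ, h⟩ := h
  intro s h0 hs
  obtain ⟨k, Y, hk, h1, h2⟩ := absEq_isAbsolute.codivergent.right h (fun i => cfg cs (s i) T)
    (by rw [h0]) fun i => Tau.nus cs (Tau.parL (hs i) T)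
  have hsk : Disjoint (s k).gn (H ∪ G) := by
    clear h1 h2 hk
    induction k with
    | zero => exact h0 ▸ hP
    | succ k ih => exact Taus.disjoint (.single (hs k)) ih
  obtain ⟨Q', h3, rfl⟩ := hT.cfg_tausPlus hQ (fun g hg ht => hT.undecided hsk hg ht) h2 h1
  exact ⟨k, Q', hk, h3, cs, H, G, T, hT, hsk, Taus.disjoint h3.to_reflTransGen hQ, h2⟩

/-- Adding a gadget that can only be used on fresh channels `L`. -/
theorem Env.add_locked {cs : List Name} {H G : Finset Name} {T : Proc} (hT : Env cs H G T)
    {D : Proc} {L : Finset Name} {g : Name} (hg : g ∉ H ∪ L ∪ cs.toFinset ∪ T.gn)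
    (hL : Disjoint L (H ∪ G ∪ cs.toFinset ∪ T.gn)) (hDG : Disjoint D.gn G)
    (hD : ∀ {l D'}, Step D l D' → ∃ e ∈ L, ∃ b, l = .inp e b ∨ l = .out e b) :
    Env cs (H ∪ L) (insert g G) (.par T D) := by
  simp only [Finset.mem_union, not_or, List.mem_toFinset] at hg
  simp only [Finset.disjoint_union_right] at hL
  refine hT.add hg.1.1.1 hg.1.1.2 hg.1.2 hg.2 hL.2 hL.1.1.2
    (fun c hc h => Finset.disjoint_left.1 hL.1.2 h (by simpa using hc)) hDG ?_ ?_ ?_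
  · intro a c D' h
    obtain ⟨e, _, b, h | h⟩ := hD h <;> cases h
  · intro a b D' h
    obtain ⟨e, he, b, h | h⟩ := hD h <;> cases h
    exact Finset.disjoint_left.1 hL.1.1.1 he
  · intro l D' h _
    obtain ⟨e, he, b, rfl | rfl⟩ := hD h
    · exact .inl ⟨e, he, by simp [Act.subj]⟩
    · exact .inl ⟨e, he, by simp [Act.subj]⟩

theorem probe_disjoint {G : Finset Name} {a o h : Name} {N : Proc} (hN : Disjoint N.gn G)
    (ha : a ∉ G) (ho : o ∉ G) (hh : h ∉ G) : Disjoint (Term.par N (probe a o h)).gn G := by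
  rw [Term.gn, Finset.disjoint_union_left, gn_probe]
  exact ⟨hN, by simp [ha, ho, hh]⟩

/-- A locked probe is an inactive gadget. -/
theorem Env.add_probe {cs : List Name} {H G : Finset Name} {T : Proc} (hT : Env cs H G T)
    {a o g h : Name} (hg : g ∉ H ∪ G ∪ cs.toFinset ∪ T.gn) (hh : h ∉ H ∪ G ∪ cs.toFinset ∪ T.gn)
    (hgh : g ≠ h) (ha : a ∉ G) (ho : o ∉ G) :
    Env cs (H ∪ {h}) (insert g G) (.par T (.par .nil (probe a o h))) := by
  simp only [Finset.mem_union, not_or] at hg hh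
  refine hT.add_locked (by simpa [hgh] using ⟨hg.1.1.1, by simpa using hg.1.2, hg.2⟩)
    (by simpa [and_assoc] using hh)
    (probe_disjoint (by simp [Term.gn]) ha ho hh.1.1.2) fun {l D'} hs => ?_
  refine hs.par_cases ∅ ?_ ?_ ?_ ?_ ?_ ?_
  · intro D' h' _ _
    obtain ⟨b, rfl⟩ := probe_cases h'
    exact ⟨h, by simp, b, .inl rfl⟩
  · intro D' h'; exact (not_step_nil h').elim
  all_goals intro _ _ _ _ _ h'; exact (not_step_nil h').elim

theorem probeBody_out (a o : Name) :
    Step (probeBody a o) (.out a o) (.par .nil (.inp (.free a) 0 (fun _ => .nil))) :=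
  .parL (Step.out a 0 (fun _ => o) (fun _ => .nil) 0) (by simp [Act.bn])

theorem probeBody_inp (a o b : Name) : Step (probeBody a o) (.inp a b)
    (.par (.out (.free a) 0 (fun _ => .free o) (fun _ => .nil)) .nil) :=
  .parR (Step.inp a b 0 (fun _ => .nil) 0) (by simp [Act.bn])

theorem tester_sendTest {a b g : Name} (hga : g ≠ a) (hgb : g ≠ b) :
    Tester a a g (sendTest a b g) where
  label h := by
    obtain ⟨rfl, _⟩ := sendTest_cases h
    exact ⟨b, .inr rfl⟩
  decided h _ := by
    obtain ⟨rfl, rfl | rfl⟩ := sendTest_cases h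
    · exact ⟨by simp [Act.names, hga, hgb], .inl (.of_notMem (by simp [Term.gn]))⟩
    · exact ⟨by simp [Act.names, hga, hgb], .sig g⟩
  loud := ⟨_, .commL (sendTest_snd a b g) (probeBody_inp a a b), .parL _ .sig⟩
  silent := ⟨_, .commL (sendTest_fst a b g) (probeBody_inp a a b), .of_notMem (by
    simp [Term.gn, Nm.gn, hga])⟩

theorem tester_recvTest {a o g : Name} {M : Term 1} (hga : g ≠ a)
    (hM : ∀ b, b ≠ g → Decided g (M.inst b)) (ho : Silent g (M.inst o)) :
    Tester a o g (recvTest a M g) where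
  label h := by
    obtain ⟨b, rfl, _⟩ := recvTest_cases h
    exact ⟨b, .inl rfl⟩
  decided h hb := by
    obtain ⟨b, rfl, rfl | rfl⟩ := recvTest_cases h
    · exact ⟨by simp [Act.names, hga, (hb b rfl).symm], hM b (hb b rfl)⟩
    · exact ⟨by simp [Act.names, hga, (hb b rfl).symm], .sig g⟩
  loud := ⟨_, .commR (recvTest_snd a g M o) (probeBody_out a o), .parL _ .sig⟩
  silent := ⟨_, .commR (recvTest_fst a g M o) (probeBody_out a o),
    ho.par (.of_notMem (by simp [Term.gn, Nm.gn, hga]))⟩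

/-- In an environment with an idle gadget the signals of `T` stay undecided. -/
theorem undecided_cfg_par {cs : List Name} {H G : Finset Name} {T P D : Proc}
    (hP : Disjoint P.gn G) (hD : Disjoint D.gn G) (hcs : ∀ c ∈ cs, c ∉ H ∪ G) :
    ∀ g ∈ G, Trig H g T → Undecided g (cfg cs P (.par T D)) := fun g hg ht =>
  (ht.par subset_rfl fun h => Finset.disjoint_left.1 hD h hg).undecided
    (fun c hc h => hcs c hc (by simp [h])) (fun h => hcs g h (by simp [hg]))
    fun h => Finset.disjoint_left.1 hP h hg

theorem Env.notMem {cs : List Name} {H G : Finset Name} {T : Proc} (hT : Env cs H G T) :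
    ∀ c ∈ cs, c ∉ H ∪ G := fun c hc h =>
  (Finset.mem_union.1 h).elim (hT.notMem_H c hc) (hT.notMem_G c hc)

/-- After an action that avoids the names of the environment, the residual still avoids the names of
the environment extended by `L` and `g`. -/
theorem Step.disjoint {P P' : Proc} {l : Act} {H G L : Finset Name} {g : Name} (h : Step P l P')
    (hP : Disjoint P.gn (H ∪ G)) (hl : Disjoint l.names (H ∪ G)) (hg : g ∉ P.gn ∪ l.names)
    (hL : Disjoint L (P.gn ∪ l.names)) : Disjoint P'.gn (H ∪ L ∪ insert g G) := by
  refine Disjoint.mono_left h.gn_subset ?_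
  have := Finset.disjoint_union_left.2 ⟨hP, hl⟩
  rw [Finset.disjoint_union_right] at this
  rw [Finset.disjoint_union_right, Finset.disjoint_union_right, Finset.disjoint_insert_right]
  exact ⟨⟨this.1, hL.symm⟩, hg, this.2⟩

/-- The input of `b` is tested by sending `b`. After the test only the locked probe remains. -/
theorem Env.sim_inp {cs : List Name} {H G : Finset Name} {T P Q P' : Proc} (hT : Env cs H G T)
    (hP : Disjoint P.gn (H ∪ G)) (hQ : Disjoint Q.gn (H ∪ G))
    (hPQ : AbsEq (cfg cs P T) (cfg cs Q T)) {a b : Name} (hs : Step P (.inp a b) P')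
    (hb : b ∉ H ∪ G) :
    ∃ Q₂ Q', Taus Q Q₂ ∧ EnvEq P Q₂ ∧ Step Q₂ (.inp a b) Q' ∧ EnvEq P' Q' := by
  have ha : a ∉ H ∪ G := Finset.disjoint_left.1 hP hs.inp_subj_mem
  obtain ⟨h, hh⟩ := exists_fresh (H ∪ G ∪ cs.toFinset ∪ T.gn ∪ (P.gn ∪ Q.gn ∪ {a, b}))
  obtain ⟨g, hg⟩ := exists_fresh (H ∪ G ∪ cs.toFinset ∪ T.gn ∪ (P.gn ∪ Q.gn ∪ {a, b, h}))
  obtain ⟨d, hd⟩ := exists_fresh (H ∪ G ∪ Q.gn ∪ T.gn ∪ (sendTest a b g).gn ∪ {a, a, h} ∪ {g})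
  rw [Finset.mem_union, not_or] at hh hg hd
  have hh' := hh.2
  have hg' := hg.2
  simp only [Finset.mem_union, Finset.mem_insert, Finset.mem_singleton, not_or] at hh' hg'
  obtain ⟨⟨hhP, hhQ⟩, hha, hhb⟩ := hh'
  obtain ⟨⟨hgP, hgQ⟩, hga, hgb, hgh⟩ := hg'
  have hO : Tester a a g (sendTest a b g) := tester_sendTest hga hgb
  have hh'' := hh.1
  have hg'' := hg.1
  have ha' := ha
  have hb' := hb
  simp only [Finset.mem_union, not_or] at hh'' hg'' ha' hb'
  have hDG : Disjoint (Term.par .nil (probe a a h)).gn G :=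
    probe_disjoint (by simp [Term.gn]) ha'.2 ha'.2 hh''.1.1.2
  have hE := hT.add_probe hg.1 hh.1 hgh ha'.2 ha'.2
  have disj : ∀ {S S' : Proc}, Step S (.inp a b) S' → Disjoint S.gn (H ∪ G) → g ∉ S.gn →
      h ∉ S.gn → Disjoint S'.gn (H ∪ {h} ∪ insert g G) := fun {S S'} hs hS hg hh =>
    hs.disjoint hS (by simp [Act.names, ha', hb']) (by simp [Act.names, hg, hga, hgb])
      (by simp [Act.names, hh, hha, hhb])
  have hP' := disj hs hP hgP hhP
  have hA : Tau (cfg cs P (.par T (.par (sendTest a b g) (probe a a h))))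
      (cfg cs P' (.par T (.par .nil (probe a a h)))) :=
    Tau.nus cs (.commR hs (.parR (.parL (sendTest_fst a b g) (by simp [Act.bn]))
      (by simp [Act.bn])))
  have hsil : g ∉ (cfg cs P' (.par T (.par .nil (probe a a h)))).gn := by
    have : g ∉ P'.gn := fun h => Finset.disjoint_left.1 hP' h (by simp)
    simp [cfg, gn_nus, Term.gn, gn_probe, this, hg'', hga, hgh]
  obtain ⟨Q₂, O', Q', h1, h2, h3, h4⟩ := hT.test hP hQ hPQ hO hg.1 hh.1 hgh (Ne.symm hha) hga hga
    (by simp [gn_sendTest, ha', hb', hg'']) ha ha'.2 hgP hgQ hhP hhQ hA (.of_notMem hsil)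
    (undecided_cfg_par (hP'.mono_right fun x hx => by simp [hx]) hDG hT.notMem) hd.1
    (by simpa using hd.2)
  refine ⟨Q₂, Q', h1, h2, ?_⟩
  rcases h4 with ⟨b', h4, h5, h6⟩ | ⟨b', _, h5, _⟩ | ⟨_, h5, _⟩
  · obtain ⟨e, rfl | rfl⟩ := sendTest_cases h5
    · cases e
      exact ⟨h4, cs, _, _, _, hE, hP', disj h4 (Taus.disjoint h1 hQ)
        (fun h => hgQ (h1.gn_subset h)) (fun h => hhQ (h1.gn_subset h)), h6⟩
    · exact (h3 .sig).elim
  all_goals obtain ⟨e, _⟩ := sendTest_cases h5; cases e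

/-! ### Testing outputs and bound outputs -/

/-- The signal on `g`, guarded by the test that the received name differs from `b`. -/
def sigUnless (b g : Name) : Term 1 := .mis (.bound 0) (.free b) (sig g)

theorem sigUnless_inst (b g x : Name) :
    (sigUnless b g).inst x = .mis (.free x) (.free b) (sig g) := by
  simp [sigUnless, sig, Term.inst, Term.map, instNm]

theorem sigUnless_self (b g : Name) : AbsEq ((sigUnless b g).inst b) .nil := by
  rw [sigUnless_inst]
  refine absEq_nil_of_stuck fun l X h => ?_
  cases h
  exact absurd rfl ‹b ≠ b›

theorem sigUnless_ne {b g x : Name} (h : x ≠ b) : Loud g ((sigUnless b g).inst x) := by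
  rw [sigUnless_inst]
  exact .mis h .sig

theorem gn_sigUnless (b g : Name) : (sigUnless b g).gn = {b, g} := by
  ext x
  simp [sigUnless, sig, Term.gn, Nm.gn]

/-- The signal on `g`, guarded by the test that the received name is in the list `ns`. -/
def sigIfMem (g : Name) : List Name → Term 1
  | [] => .nil
  | n :: ns => .par (.mat (.bound 0) (.free n) (sig g)) (sigIfMem g ns)

theorem sigIfMem_inst_cons (g n x : Name) (ns : List Name) : (sigIfMem g (n :: ns)).inst x =
    .par (.mat (.free x) (.free n) (sig g)) ((sigIfMem g ns).inst x) := by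
  simp [sigIfMem, sig, Term.inst, Term.map, instNm]

theorem sigIfMem_mem {g x : Name} {ns : List Name} (h : x ∈ ns) :
    Loud g ((sigIfMem g ns).inst x) := by
  induction ns with
  | nil => simp at h
  | cons n ns ih =>
    rw [sigIfMem_inst_cons]
    rcases List.mem_cons.1 h with rfl | h
    · exact .parL _ (.mat _ .sig)
    · exact .parR _ (ih h)

theorem sigIfMem_notMem {g x : Name} {ns : List Name} (h : x ∉ ns) :
    AbsEq ((sigIfMem g ns).inst x) .nil := by
  induction ns with
  | nil => exact .refl _
  | cons n ns ih =>
    rw [sigIfMem_inst_cons]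
    simp only [List.mem_cons, not_or] at h
    refine AbsEq.trans (.par (absEq_nil_of_stuck fun l X hs => ?_) (ih h.2)) (SC.par_nil _).absEq
    cases hs
    exact h.1 rfl

theorem gn_sigIfMem_subset (g : Name) (ns : List Name) :
    (sigIfMem g ns).gn ⊆ insert g ns.toFinset := by
  induction ns with
  | nil => simp [sigIfMem, Term.gn]
  | cons n ns ih =>
    intro x hx
    simp only [sigIfMem, sig, Term.gn, Nm.gn, Finset.mem_union, Finset.mem_singleton,
      Finset.notMem_empty, false_or, or_false] at hx
    simp only [List.toFinset_cons, Finset.mem_insert]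
    rcases hx with (h | h) | h
    · exact .inr (.inl h)
    · exact .inl (by tauto)
    · exact (Finset.mem_insert.1 (ih h)).imp_right .inr

/-- The output of `b` is tested by a receiver that activates its signal unless it receives `b`. When
it does receive `b`, the receiver becomes a stuck process. -/
theorem Env.sim_out {cs : List Name} {H G : Finset Name} {T P Q P' : Proc} (hT : Env cs H G T)
    (hP : Disjoint P.gn (H ∪ G)) (hQ : Disjoint Q.gn (H ∪ G))
    (hPQ : AbsEq (cfg cs P T) (cfg cs Q T)) {a b : Name} (hs : Step P (.out a b) P') :
    ∃ Q₂ Q', Taus Q Q₂ ∧ EnvEq P Q₂ ∧ Step Q₂ (.out a b) Q' ∧ EnvEq P' Q' := by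
  have ha : a ∉ H ∪ G := Finset.disjoint_left.1 hP hs.out_subj_mem
  have hb : b ∉ H ∪ G := Finset.disjoint_left.1 hP hs.obj_mem
  obtain ⟨h, hh⟩ := exists_fresh (H ∪ G ∪ cs.toFinset ∪ T.gn ∪ (P.gn ∪ Q.gn ∪ {a, b}))
  obtain ⟨g, hg⟩ := exists_fresh (H ∪ G ∪ cs.toFinset ∪ T.gn ∪ (P.gn ∪ Q.gn ∪ {a, b, h}))
  obtain ⟨d, hd⟩ := exists_fresh (H ∪ G ∪ Q.gn ∪ T.gn ∪ (recvTest a (sigUnless b g) g).gn ∪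
    {a, b, h} ∪ {g})
  rw [Finset.mem_union, not_or] at hh hg hd
  have hdb : d ≠ b := by
    rintro rfl
    exact hd.1 (by simp)
  have hh' := hh.2
  have hg' := hg.2
  simp only [Finset.mem_union, Finset.mem_insert, Finset.mem_singleton, not_or] at hh' hg'
  obtain ⟨⟨hhP, hhQ⟩, hha, hhb⟩ := hh'
  obtain ⟨⟨hgP, hgQ⟩, hga, hgb, hgh⟩ := hg'
  have hsil₀ : Silent g ((sigUnless b g).inst b) :=
    (Silent.of_notMem (by simp [Term.gn])).congr (sigUnless_self b g).symm
  have hO : Tester a b g (recvTest a (sigUnless b g) g) := by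
    refine tester_recvTest hga (fun x _ => ?_) hsil₀
    by_cases hx : x = b
    · exact .inl (by rwa [hx])
    · exact .inr (sigUnless_ne hx)
  have hh'' := hh.1
  have hg'' := hg.1
  have ha' := ha
  have hb' := hb
  simp only [Finset.mem_union, not_or] at hh'' hg'' ha' hb'
  have hDG : Disjoint (Term.par .nil (probe a b h)).gn G :=
    probe_disjoint (by simp [Term.gn]) ha'.2 hb'.2 hh''.1.1.2
  have hE := hT.add_probe hg.1 hh.1 hgh ha'.2 hb'.2
  have disj : ∀ {S S' : Proc}, Step S (.out a b) S' → Disjoint S.gn (H ∪ G) → g ∉ S.gn →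
      h ∉ S.gn → Disjoint S'.gn (H ∪ {h} ∪ insert g G) := fun {S S'} hs hS hg hh =>
    hs.disjoint hS (by simp [Act.names, ha', hb']) (by simp [Act.names, hg, hga, hgb])
      (by simp [Act.names, hh, hha, hhb])
  have hP' := disj hs hP hgP hhP
  have hA : Tau (cfg cs P (.par T (.par (recvTest a (sigUnless b g) g) (probe a b h))))
      (cfg cs P' (.par T (.par ((sigUnless b g).inst b) (probe a b h)))) :=
    Tau.nus cs (.commL hs (.parR (.parL (recvTest_fst a g _ b) (by simp [Act.bn]))
      (by simp [Act.bn])))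
  have heq : ∀ S, AbsEq (cfg cs S (.par T (.par .nil (probe a b h))))
      (cfg cs S (.par T (.par ((sigUnless b g).inst b) (probe a b h)))) := fun S =>
    AbsEq.cfg cs S ((AbsEq.refl T).par ((sigUnless_self b g).symm.par (.refl _)))
  have hsil : g ∉ (cfg cs P' (.par T (.par .nil (probe a b h)))).gn := by
    have : g ∉ P'.gn := fun h => Finset.disjoint_left.1 hP' h (by simp)
    simp [cfg, gn_nus, Term.gn, gn_probe, this, hg'', hga, hgb, hgh]
  obtain ⟨Q₂, O', Q', h1, h2, h3, h4⟩ := hT.test hP hQ hPQ hO hg.1 hh.1 hgh (Ne.symm hha) hga hgb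
    (by simp [gn_recvTest, gn_sigUnless, ha', hb', hg'']) ha hb'.2 hgP hgQ hhP hhQ hA
    ((Silent.of_notMem hsil).congr (heq P')) (fun x hx ht => (undecided_cfg_par
      (hP'.mono_right fun x hx => by simp [hx]) hDG hT.notMem x hx ht).congr (heq P')) hd.1
    (by simpa using hd.2)
  refine ⟨Q₂, Q', h1, h2, ?_⟩
  rcases h4 with ⟨b', _, h5, _⟩ | ⟨b', h4, h5, h6⟩ | ⟨_, h5, _⟩
  · obtain ⟨x, e, _⟩ := recvTest_cases h5
    cases e
  · obtain ⟨x, e, rfl | rfl⟩ := recvTest_cases h5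
    · cases e
      by_cases hx : b' = b
      · subst hx
        exact ⟨h4, cs, _, _, _, hE, hP', disj h4 (Taus.disjoint h1 hQ)
          (fun h => hgQ (h1.gn_subset h)) (fun h => hhQ (h1.gn_subset h)),
          (heq P').trans (h6.trans (heq Q').symm)⟩
      · exact (h3 (sigUnless_ne hx)).elim
    · exact (h3 .sig).elim
  · obtain ⟨x, e, rfl | rfl⟩ := recvTest_cases h5
    · cases e
      exact (h3 (sigUnless_ne hdb)).elim
    · exact (h3 .sig).elim

/-- Signal when the received name is in `ns`; otherwise offer it on `e` from now on. -/
def shareUnless (ns : List Name) (e g : Name) : Term 1 :=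
  .par (sigIfMem g ns) (.repOut (.free e) (.bound 0) .nil)

/-- The server that offers the name `c` on the channel `e`. -/
def server (e c : Name) : Proc := .repOut (.free e) (.free c) .nil

theorem server_step (e c : Name) : Step (server e c) (.out e c) (.par .nil (server e c)) :=
  .repOut e c .nil

theorem server_cases {e c : Name} {l : Act} {X : Proc} (h : Step (server e c) l X) :
    l = .out e c ∧ X = .par .nil (server e c) := by
  generalize hS : server e c = S at h
  cases h <;> cases hS
  exact ⟨rfl, rfl⟩

theorem gn_server (e c : Name) : (server e c).gn = {e, c} := by
  ext x
  simp [server, Term.gn, Nm.gn]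

theorem shareUnless_inst (ns : List Name) (e g x : Name) :
    (shareUnless ns e g).inst x = .par ((sigIfMem g ns).inst x) (server e x) := by
  simp [shareUnless, server, Term.inst, Term.map, instNm]

theorem shareUnless_mem {ns : List Name} {e g x : Name} (h : x ∈ ns) :
    Loud g ((shareUnless ns e g).inst x) := by
  rw [shareUnless_inst]
  exact .parL _ (sigIfMem_mem h)

theorem shareUnless_notMem {ns : List Name} {e g x : Name} (h : x ∉ ns) :
    AbsEq ((shareUnless ns e g).inst x) (server e x) := by
  rw [shareUnless_inst]
  exact ((sigIfMem_notMem h).par (.refl _)).trans ((SC.comm _ _).trans (SC.par_nil _)).absEq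

theorem gn_shareUnless_subset (ns : List Name) (e g : Name) :
    (shareUnless ns e g).gn ⊆ insert g (insert e ns.toFinset) := by
  intro x hx
  simp only [shareUnless, Term.gn, Nm.gn, Finset.mem_union, Finset.mem_singleton,
    Finset.notMem_empty, or_false] at hx
  rcases hx with h | h
  · have := gn_sigIfMem_subset g ns h
    simp only [Finset.mem_insert] at this ⊢
    tauto
  · simp [h]

/-- A server for a new local name `c` next to a locked probe. -/
theorem Env.add_server {cs : List Name} {H G : Finset Name} {T : Proc} (hT : Env cs H G T)
    {a o g h e c : Name} (hg : g ∉ H ∪ G ∪ cs.toFinset ∪ T.gn)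
    (hh : h ∉ H ∪ G ∪ cs.toFinset ∪ T.gn) (he : e ∉ H ∪ G ∪ cs.toFinset ∪ T.gn)
    (hgh : g ≠ h) (hge : g ≠ e) (heh : e ≠ h) (hc : c ∉ H ∪ G) (hcg : c ≠ g) (hch : c ≠ h)
    (hce : c ≠ e) (ha : a ∉ G) (ho : o ∉ G) :
    Env (c :: cs) (H ∪ {h, e}) (insert g G) (.par T (.par (server e c) (probe a o h))) := by
  simp only [Finset.mem_union, not_or] at hg hh he hc
  have hD : ∀ {l D'}, Step (.par (server e c) (probe a o h)) l D' →
      (∃ b, l = .inp h b) ∨ (l = .out e c ∧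
        D' = .par (.par .nil (server e c)) (probe a o h)) := fun {l D'} hs => by
    refine hs.par_cases ∅ ?_ ?_ ?_ ?_ ?_ ?_
    · intro D' h' _ _
      obtain ⟨b, rfl⟩ := probe_cases h'
      exact .inl ⟨b, rfl⟩
    · rintro D' h' _ rfl
      obtain ⟨rfl, rfl⟩ := server_cases h'
      exact .inr ⟨rfl, rfl⟩
    · intro x b D' X _ h'
      obtain ⟨h', _⟩ := server_cases h'
      cases h'
    · intro x b D' X _ h1 h2
      obtain ⟨h', _⟩ := server_cases h1
      cases h'
      obtain ⟨b', h'⟩ := probe_cases h2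
      cases h'
      exact (heh rfl).elim
    all_goals
      intro x b D' X _ h'
      obtain ⟨h', _⟩ := server_cases h'
      cases h'
  have hE : Env cs (H ∪ {h, e}) (insert g G) (.par T (.par (server e c) (probe a o h))) := by
    refine hT.add_locked ?_ ?_ (probe_disjoint (by simp [gn_server, he, hc]) ha ho hh.1.1.2)
      fun {l D'} hs => ?_
    · simpa [hgh, hge] using ⟨hg.1.1.1, by simpa using hg.1.2, hg.2⟩
    · simp only [List.mem_toFinset] at he hh
      simp [he, hh]
    · rcases hD hs with ⟨b, rfl⟩ | ⟨rfl, _⟩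
      · exact ⟨h, by simp, b, .inl rfl⟩
      · exact ⟨e, by simp, c, .inr rfl⟩
  refine hE.cons (e := e) (by simp [hc, hch, hce]) (by simp [hc, hcg]) (by simp)
    ⟨_, .parR (.parL (server_step e c) (by simp [Act.bn])) (by simp [Act.bn])⟩ ?_
  intro c' T' hs
  refine hs.par_cases ∅ ?_ ?_ ?_ ?_ ?_ ?_
  · rintro D' k _ rfl
    rcases hD k with ⟨b, h'⟩ | ⟨h', rfl⟩
    · cases h'
    · obtain rfl : c' = c := by injection h'
      exact ⟨rfl, (AbsEq.refl T).par (.par ((SC.comm _ _).trans (SC.par_nil _)).absEq (.refl _))⟩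
  · intro T'' h'
    exact (he.2 h'.out_subj_mem).elim
  all_goals intro _ _ _ _ h'; cases h'

/-- The bound output of `c` is tested by a receiver that activates its signal when it receives a
global name of `Q`. Otherwise it becomes a server for the received name, so that `c` can be added to
the shared local names. -/
theorem Env.sim_bout {cs : List Name} {H G : Finset Name} {T P Q P' : Proc} (hT : Env cs H G T)
    (hP : Disjoint P.gn (H ∪ G)) (hQ : Disjoint Q.gn (H ∪ G))
    (hPQ : AbsEq (cfg cs P T) (cfg cs Q T)) {a c : Name} (hs : Step P (.bout a c) P')
    (hc : c ∉ H ∪ G ∪ Q.gn ∪ T.gn) :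
    ∃ Q₂ Q', Taus Q Q₂ ∧ EnvEq P Q₂ ∧ Step Q₂ (.bout a c) Q' ∧ EnvEq P' Q' := by
  have ha : a ∉ H ∪ G := Finset.disjoint_left.1 hP hs.bout_subj_mem
  have hac := hs.bout_ne
  obtain ⟨h, hh⟩ := exists_fresh (H ∪ G ∪ cs.toFinset ∪ T.gn ∪ (P.gn ∪ Q.gn ∪ {a, c}))
  obtain ⟨e, he⟩ := exists_fresh (H ∪ G ∪ cs.toFinset ∪ T.gn ∪ (P.gn ∪ Q.gn ∪ {a, c, h}))
  obtain ⟨g, hg⟩ := exists_fresh (H ∪ G ∪ cs.toFinset ∪ T.gn ∪ (P.gn ∪ Q.gn ∪ {a, c, h, e}))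
  rw [Finset.mem_union, not_or] at hh he hg
  have hh' := hh.2
  have he' := he.2
  have hg' := hg.2
  simp only [Finset.mem_union, Finset.mem_insert, Finset.mem_singleton, not_or] at hh' he' hg'
  obtain ⟨⟨hhP, hhQ⟩, hha, hhc⟩ := hh'
  obtain ⟨⟨heP, heQ⟩, hea, hec, heh⟩ := he'
  obtain ⟨⟨hgP, hgQ⟩, hga, hgc, hgh, hge⟩ := hg'
  have hh'' := hh.1
  have he'' := he.1
  have hg'' := hg.1
  have ha' := ha
  have hc' := hc
  simp only [Finset.mem_union, not_or] at hh'' he'' hg'' ha' hc'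
  -- The probe sends its own key `h` to the tester, a name that is not global in `Q`.
  set ns := Q.gn.toList with hns
  have hmem : ∀ {x}, x ∈ ns ↔ x ∈ Q.gn := by simp [hns]
  set M := shareUnless ns e g with hM
  have hsil₀ : ∀ {x}, x ∉ Q.gn → x ≠ g → Silent g (M.inst x) := fun hx hxg =>
    (Silent.of_notMem (by simp [gn_server, hge, Ne.symm hxg])).congr
      (shareUnless_notMem (fun h => hx (hmem.1 h))).symm
  have hO : Tester a h g (recvTest a M g) := by
    refine tester_recvTest hga (fun x hxg => ?_) (hsil₀ hhQ (Ne.symm hgh))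
    by_cases hx : x ∈ Q.gn
    · exact .inr (shareUnless_mem (hmem.2 hx))
    · exact .inl (hsil₀ hx hxg)
  have hOgn : ∀ x ∈ (recvTest a M g).gn, x = a ∨ x = g ∨ x = e ∨ x ∈ Q.gn := fun x hx => by
    rw [gn_recvTest] at hx
    simp only [Finset.mem_union, Finset.mem_insert, Finset.mem_singleton] at hx
    rcases hx with (h | h) | h
    · exact .inl h
    · exact .inr (.inl h)
    · have := gn_shareUnless_subset _ _ _ h
      simp only [Finset.mem_insert, List.mem_toFinset, hmem] at this
      tauto
  have hOG : Disjoint (recvTest a M g).gn (H ∪ G) := by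
    refine Finset.disjoint_left.2 fun x hx => ?_
    rcases hOgn x hx with rfl | rfl | rfl | h
    · exact ha
    · simp [hg'']
    · simp [he'']
    · exact Finset.disjoint_left.1 hQ h
  have hcO : c ∉ (recvTest a M g).gn := fun hx => by
    rcases hOgn c hx with h | h | h | h
    · exact hac h.symm
    · exact hgc h.symm
    · exact hec h.symm
    · exact hc'.1.2 h
  have hDG : Disjoint (Term.par (server e c) (probe a h h)).gn G :=
    probe_disjoint (by simp [gn_server, he'', hc']) ha'.2 hh''.1.1.2 hh''.1.1.2
  have hE := hT.add_server (a := a) (o := h) hg.1 hh.1 he.1 hgh hge heh (c := c) (by simp [hc'])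
    (Ne.symm hgc) (Ne.symm hhc) (Ne.symm hec) ha'.2 hh''.1.1.2
  have disj : ∀ {S S' : Proc}, Step S (.bout a c) S' → Disjoint S.gn (H ∪ G) → g ∉ S.gn →
      h ∉ S.gn → e ∉ S.gn → Disjoint S'.gn (H ∪ {h, e} ∪ insert g G) :=
    fun {S S'} hs hS hg hh he =>
    hs.disjoint hS (by simp [Act.names, ha', hc']) (by simp [Act.names, hg, hga, hgc])
      (by simp [Act.names, hh, he, Ne.symm hha, Ne.symm hhc, Ne.symm hea, Ne.symm hec])
  have hP' := disj hs hP hgP hhP heP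
  have hA : Tau (cfg cs P (.par T (.par (recvTest a M g) (probe a h h))))
      (cfg (c :: cs) P' (.par T (.par (M.inst c) (probe a h h)))) := by
    refine Tau.nus cs (.closeL hs (.parR (.parL (recvTest_fst a g _ c) (by simp [Act.bn]))
      (by simp [Act.bn])) ?_)
    simp only [Term.gn, gn_probe, Finset.mem_union, not_or, Finset.mem_insert,
      Finset.mem_singleton]
    exact ⟨hc'.2, hcO, Ne.symm hac, Ne.symm hhc, Ne.symm hhc⟩
  have heq : ∀ S, AbsEq (cfg (c :: cs) S (.par T (.par (server e c) (probe a h h))))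
      (cfg (c :: cs) S (.par T (.par (M.inst c) (probe a h h)))) := fun S =>
    AbsEq.cfg _ S ((AbsEq.refl T).par
      ((shareUnless_notMem (fun h => hc'.1.2 (hmem.1 h))).symm.par (.refl _)))
  have hsil : g ∉ (cfg (c :: cs) P' (.par T (.par (server e c) (probe a h h)))).gn := by
    have : g ∉ P'.gn := fun h => Finset.disjoint_left.1 hP' h (by simp)
    simp [cfg, gn_nus, Term.gn, gn_probe, gn_server, this, hg'', hga, hgc, hgh, hge]
  obtain ⟨Q₂, O', Q', h1, h2, h3, h4⟩ := hT.test hP hQ hPQ hO hg.1 hh.1 hgh (Ne.symm hha) hga hgh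
    hOG ha hh''.1.1.2 hgP hgQ hhP hhQ hA ((Silent.of_notMem hsil).congr (heq P'))
    (fun x hx ht => (undecided_cfg_par (hP'.mono_right fun x hx => by simp [hx]) hDG
      (List.forall_mem_cons.2 ⟨by simp [hc'], hT.notMem⟩) x hx ht).congr (heq P'))
    (d := c) (by
      rw [Finset.mem_union, Finset.mem_union, not_or, not_or]
      exact ⟨⟨hc, hcO⟩, by simp [Ne.symm hac, Ne.symm hhc]⟩) (Ne.symm hgc)
  refine ⟨Q₂, Q', h1, h2, ?_⟩
  rcases h4 with ⟨b', _, h5, _⟩ | ⟨b', h4, h5, h6⟩ | ⟨h4, h5, h6⟩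
  · obtain ⟨x, e, _⟩ := recvTest_cases h5
    cases e
  · obtain ⟨x, e, rfl | rfl⟩ := recvTest_cases h5
    · cases e
      exact (h3 (shareUnless_mem (hmem.2 (h1.gn_subset h4.obj_mem)))).elim
    · exact (h3 .sig).elim
  · obtain ⟨x, ex, rfl | rfl⟩ := recvTest_cases h5
    · cases ex
      exact ⟨h4, c :: cs, _, _, _, hE, hP', disj h4 (Taus.disjoint h1 hQ)
        (fun h => hgQ (h1.gn_subset h)) (fun h => hhQ (h1.gn_subset h))
        (fun h => heQ (h1.gn_subset h)), (heq P').trans (h6.trans (heq Q').symm)⟩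
    · exact (h3 .sig).elim

/-! ### Renaming the names of an action apart from the environment -/

/-- `EnvEq` up to injective renaming. The names of an action can then be chosen outside the
environment. -/
def RenEq (P Q : Proc) : Prop := ∃ σ : Equiv.Perm Name, EnvEq (P.ren σ) (Q.ren σ)

theorem EnvEq.renEq {P Q : Proc} (h : EnvEq P Q) (σ : Equiv.Perm Name) :
    RenEq (P.ren σ) (Q.ren σ) := ⟨σ⁻¹, by simpa using h⟩

/-- The image of `x` can be moved out of `F` without changing the permutation on `S`. -/
theorem exists_perm_apply_notMem (σ : Equiv.Perm Name) (S F : Finset Name) {x : Name}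
    (hx : x ∉ S) : ∃ τ : Equiv.Perm Name, (∀ y ∈ S, τ y = σ y) ∧ τ x ∉ F := by
  obtain ⟨b, hb⟩ := exists_fresh (F ∪ S.image σ)
  simp only [Finset.mem_union, Finset.mem_image, not_or, not_exists, not_and] at hb
  refine ⟨Equiv.swap (σ x) b * σ, fun y hy => ?_, by simpa using hb.1⟩
  refine Equiv.swap_apply_of_ne_of_ne (fun h => hx (σ.injective h ▸ hy)) (hb.2 y hy)

/-- Answers to a renamed action, renamed back. -/
theorem RenEq.rename {P Q P' : Proc} {l : Act} {σ τ : Equiv.Perm Name}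
    (hQ : ∀ x ∈ Q.gn, τ x = σ x)
    (h : ∃ Q₂ Q', Taus (Q.ren σ) Q₂ ∧ EnvEq (P.ren σ) Q₂ ∧ Step Q₂ (l.ren τ) Q' ∧
      EnvEq (P'.ren τ) Q') :
    ∃ Q₂ Q', Taus Q Q₂ ∧ RenEq P Q₂ ∧ Step Q₂ l Q' ∧ RenEq P' Q' := by
  obtain ⟨Q₂, Q', h1, h2, h3, h4⟩ := h
  have hσ : Q₂.ren τ⁻¹ = Q₂.ren σ⁻¹ := by
    refine Term.ren_congr fun x hx => ?_
    have := h1.gn_subset hx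
    rw [Term.gn_ren] at this
    obtain ⟨y, hy, rfl⟩ := Finset.mem_image.1 this
    rw [Equiv.Perm.inv_eq_iff_eq, ← hQ y hy, hQ y hy, Equiv.Perm.inv_def, Equiv.symm_apply_apply,
      hQ y hy]
  refine ⟨Q₂.ren σ⁻¹, Q'.ren τ⁻¹, by simpa using h1.ren σ⁻¹, by simpa using h2.renEq σ⁻¹, ?_,
    by simpa using h4.renEq τ⁻¹⟩
  rw [← hσ]
  simpa [Act.ren_ren] using h3.ren τ⁻¹

/-- Inputs of names that the environment knows, and bound outputs whose name clashes, are renamed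
before they are tested. -/
theorem RenEq.simAt {P Q : Proc} (h : RenEq P Q) : SimAt RenEq P Q := by
  obtain ⟨σ, h⟩ := h
  intro l P' hs hd
  cases l with
  | tau =>
    rcases h.tau (Tau.ren hs σ) with ⟨Q', h1, h2, h3⟩ | ⟨Q₂, Q', h1, h2, h3, h4⟩
    · exact .inl ⟨rfl, Q'.ren σ⁻¹, by simpa using h1.ren σ⁻¹, by simpa using h2.renEq σ⁻¹,
        by simpa using h3.renEq σ⁻¹⟩
    · exact .inr ⟨Q₂.ren σ⁻¹, Q'.ren σ⁻¹, by simpa using h1.ren σ⁻¹, by simpa using h2.renEq σ⁻¹,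
        Tau.ren h3 σ⁻¹, by simpa using h4.renEq σ⁻¹⟩
  | inp a b =>
    right
    obtain ⟨cs, H, G, T, hT, hP, hQ, h⟩ := h
    obtain ⟨τ, h1, h2⟩ : ∃ τ : Equiv.Perm Name, (∀ x ∈ P.gn ∪ Q.gn, τ x = σ x) ∧
        τ b ∉ H ∪ G := by
      by_cases hb : b ∈ P.gn ∪ Q.gn
      · refine ⟨σ, fun _ _ => rfl, ?_⟩
        rcases Finset.mem_union.1 hb with hb | hb
        · exact Finset.disjoint_left.1 hP (by simp [hb])
        · exact Finset.disjoint_left.1 hQ (by simp [hb])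
      · exact exists_perm_apply_notMem σ _ _ hb
    refine RenEq.rename (σ := σ) (τ := τ) (fun x hx => h1 x (by simp [hx])) ?_
    refine hT.sim_inp hP hQ h ?_ h2
    have := hs.ren τ
    rwa [Term.ren_congr (τ := σ) fun x hx => h1 x (by simp [hx])] at this
  | out a b =>
    right
    obtain ⟨cs, H, G, T, hT, hP, hQ, h⟩ := h
    exact RenEq.rename (σ := σ) (τ := σ) (fun _ _ => rfl) (hT.sim_out hP hQ h (hs.ren σ))
  | bout a c =>
    right
    obtain ⟨cs, H, G, T, hT, hP, hQ, h⟩ := h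
    simp only [Act.bn, Finset.disjoint_singleton_left] at hd
    obtain ⟨τ, h1, h2⟩ := exists_perm_apply_notMem σ (P.gn.erase c ∪ Q.gn)
      (H ∪ G ∪ (Q.ren σ).gn ∪ T.gn ∪ (P.ren σ).gn) (x := c) (by simp [hd])
    rw [Finset.mem_union, not_or] at h2
    refine RenEq.rename (σ := σ) (τ := τ) (fun x hx => h1 x (by simp [hx])) ?_
    refine hT.sim_bout hP hQ h ?_ h2.1
    refine hs.ren_ren σ τ (fun x hx hxc => ?_) fun x hx => .inr ?_
    · exact (h1 x (by simp [hx, show x ≠ c by simpa [Act.bn] using hxc])).symm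
    · obtain rfl := Finset.mem_singleton.1 hx
      exact h2.2

theorem RenEq.isPiBisimulation : IsPiBisimulation RenEq := by
  refine .of_symm ?_ RenEq.simAt ?_
  · rintro P Q ⟨σ, h⟩
    exact ⟨σ, h.symm⟩
  · rintro P Q ⟨σ, h⟩ s h0 hs
    obtain ⟨k, Q', hk, h1, h2⟩ := h.codivAt (fun i => (s i).ren σ) (by rw [h0])
      fun i => Tau.ren (hs i) σ
    exact ⟨k, Q'.ren σ⁻¹, hk, by simpa using h1.ren σ⁻¹, by simpa using h2.renEq σ⁻¹⟩

/-- Absolutely equal processes are absolutely equal in the empty environment. -/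
theorem AbsEq.piBisimilar {P Q : Proc} (h : AbsEq P Q) : PiBisimilar P Q :=
  ⟨RenEq, RenEq.isPiBisimulation, 1, [], ∅, ∅, .nil, .nil, by simp, by simp, by
    rw [Term.ren_one, Term.ren_one]
    exact h.par (.refl .nil)⟩

end PiCalc

theorem mainTheorem2 :
    IsGreatest {R : PiCalc.Proc → PiCalc.Proc → Prop | PiCalc.IsPiBisimulation R}
      PiCalc.PiBisimilar ∧
    IsGreatest {R : PiCalc.Proc → PiCalc.Proc → Prop | PiCalc.IsAbsolute R} PiCalc.AbsEq ∧
    ∀ P Q : PiCalc.Proc, PiCalc.PiBisimilar P Q ↔ PiCalc.AbsEq P Q :=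
  ⟨⟨PiCalc.piBisimilar_isPiBisimulation, fun R hR _ _ h => ⟨R, hR, h⟩⟩,
    ⟨PiCalc.absEq_isAbsolute, fun R hR _ _ h => ⟨R, hR, h⟩⟩,
    fun _ _ => ⟨PiCalc.PiBisimilar.absEq, PiCalc.AbsEq.piBisimilar⟩⟩
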